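/- Let $\mu_0,\mu_1$ be absolutely continuous probability measures on $\mathbb{R}$ with convex supports, whose densities $\bar\mu_0,\bar\mu_1$ are continuous and positive on the respective (closed) supports and vanish outside them. For such measures $\mu_0,\nu$, the monotone transport map from $\mu_0$ to $\nu$ is the non-decreasing continuous map $T:\operatorname{supp}\mu_0\to\mathbb{R}$ with $T_\#\mu_0=\nu$, if it exists, and $K_\nu$ denotes $\operatorname{Conv}(\operatorname{supp}\mu_0\cup\operatorname{supp}\nu)$. We say that a velocity field $v:K_\nu\to\mathbb{R}$ realizes the monotone map from $\mu_0$ to $\nu$ if this map $T$ exists (with finite values on all of $\operatorname{supp}\mu_0$), $v$ is continuous on $K_\nu$, $v=0$ on the set $\mathcal S=\{x\in\operatorname{supp}\mu_0: T(x)=x\}$ of fixed points and $|v|>0$ on $K_\nu\setminus\mathcal S$, and for every $x\in\operatorname{supp}\mu_0$ the problem \[ \phi(t,x)=x+\int_0^t v(\phi(s,x))\,ds ,\qquad t\in[0,1], \] has a unique solution $\phi(\cdot,x)$ with values in $K_\nu$ (and every $K_\nu$-valued solution on a shorter interval $[0,\tau]$ coincides with it there), and $\phi(1,x)=T(x)$.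 Let $\varepsilon>0$. (1) There exist a measure $\mu_1^\varepsilon$ satisfying the same hypotheses as $\mu_1$, with $\|\bar\mu_1-\bar\mu_1^\varepsilon\|_{L^1(\mathbb{R})}<\varepsilon$, and a continuous velocity field $v^\varepsilon:K_{\mu_1^\varepsilon}\to\mathbb{R}$ that realizes the monotone map from $\mu_0$ to $\mu_1^\varepsilon$. If, furthermore, $\bar\mu_0$ is Lipschitz continuous on $\operatorname{supp}\mu_0$, then $v^\varepsilon$ can be taken (globally) Lipschitz continuous on $K_{\mu_1^\varepsilon}$. (2) Let $1\le p<\infty$ and suppose that $\mu_1$ has finite $p$-th moment. There exist a measure $\mu_1^\varepsilon$ satisfying the same hypotheses as $\mu_1$ (continuity and positivity of the density, convexity of the support), with $W_p(\mu_1,\mu_1^\varepsilon)<\varepsilon$ for the $p$-Wasserstein distance, and a continuous velocity field $v^\varepsilon:K_{\mu_1^\varepsilon}\to\mathbb{R}$ that realizes the monotone map from $\mu_0$ to $\mu_1^\varepsilon$. If, furthermore, $\bar\mu_0$ is Lipschitz continuous on $\operatorname{supp}\mu_0$, then $v^\varepsilon$ can be taken locally Lipschitz continuous on $K_{\mu_1^\varepsilon}$,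 and (globally) Lipschitz continuous if also $\mu_0$ has finite $p$-th moment. -/

import Mathlib

open MeasureTheory Set
open scoped ENNReal NNReal

noncomputable section

namespace AutonomousTransport

/-- `μ` is an absolutely continuous probability measure on the line with convex (closed) support,
and `f` is its density: it vanishes off the support and is continuous and positive on it. -/
structure IsAdmissible (μ : Measure ℝ) (f : ℝ → ℝ) : Prop where
  isProbabilityMeasure : IsProbabilityMeasure μ
  eq_withDensity : μ = volume.withDensity (fun x => ENNReal.ofReal (f x))
  eq_zero_off_support : ∀ x ∉ μ.support, f x = 0
  convex_support : Convex ℝ μ.support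
  continuousOn : ContinuousOn f μ.support
  pos_on_support : ∀ x ∈ μ.support, 0 < f x

/-- `μ` has finite `p`-th moment. -/
def FiniteMoment (p : ℝ) (μ : Measure ℝ) : Prop :=
  ∫⁻ x, ‖x‖ₑ ^ p ∂μ < ∞

/-- `π` is a coupling (transport plan) of `μ` and `ν`. -/
def IsCoupling (μ ν : Measure ℝ) (π : Measure (ℝ × ℝ)) : Prop :=
  π.map Prod.fst = μ ∧ π.map Prod.snd = ν

/-- The Wasserstein distance `W_p` on the line, `1 ≤ p < ∞`. -/
def wassersteinDist (p : ℝ) (μ ν : Measure ℝ) : ℝ≥0∞ :=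
  (⨅ (π : Measure (ℝ × ℝ)) (_ : IsCoupling μ ν π), ∫⁻ z, edist z.1 z.2 ^ p ∂π) ^ (1 / p)

/-- The `L¹` distance of two densities. -/
def l1Dist (f g : ℝ → ℝ) : ℝ≥0∞ :=
  ∫⁻ x, ‖f x - g x‖ₑ

/-- `T` is the (continuous version of the) monotone transport map of `μ` to `ν`: a non-decreasing
continuous real-valued map on the support of `μ` which pushes `μ` forward to `ν`. -/
structure IsMonotoneTransportMap (μ ν : Measure ℝ) (T : ℝ → ℝ) : Prop where
  monotoneOn : MonotoneOn T μ.support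
  continuousOn : ContinuousOn T μ.support
  aemeasurable : AEMeasurable T μ
  map_eq : μ.map T = ν

/-- The set of fixed points of `T` in the support of `μ`. -/
def fixedPoints (μ : Measure ℝ) (T : ℝ → ℝ) : Set ℝ :=
  {x | x ∈ μ.support ∧ T x = x}

/-- The convex hull of the union of the supports of `μ` and `ν`. -/
def hull (μ ν : Measure ℝ) : Set ℝ :=
  convexHull ℝ (μ.support ∪ ν.support)

/-- `γ` solves `γ' = v(γ)`, `γ(0) = x` on `[0, τ]` for the velocity field `v` on `K`: it stays in
`K` and `γ(t) = x + ∫₀ᵗ v(γ(s)) ds` with integrable integrand (so it is absolutely continuous). -/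
structure IsSolution (K : Set ℝ) (v : ℝ → ℝ) (x τ : ℝ) (γ : ℝ → ℝ) : Prop where
  mem : ∀ t ∈ Icc 0 τ, γ t ∈ K
  integrable : IntervalIntegrable (fun s => v (γ s)) volume 0 τ
  eq_integral : ∀ t ∈ Icc 0 τ, γ t = x + ∫ s in (0 : ℝ)..t, v (γ s)

/-- `φ` is the unique flow, up to time one, of the velocity field `v` on `K` from the points of `A`:
every `φ(·, x)` with `x ∈ A` is a solution on `[0, 1]`, and any solution from `x` on an interval
`[0, τ]` with `τ ≤ 1` coincides there with `φ(·, x)`. -/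
structure IsUniqueFlow (K A : Set ℝ) (v : ℝ → ℝ) (φ : ℝ → ℝ → ℝ) : Prop where
  isSolution : ∀ x ∈ A, IsSolution K v x 1 (fun t => φ t x)
  unique : ∀ x ∈ A, ∀ τ ∈ Icc (0 : ℝ) 1, ∀ γ : ℝ → ℝ, IsSolution K v x τ γ →
    ∀ t ∈ Icc 0 τ, γ t = φ t x

/-- The velocity field `v` on the convex hull of the supports of `μ` and `ν` is continuous, has a
unique flow up to time one from the support of `μ`, the time-one map of this flow is the monotone
transport map of `μ` to `ν`, and `v` vanishes exactly at the fixed points of that map. -/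
def Realizes (μ ν : Measure ℝ) (v : ℝ → ℝ) : Prop :=
  ContinuousOn v (hull μ ν) ∧
  ∃ (T : ℝ → ℝ) (φ : ℝ → ℝ → ℝ),
    IsMonotoneTransportMap μ ν T ∧
    (∀ x ∈ fixedPoints μ T, v x = 0) ∧
    (∀ x ∈ hull μ ν \ fixedPoints μ T, 0 < |v x|) ∧
    IsUniqueFlow (hull μ ν) μ.support v φ ∧
    ∀ x ∈ μ.support, φ 1 x = T x

/-- `f` is Lipschitz continuous on `s`. -/
def IsLipschitzOn (f : ℝ → ℝ) (s : Set ℝ) : Prop :=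
  ∃ C : ℝ≥0, LipschitzOnWith C f s

end AutonomousTransport

end

/-! The construction works with the inverse transport. If `Φ` is the flow of a complete field `w`
and `D` is the derivative of `Φ 1`, then `-w` carries `μ₀` to `μ₀.map (Φ (-1))`, whose density is
`f₀ (Φ 1 y) * D y` (`IsAdmissible.map`, `IsFlowField.realizes`). It is therefore enough to find
flows for which this expression is close to `f₁`. The monotone rearrangement `S` from `μ₁` to `μ₀`
satisfies `f₁ = (f₀ ∘ S) * S'` exactly on the interior of the support. On a compact interval
carrying most of `μ₁`, `S` is replaced by a C¹-close polynomial, which is then continued to a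
diffeomorphism of the line, still called `S`, with finitely many fixed points
(`exists_polynomial_pullback_near`, `exists_diffeo_extension`).

Between two consecutive fixed points, a field has time-one map `S` once it satisfies `v (S x) = v x
* S' x`, up to a constant factor: with `h' = 1 / v`, the travel time `h (S x) - h x` does not depend
on `x`. Such a `v` can be prescribed on one fundamental interval `[α, S α]` and is then propagated
by the equation (`abelSeq`). The propagated field need not behave well at the fixed points. So the
equation is imposed only at distance `δ` from them, and `v` is made to vanish quadratically at the
ends of each gap. Quadratic zeros are reached in infinite time and give `Φ 1` derivative `1` there,
continuously (`exists_isFlowField_of_travelTime`); hence the new target density is continuous and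
positive. The fields of the different gaps have disjoint supports and can be added.

The densities are then close except near finitely many points and in the tails. Since both measures
are probabilities, closeness on a set of nearly full `μ₁`-mass also bounds the mass of the new
target on the complement (`lintegral_weight_le`). Its tails are treated in two ways. If `μ₀` has the
required moment, the field is cut off to compact support, hence Lipschitz, and moves mass inwards
far away, so the tails are dominated by those of `μ₀`. Otherwise `S` is made to grow so fast that
its inverse compresses the tails of `μ₀` as strongly as needed (`exists_growth`). All estimates use
the weight `1 + |y| ^ r`: the exponent `r = 0` gives the `L¹` statement, and `r = p` gives the
Wasserstein one through `wassersteinDist_le`. -/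

open Filter Topology

namespace AutonomousTransport

/-! ### Locally Lipschitz functions on the line -/

section LocallyLipschitz

theorem LocallyLipschitz.real_mul {f g : ℝ → ℝ} (hf : LocallyLipschitz f)
    (hg : LocallyLipschitz g) : LocallyLipschitz (fun x => f x * g x) := by
  have h : LocallyLipschitz (fun p : ℝ × ℝ => p.1 * p.2) :=
    ContDiff.locallyLipschitz (𝕂 := ℝ) (contDiff_fst.mul contDiff_snd)
  exact h.comp (hf.prodMk hg)

theorem LocallyLipschitz.const_mul {f : ℝ → ℝ} (hf : LocallyLipschitz f) (c : ℝ) :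
    LocallyLipschitz (fun x => c * f x) :=
  LocallyLipschitz.real_mul (LocallyLipschitz.const c) hf

/-- Two locally Lipschitz functions which agree at `a` can be glued there. -/
theorem LocallyLipschitz.glue {f g : ℝ → ℝ} {a : ℝ} (hf : LocallyLipschitz f)
    (hg : LocallyLipschitz g) (h : f a = g a) :
    LocallyLipschitz (fun x => if x ≤ a then f x else g x) := by
  -- Clamping the arguments turns the case distinction into a sum: the inactive term is the common
  -- value at `a`, which is subtracted.
  have e : (fun x => if x ≤ a then f x else g x) =
      fun x => (f (min x a) + g (max x a)) + -f a := by
    funext x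
    by_cases hx : x ≤ a
    · simp [hx, h]
    · have hx' : a ≤ x := le_of_not_ge hx
      simp [hx, hx']
  rw [e]
  exact ((hf.comp (LocallyLipschitz.id.min_const a)).add
    (hg.comp (LocallyLipschitz.id.max_const a))).add (LocallyLipschitz.const _)

theorem LocallyLipschitz.exists_lipschitzOnWith {f : ℝ → ℝ} (hf : LocallyLipschitz f) {s : Set ℝ}
    (hs : IsCompact s) : ∃ K, LipschitzOnWith K f s :=
  LocallyLipschitzOn.exists_lipschitzOnWith_of_compact hs (hf.locallyLipschitzOn)

/-- A locally Lipschitz function that vanishes off a compact interval is Lipschitz. -/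
theorem LocallyLipschitz.exists_lipschitzWith {f : ℝ → ℝ} (hf : LocallyLipschitz f) {a b : ℝ}
    (hab : a ≤ b) (ha : ∀ x ≤ a, f x = 0) (hb : ∀ x, b ≤ x → f x = 0) :
    ∃ K, LipschitzWith K f := by
  obtain ⟨K, hK⟩ := LocallyLipschitz.exists_lipschitzOnWith hf (isCompact_Icc (a := a) (b := b))
  have e : f = fun x => f (max a (min x b)) := by
    funext x
    rcases le_total x a with h | h
    · rw [min_eq_left (h.trans hab), max_eq_left h, ha x h, ha a le_rfl]
    · rcases le_total x b with h' | h'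
      · rw [min_eq_left h', max_eq_right h]
      · rw [min_eq_right h', max_eq_right hab, hb x h', hb b le_rfl]
  have hl : LipschitzWith 1 (fun x : ℝ => max a (min x b)) :=
    (LipschitzWith.id.min_const b).const_max a
  refine ⟨K * 1, ?_⟩
  rw [e, ← lipschitzOnWith_univ]
  exact hK.comp (hl.lipschitzOnWith (s := univ))
    (fun x _ => ⟨le_max_left _ _, max_le hab (min_le_right _ _)⟩)

end LocallyLipschitz

/-! ### Uniqueness of integral curves and inverse functions -/

section Curves

/-- Forward uniqueness for autonomous equations on the line. -/
theorem eqOn_of_hasDerivWithinAt {v : ℝ → ℝ} (hv : LocallyLipschitz v) {f g : ℝ → ℝ} {τ : ℝ}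
    (hf : ContinuousOn f (Icc 0 τ))
    (hf' : ∀ t ∈ Ico 0 τ, HasDerivWithinAt f (v (f t)) (Ici t) t)
    (hg : ContinuousOn g (Icc 0 τ))
    (hg' : ∀ t ∈ Ico 0 τ, HasDerivWithinAt g (v (g t)) (Ici t) t)
    (h0 : f 0 = g 0) : EqOn f g (Icc 0 τ) := by
  -- The two trajectories stay in a compact set, on which the local Lipschitz condition becomes a
  -- uniform one.
  have hc : IsCompact (f '' Icc 0 τ ∪ g '' Icc 0 τ) :=
    (isCompact_Icc.image_of_continuousOn hf).union (isCompact_Icc.image_of_continuousOn hg)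
  obtain ⟨K, hK⟩ := LocallyLipschitz.exists_lipschitzOnWith hv hc
  exact ODE_solution_unique_of_mem_Icc_right (v := fun _ => v) (s := fun _ => _)
    (fun t _ => hK) hf hf' (fun t ht => Or.inl ⟨t, Ico_subset_Icc_self ht, rfl⟩) hg hg'
    (fun t ht => Or.inr ⟨t, Ico_subset_Icc_self ht, rfl⟩) h0

/-- The inverse of a function with positive derivative on an open interval. -/
theorem exists_inverse_of_hasDerivAt {C : Set ℝ} (hC : IsOpen C) [OrdConnected C] {h h' : ℝ → ℝ}
    (hh : ∀ x ∈ C, HasDerivAt h (h' x) x) (hpos : ∀ x ∈ C, 0 < h' x) :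
    StrictMonoOn h C ∧ ∃ H : ℝ → ℝ, (∀ x ∈ C, H (h x) = x) ∧
      ∀ t ∈ h '' C, H t ∈ C ∧ h (H t) = t ∧ HasDerivAt H (h' (H t))⁻¹ t := by
  have hcont : ContinuousOn h C := fun x hx => (hh x hx).continuousAt.continuousWithinAt
  have hconv : Convex ℝ C := convex_iff_ordConnected.2 inferInstance
  have hmono : StrictMonoOn h C := by
    refine strictMonoOn_of_hasDerivWithinAt_pos hconv hcont (f' := h') ?_ ?_
    · intro x hx
      exact (hh x (interior_subset hx)).hasDerivWithinAt
    · intro x hx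
      exact hpos x (interior_subset hx)
  refine ⟨hmono, Function.invFunOn h C, ?_, ?_⟩
  · intro x hx
    exact hmono.injOn.leftInvOn_invFunOn hx
  · have hmem : ∀ t ∈ h '' C, Function.invFunOn h C t ∈ C := fun t ht =>
      Function.invFunOn_mem ht
    have heq : ∀ t ∈ h '' C, h (Function.invFunOn h C t) = t := fun t ht =>
      Function.invFunOn_eq ht
    have hopen : IsOpen (h '' C) := by
      rw [isOpen_iff_mem_nhds]
      rintro _ ⟨x, hx, rfl⟩
      have := (hh x hx)
      obtain ⟨a, b, hxab, hab⟩ := mem_nhds_iff_exists_Ioo_subset.1 (hC.mem_nhds hx)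
      obtain ⟨a', ha1, ha2⟩ := exists_between hxab.1
      obtain ⟨b', hb1, hb2⟩ := exists_between hxab.2
      have haC : a' ∈ C := hab ⟨ha1, ha2.trans hxab.2⟩
      have hbC : b' ∈ C := hab ⟨hxab.1.trans hb1, hb2⟩
      have hsub : Icc a' b' ⊆ C := OrdConnected.out inferInstance haC hbC
      have hivt := intermediate_value_Ioo (ha2.trans hb1).le (hcont.mono hsub)
      refine mem_of_superset (Ioo_mem_nhds (hmono haC hx ha2) (hmono hx hbC hb1)) ?_
      exact hivt.trans (image_mono (Ioo_subset_Icc_self.trans hsub))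
    intro t ht
    refine ⟨hmem t ht, heq t ht, ?_⟩
    have hmonoH : StrictMonoOn (Function.invFunOn h C) (h '' C) := by
      intro s hs t ht hst
      rw [← heq s hs, ← heq t ht] at hst
      exact (hmono.lt_iff_lt (hmem s hs) (hmem t ht)).1 hst
    have himg : Function.invFunOn h C '' (h '' C) = C := by
      apply Subset.antisymm
      · rintro _ ⟨t, ht, rfl⟩
        exact hmem t ht
      · intro x hx
        exact ⟨h x, ⟨x, hx, rfl⟩, hmono.injOn.leftInvOn_invFunOn hx⟩
    have hcontH : ContinuousAt (Function.invFunOn h C) t := by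
      refine hmonoH.continuousAt_of_image_mem_nhds (hopen.mem_nhds ht) ?_
      rw [himg]
      exact hC.mem_nhds (hmem t ht)
    refine HasDerivAt.of_local_left_inverse hcontH (hh _ (hmem t ht)) (hpos _ (hmem t ht)).ne' ?_
    filter_upwards [hopen.mem_nhds ht] with s hs using heq s hs

end Curves

/-! ### Complete flows with regular time-one map -/

/-- `Φ` is the complete flow of the locally Lipschitz field `v` on the line, and its time-one map is
continuously differentiable with positive derivative `D`. -/
structure IsFlowField (v : ℝ → ℝ) (Φ : ℝ → ℝ → ℝ) (D : ℝ → ℝ) : Prop where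
  lip : LocallyLipschitz v
  zero : ∀ x, Φ 0 x = x
  add : ∀ s t x, Φ (s + t) x = Φ s (Φ t x)
  deriv : ∀ t x, HasDerivAt (fun t => Φ t x) (v (Φ t x)) t
  fixed : ∀ t x, v x = 0 → Φ t x = x
  mono : ∀ x, Monotone (fun t => Φ t x) ∨ Antitone (fun t => Φ t x)
  hasDerivAt : ∀ x, HasDerivAt (Φ 1) (D x) x
  contD : Continuous D
  posD : ∀ x, 0 < D x

namespace IsFlowField

variable {v w : ℝ → ℝ} {Φ Ψ : ℝ → ℝ → ℝ} {D G : ℝ → ℝ}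

theorem neg_apply_apply (h : IsFlowField v Φ D) (t x : ℝ) : Φ (-t) (Φ t x) = x := by
  rw [← h.add, neg_add_cancel, h.zero]

theorem apply_neg_apply (h : IsFlowField v Φ D) (t x : ℝ) : Φ t (Φ (-t) x) = x := by
  rw [← h.add, add_neg_cancel, h.zero]

theorem eq_zero_of_eq_zero (h : IsFlowField v Φ D) {t x : ℝ} (hx : v (Φ t x) = 0) : v x = 0 := by
  have := h.fixed (-t) _ hx
  rw [h.neg_apply_apply] at this
  rwa [this]

theorem strictMono (h : IsFlowField v Φ D) : StrictMono (Φ 1) :=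
  strictMono_of_hasDerivAt_pos h.hasDerivAt h.posD

/-- Orbits are monotone in time, so one that returns at time one has been constant in between; its
velocity vanishes. -/
theorem eq_zero_of_fixed (h : IsFlowField v Φ D) {x : ℝ} (hx : Φ 1 x = x) : v x = 0 := by
  have hc : ∀ t ∈ Ioo (0 : ℝ) 1, Φ t x = x := by
    intro t ht
    have h0 := h.zero x
    rcases h.mono x with hm | hm
    · have h1 := hm ht.1.le
      have h2 := hm ht.2.le
      simp only at h1 h2
      linarith
    · have h1 := hm ht.1.le
      have h2 := hm ht.2.le
      simp only at h1 h2
      linarith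
  have hd := h.deriv (1 / 2) x
  have hm : (1 / 2 : ℝ) ∈ Ioo (0 : ℝ) 1 := by constructor <;> norm_num
  have hd' : HasDerivAt (fun t => Φ t x) 0 (1 / 2) := by
    refine (hasDerivAt_const (1 / 2 : ℝ) x).congr_of_eventuallyEq ?_
    filter_upwards [isOpen_Ioo.mem_nhds hm] with t ht using hc t ht
  rw [hc _ hm] at hd
  exact hd.unique hd'

theorem zero_field : IsFlowField (fun _ => 0) (fun _ x => x) (fun _ => 1) where
  lip := LocallyLipschitz.const 0
  zero _ := rfl
  add _ _ _ := rfl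
  deriv t x := hasDerivAt_const t x
  fixed _ _ _ := rfl
  mono _ := Or.inl monotone_const
  hasDerivAt x := hasDerivAt_id x
  contD := continuous_const
  posD _ := one_pos

/-- Reflection of the line. -/
theorem reflect (h : IsFlowField v Φ D) :
    IsFlowField (fun x => -v (-x)) (fun t x => -Φ t (-x)) (fun x => D (-x)) where
  lip := by
    have hn : LocallyLipschitz (fun x : ℝ => -x) := LocallyLipschitz.id.neg
    exact (h.lip.comp hn).neg
  zero x := by simp [h.zero]
  add s t x := by simp [h.add]
  deriv t x := by simpa using (h.deriv t (-x)).fun_neg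
  fixed t x hx := by
    rw [h.fixed t (-x) (by simpa using hx), neg_neg]
  mono x := by
    rcases h.mono (-x) with hm | hm
    · exact Or.inr fun a b hab => neg_le_neg (hm hab)
    · exact Or.inl fun a b hab => neg_le_neg (hm hab)
  hasDerivAt x := by
    have := ((h.hasDerivAt (-x)).comp x (hasDerivAt_neg x)).fun_neg
    simpa using this
  contD := h.contD.comp continuous_neg
  posD x := h.posD _

/-- A point moved by `w` never leaves `{w ≠ 0}`, where `v` vanishes. This is why the flow of a sum
with disjoint supports is the composition of the flows. -/
theorem comp_eq_right (hv : IsFlowField v Φ D) (hw : IsFlowField w Ψ G)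
    (hd : ∀ x, v x = 0 ∨ w x = 0) {x : ℝ} (hx : w x ≠ 0) (t : ℝ) : Φ t (Ψ t x) = Ψ t x := by
  refine hv.fixed t _ ((hd _).resolve_right fun h0 => hx (hw.eq_zero_of_eq_zero h0))

/-- Fields with disjoint supports can be added. -/
theorem add_field (hv : IsFlowField v Φ D) (hw : IsFlowField w Ψ G)
    (hd : ∀ x, v x = 0 ∨ w x = 0) :
    IsFlowField (fun x => v x + w x) (fun t x => Φ t (Ψ t x)) (fun x => D (Ψ 1 x) * G x) where
  lip := hv.lip.add hw.lip
  zero x := by simp [hv.zero, hw.zero]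
  add s t x := by
    by_cases hx : w x = 0
    · rw [hw.fixed _ x hx, hw.fixed _ x hx, hv.add]
      by_cases hvx : v x = 0
      · rw [hv.fixed _ x hvx, hw.fixed _ x hx]
      · rw [hw.fixed s (Φ t x)]
        exact (hd _).resolve_left fun h0 => hvx (hv.eq_zero_of_eq_zero h0)
    · rw [comp_eq_right hv hw hd hx, comp_eq_right hv hw hd hx, hw.add]
      rw [comp_eq_right hv hw hd]
      exact fun h0 => hx (hw.eq_zero_of_eq_zero h0)
  deriv t x := by
    by_cases hx : w x = 0
    · simp_rw [hw.fixed _ x hx]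
      by_cases hvx : v x = 0
      · simp_rw [hv.fixed _ x hvx]
        simpa [hvx, hx] using hasDerivAt_const t x
      · have : w (Φ t x) = 0 :=
          (hd _).resolve_left fun h0 => hvx (hv.eq_zero_of_eq_zero h0)
        simpa [this] using hv.deriv t x
    · simp_rw [comp_eq_right hv hw hd hx]
      have : v (Ψ t x) = 0 :=
        (hd _).resolve_right fun h0 => hx (hw.eq_zero_of_eq_zero h0)
      simpa [this] using hw.deriv t x
  fixed t x hx := by
    rcases hd x with h0 | h0
    · have hw0 : w x = 0 := by simpa [h0] using hx
      rw [hw.fixed t x hw0, hv.fixed t x h0]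
    · have hv0 : v x = 0 := by simpa [h0] using hx
      rw [hw.fixed t x h0, hv.fixed t x hv0]
  mono x := by
    by_cases hx : w x = 0
    · simp_rw [hw.fixed _ x hx]
      exact hv.mono x
    · simp_rw [comp_eq_right hv hw hd hx]
      exact hw.mono x
  hasDerivAt x := (hv.hasDerivAt (Ψ 1 x)).comp x (hw.hasDerivAt x)
  contD := by
    have : Continuous (Ψ 1) :=
      continuous_iff_continuousAt.2 fun x => (hw.hasDerivAt x).continuousAt
    exact (hv.contD.comp this).mul hw.contD
  posD x := mul_pos (hv.posD _) (hw.posD _)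

/-- A finite sum of fields with pairwise disjoint supports. -/
theorem exists_sum {ι : Type*} (s : Finset ι) (v : ι → ℝ → ℝ)
    (Φ : ι → ℝ → ℝ → ℝ) (D : ι → ℝ → ℝ) (h : ∀ i ∈ s, IsFlowField (v i) (Φ i) (D i))
    (hd : ∀ i ∈ s, ∀ j ∈ s, i ≠ j → ∀ x, v i x = 0 ∨ v j x = 0) :
    ∃ Ψ G, IsFlowField (fun x => ∑ i ∈ s, v i x) Ψ G ∧
      ∀ i ∈ s, ∀ x, v i x ≠ 0 → Ψ 1 x = Φ i 1 x := by
  classical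
  induction s using Finset.induction_on with
  | empty => exact ⟨_, _, by simpa using zero_field, by simp⟩
  | insert a s ha ih =>
    obtain ⟨Ψ, G, h1, h2⟩ := ih (fun i hi => h i (Finset.mem_insert_of_mem hi))
      (fun i hi j hj => hd i (Finset.mem_insert_of_mem hi) j (Finset.mem_insert_of_mem hj))
    have hdis : ∀ x, v a x = 0 ∨ (∑ i ∈ s, v i x) = 0 := by
      intro x
      by_cases hx : v a x = 0
      · exact Or.inl hx
      · refine Or.inr (Finset.sum_eq_zero fun i hi => ?_)
        exact (hd a (Finset.mem_insert_self _ _) i (Finset.mem_insert_of_mem hi)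
          (fun h => ha (h ▸ hi)) x).resolve_left hx
    have ha' := h a (Finset.mem_insert_self _ _)
    refine ⟨_, _, by simpa [Finset.sum_insert ha] using add_field ha' h1 hdis, ?_⟩
    intro i hi x hx
    rcases Finset.mem_insert.1 hi with rfl | hi
    · rw [h1.fixed 1 x ((hdis x).resolve_left hx)]
    · have hsx : (∑ j ∈ s, v j x) ≠ 0 := by
        rw [Finset.sum_eq_single i]
        · exact hx
        · intro j hj hji
          exact (hd j (Finset.mem_insert_of_mem hj) i (Finset.mem_insert_of_mem hi) hji
            x).resolve_right hx
        · exact fun h => absurd hi h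
      rw [comp_eq_right ha' h1 hdis hsx, h2 i hi x hx]

theorem mem_uIcc (h : IsFlowField v Φ D) {a b t : ℝ} (x : ℝ) (ht : t ∈ uIcc a b) :
    Φ t x ∈ uIcc (Φ a x) (Φ b x) := by
  rcases h.mono x with hm | hm
  · exact hm.mapsTo_uIcc ht
  · exact hm.mapsTo_uIcc ht

end IsFlowField

/-! ### Push-forward of admissible measures and realization by a flow -/

theorem IsAdmissible.measurable {μ : Measure ℝ} {f : ℝ → ℝ} (h : IsAdmissible μ f) :
    Measurable f := by
  classical
  have hm : MeasurableSet μ.support := Measure.isClosed_support.measurableSet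
  have e : f = μ.support.piecewise f (fun _ => 0) := by
    funext x
    by_cases hx : x ∈ μ.support
    · simp [hx]
    · simp [hx, h.eq_zero_off_support x hx]
  rw [e]
  exact h.continuousOn.measurable_piecewise continuousOn_const hm

theorem support_map_of_inverse {μ : Measure ℝ} {T S : ℝ → ℝ} (hT : Continuous T)
    (hS : Continuous S) (hST : ∀ x, S (T x) = x) (hTS : ∀ y, T (S y) = y) :
    (μ.map T).support = S ⁻¹' μ.support := by
  ext y
  rw [mem_preimage, Measure.mem_support_iff_forall, Measure.mem_support_iff_forall]
  constructor
  · intro h U hU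
    have hU' : interior U ∈ 𝓝 (S y) := interior_mem_nhds.2 hU
    have := h (S ⁻¹' interior U) (hS.continuousAt hU')
    rw [Measure.map_apply hT.measurable (isOpen_interior.preimage hS).measurableSet,
      ← preimage_comp] at this
    have e : S ∘ T = id := funext hST
    rw [e, preimage_id] at this
    exact this.trans_le (measure_mono interior_subset)
  · intro h U hU
    have hU' : interior U ∈ 𝓝 y := interior_mem_nhds.2 hU
    refine lt_of_lt_of_le ?_ (measure_mono (interior_subset (s := U)))
    rw [Measure.map_apply hT.measurable isOpen_interior.measurableSet]
    refine h _ (hT.continuousAt ?_)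
    rwa [hTS]

/-- Change of variables along the inverse `S` of `T`. Only `S` has to be differentiable; continuity
and positivity of `D` are what keep the new density admissible. -/
theorem IsAdmissible.map {μ : Measure ℝ} {f : ℝ → ℝ} (h : IsAdmissible μ f) {T S D : ℝ → ℝ}
    (hST : ∀ x, S (T x) = x) (hTS : ∀ y, T (S y) = y) (hT : Continuous T)
    (hS : ∀ y, HasDerivAt S (D y) y) (hD : Continuous D) (hpos : ∀ y, 0 < D y) :
    IsAdmissible (μ.map T) (fun y => f (S y) * D y) := by
  have hSc : Continuous S := continuous_iff_continuousAt.2 fun y => (hS y).continuousAt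
  have hSm : StrictMono S := strictMono_of_hasDerivAt_pos hS hpos
  have hsup := support_map_of_inverse (μ := μ) hT hSc hST hTS
  have := h.isProbabilityMeasure
  refine ⟨Measure.isProbabilityMeasure_map hT.aemeasurable, ?_, ?_, ?_, ?_, ?_⟩
  · ext A hA
    rw [Measure.map_apply hT.measurable hA, withDensity_apply _ hA]
    have e : T ⁻¹' A = S '' A := by
      ext x
      constructor
      · intro hx
        exact ⟨T x, hx, hST x⟩
      · rintro ⟨y, hy, rfl⟩
        simpa [hTS] using hy
    conv_lhs => rw [h.eq_withDensity]
    rw [withDensity_apply _ (hT.measurable hA), e,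
      lintegral_image_eq_lintegral_abs_deriv_mul hA (fun y _ => (hS y).hasDerivWithinAt)
        hSm.injective.injOn]
    refine lintegral_congr fun y => ?_
    rw [abs_of_pos (hpos y), ← ENNReal.ofReal_mul (hpos y).le, mul_comm]
  · intro y hy
    rw [hsup] at hy
    rw [h.eq_zero_off_support _ hy, zero_mul]
  · rw [hsup, convex_iff_ordConnected]
    have := convex_iff_ordConnected.1 h.convex_support
    exact this.preimage_mono hSm.monotone
  · rw [hsup]
    exact (h.continuousOn.comp hSc.continuousOn (mapsTo_preimage _ _)).mul hD.continuousOn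
  · intro y hy
    rw [hsup] at hy
    exact mul_pos (h.pos_on_support _ hy) (hpos y)

/-- An integral solution is continuous because its integrand is integrable. Then `v ∘ γ` is
continuous, `γ` has right derivatives `v (γ t)`, and forward uniqueness applies. -/
theorem IsSolution.eqOn {K : Set ℝ} {v γ φ : ℝ → ℝ} {x τ : ℝ} (hv : LocallyLipschitz v)
    (h : IsSolution K v x τ γ) (hτ : 0 ≤ τ)
    (hφ : ∀ t, HasDerivAt φ (v (φ t)) t) (h0 : φ 0 = x) : ∀ t ∈ Icc 0 τ, γ t = φ t := by
  have hint : IntegrableOn (fun s => v (γ s)) (uIcc 0 τ) := by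
    rw [← intervalIntegrable_iff']
    exact h.integrable
  have hcont : ContinuousOn γ (Icc 0 τ) := by
    have := (intervalIntegral.continuousOn_primitive_interval hint).const_add x
    rw [uIcc_of_le hτ] at this
    exact this.congr h.eq_integral
  have hvc : ContinuousOn (fun s => v (γ s)) (Icc 0 τ) := hv.continuous.comp_continuousOn hcont
  refine eqOn_of_hasDerivWithinAt hv hcont ?_
    (fun t _ => (hφ t).continuousAt.continuousWithinAt) (fun t _ => (hφ t).hasDerivWithinAt) ?_
  · intro t ht
    have hti : t ∈ Icc 0 τ := Ico_subset_Icc_self ht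
    have hsub : Icc t τ ⊆ Icc 0 τ := Icc_subset_Icc_left ht.1
    have hii : IntervalIntegrable (fun s => v (γ s)) volume 0 t :=
      (hvc.mono (Icc_subset_Icc_right ht.2.le)).intervalIntegrable_of_Icc ht.1
    have hwa : ContinuousWithinAt (fun s => v (γ s)) (Ici t) t := by
      have := (hvc t hti).mono hsub
      exact this.mono_of_mem_nhdsWithin (Icc_mem_nhdsGE ht.2)
    have hmeas : StronglyMeasurableAtFilter (fun s => v (γ s)) (𝓝[>] t) volume := by
      refine ⟨Ioo t τ, Ioo_mem_nhdsGT ht.2, ?_⟩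
      exact (hvc.mono (Ioo_subset_Icc_self.trans hsub)).aestronglyMeasurable measurableSet_Ioo
    have hd := (intervalIntegral.integral_hasDerivWithinAt_right hii (s := Ici t) (t := Ioi t)
      hmeas (hwa.mono Ioi_subset_Ici_self)).const_add x
    refine hd.congr_of_eventuallyEq ?_ (h.eq_integral t hti)
    filter_upwards [Icc_mem_nhdsGE ht.2] with s hs using h.eq_integral s (hsub hs)
  · rw [h.eq_integral 0 (left_mem_Icc.2 hτ), h0]
    simp

/-- The backward flow of a field realizes the transport of `μ` to its image under the inverse of
the time-one map. -/
theorem IsFlowField.realizes {v : ℝ → ℝ} {Φ : ℝ → ℝ → ℝ} {D : ℝ → ℝ} (h : IsFlowField v Φ D)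
    {μ : Measure ℝ} (hμ : Convex ℝ μ.support) (hT : Continuous (Φ (-1))) :
    Realizes μ (μ.map (Φ (-1))) (fun x => -v x) := by
  have hlip : LocallyLipschitz (fun x => -v x) := h.lip.neg
  have hS : Continuous (Φ 1) :=
    continuous_iff_continuousAt.2 fun x => (h.hasDerivAt x).continuousAt
  have hST := h.apply_neg_apply 1
  have hTS := h.neg_apply_apply 1
  have hTm : StrictMono (Φ (-1)) := by
    intro x y hxy
    rw [← h.strictMono.lt_iff_lt, hST, hST]
    exact hxy
  have hsup : (μ.map (Φ (-1))).support = Φ 1 ⁻¹' μ.support :=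
    support_map_of_inverse hT hS hST hTS
  have hderiv : ∀ x t, HasDerivAt (fun t => Φ (-t) x) (-v (Φ (-t) x)) t := by
    intro x t
    have := (h.deriv (-t) x).comp t (hasDerivAt_neg t)
    rw [mul_neg, mul_one] at this
    exact this
  have hconv : OrdConnected (hull μ (μ.map (Φ (-1)))) :=
    convex_iff_ordConnected.1 (convex_convexHull ℝ _)
  have hfix : ∀ {x}, Φ (-1) x = x → v x = 0 := by
    intro x hx
    refine h.eq_zero_of_fixed ?_
    conv_lhs => rw [← hx]
    exact hST x
  refine ⟨hlip.continuous.continuousOn, Φ (-1), fun t x => Φ (-t) x,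
    ⟨hTm.monotone.monotoneOn _, hT.continuousOn, hT.aemeasurable, rfl⟩, ?_, ?_, ⟨?_, ?_⟩, ?_⟩
  · rintro x ⟨_, hx⟩
    simp [hfix hx]
  · rintro x ⟨hx, hx'⟩
    rw [abs_neg, abs_pos]
    intro h0
    have hTx : Φ (-1) x = x := h.fixed _ x h0
    have hSx : Φ 1 x = x := h.fixed _ x h0
    have hxs : x ∉ μ.support := fun hs => hx' ⟨hs, hTx⟩
    have hoc := convex_iff_ordConnected.1 hμ
    -- A zero `x` of the field outside the support has the whole support on one side. The increasing
    -- map `Φ 1` fixes `x`, so the support of the image lies on the same side, and `x` cannot belong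
    -- to the hull.
    have hside : (∀ y ∈ μ.support, y < x) ∨ ∀ y ∈ μ.support, x < y := by
      by_contra! hcon
      obtain ⟨⟨y, hy, hxy⟩, z, hz, hzx⟩ := hcon
      exact hxs (hoc.out hz hy ⟨hzx, hxy⟩)
    rcases hside with hs | hs
    · have hsub : hull μ (μ.map (Φ (-1))) ⊆ Iio x := by
        refine convexHull_min (union_subset hs ?_) (convex_Iio x)
        intro y hy
        rw [hsup] at hy
        have := hs _ hy
        rw [← hSx] at this
        exact h.strictMono.lt_iff_lt.1 this
      exact lt_irrefl x (hsub hx)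
    · have hsub : hull μ (μ.map (Φ (-1))) ⊆ Ioi x := by
        refine convexHull_min (union_subset hs ?_) (convex_Ioi x)
        intro y hy
        rw [hsup] at hy
        have := hs _ hy
        rw [← hSx] at this
        exact h.strictMono.lt_iff_lt.1 this
      exact lt_irrefl x (hsub hx)
  · intro x hx
    have hcont : Continuous (fun t => -v (Φ (-t) x)) := by
      refine hlip.continuous.comp ?_
      exact continuous_iff_continuousAt.2 fun t => (hderiv x t).continuousAt
    refine ⟨?_, hcont.intervalIntegrable _ _, ?_⟩
    · intro t ht
      have h1 : x ∈ hull μ (μ.map (Φ (-1))) := subset_convexHull ℝ _ (Or.inl hx)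
      have h2 : Φ (-1) x ∈ hull μ (μ.map (Φ (-1))) := by
        refine subset_convexHull ℝ _ (Or.inr ?_)
        rw [hsup, mem_preimage, hST]
        exact hx
      refine hconv.uIcc_subset h1 h2 ?_
      have := h.mem_uIcc (a := 0) (b := -1) (t := -t) x
        (by rw [uIcc_of_ge (by norm_num)]; constructor <;> linarith [ht.1, ht.2])
      rwa [h.zero] at this
    · intro t ht
      have := intervalIntegral.integral_eq_sub_of_hasDerivAt (f := fun t => Φ (-t) x)
        (a := 0) (b := t) (fun s _ => hderiv x s) (hcont.intervalIntegrable _ _)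
      simp only [neg_zero, h.zero] at this
      rw [this]
      ring
  · intro x hx τ hτ γ hγ t ht
    exact hγ.eqOn hlip hτ.1 (hderiv x) (by simp [h.zero]) t ht
  · intro x _
    rfl

/-! ### Flows constructed from travel times -/

open Classical in
/-- A field that is positive on an open interval and vanishes off it, with divergent travel times
and quadratic behaviour at the end points of the interval, has a complete flow with continuously
differentiable time-one map. -/
theorem exists_isFlowField_of_travelTime {v h : ℝ → ℝ} {C : Set ℝ} (hv : LocallyLipschitz v)
    (hC : IsOpen C) [hoc : OrdConnected C] (hpos : ∀ x ∈ C, 0 < v x) (h0 : ∀ x ∉ C, v x = 0)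
    (hh : ∀ x ∈ C, HasDerivAt h (v x)⁻¹ x) (hsurj : h '' C = univ)
    (hq : ∀ z ∉ C, ∃ c, ∀ᶠ x in 𝓝 z, x ∈ C → v x = c * (x - z) ^ 2) :
    ∃ Φ D, IsFlowField v Φ D ∧ (∀ x, x ≤ Φ 1 x) ∧ ∀ x ∈ C, Φ 1 x ∈ C ∧ h (Φ 1 x) = h x + 1 := by
  obtain ⟨hmono, H, hHh, hH⟩ := exists_inverse_of_hasDerivAt hC hh fun x hx => inv_pos.2 (hpos x hx)
  have hHC : ∀ t, H t ∈ C := fun t => (hH t (hsurj ▸ mem_univ t)).1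
  have hhH : ∀ t, h (H t) = t := fun t => (hH t (hsurj ▸ mem_univ t)).2.1
  have hHd : ∀ t, HasDerivAt H (v (H t)) t := fun t => by
    simpa using (hH t (hsurj ▸ mem_univ t)).2.2
  have hHm : StrictMono H := strictMono_of_hasDerivAt_pos hHd fun t => hpos _ (hHC t)
  -- In the coordinate `h`, which maps `C` onto the whole line, the flow is a translation. This
  -- gives completeness.
  obtain ⟨Φ, hΦ⟩ : ∃ Φ : ℝ → ℝ → ℝ, ∀ t x, Φ t x = if x ∈ C then H (h x + t) else x :=
    ⟨_, fun _ _ => rfl⟩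
  have hin : ∀ t, ∀ x ∈ C, Φ t x = H (h x + t) := fun t x hx => by rw [hΦ, if_pos hx]
  have hout : ∀ t, ∀ x ∉ C, Φ t x = x := fun t x hx => by rw [hΦ, if_neg hx]
  have hΦC : ∀ t, ∀ x ∈ C, Φ t x ∈ C := fun t x hx => by
    rw [hin t x hx]
    exact hHC _
  have hzero : ∀ x, Φ 0 x = x := by
    intro x
    by_cases hx : x ∈ C
    · rw [hin _ x hx, add_zero, hHh x hx]
    · exact hout _ x hx
  have hadd : ∀ s t x, Φ (s + t) x = Φ s (Φ t x) := by
    intro s t x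
    by_cases hx : x ∈ C
    · rw [hin _ _ (hΦC t x hx), hin _ x hx, hin _ x hx, hhH]
      congr 1
      ring
    · rw [hout _ x hx, hout _ x hx, hout _ x hx]
  have hderiv : ∀ t x, HasDerivAt (fun t => Φ t x) (v (Φ t x)) t := by
    intro t x
    by_cases hx : x ∈ C
    · simp_rw [hin _ x hx]
      simpa using (hHd (h x + t)).comp_const_add (h x) t
    · simp_rw [hout _ x hx, h0 x hx]
      exact hasDerivAt_const t x
  have htm : ∀ x, Monotone fun t => Φ t x := by
    intro x
    refine monotone_of_hasDerivAt_nonneg (hderiv · x) fun t => ?_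
    by_cases hx : Φ t x ∈ C
    · exact (hpos _ hx).le
    · exact (h0 _ hx).ge
  have hxm : ∀ t, StrictMono (Φ t) := by
    intro t x y hxy
    by_cases hx : x ∈ C <;> by_cases hy : y ∈ C
    · rw [hin t x hx, hin t y hy]
      exact hHm (by have := hmono hx hy hxy; linarith)
    · rw [hout t y hy]
      by_contra! hcon
      exact hy (hoc.out hx (hΦC t x hx) ⟨hxy.le, hcon⟩)
    · rw [hout t x hx]
      by_contra! hcon
      exact hx (hoc.out (hΦC t y hy) hy ⟨hcon, hxy.le⟩)
    · rwa [hout t x hx, hout t y hy]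
  have hTc : Continuous (Φ 1) := by
    refine (hxm 1).monotone.continuous_of_surjective fun y => ⟨Φ (-1) y, ?_⟩
    rw [← hadd, add_neg_cancel, hzero]
  have hle : ∀ x, x ≤ Φ 1 x := by
    intro x
    have := htm x zero_le_one
    simpa [hzero] using this
  -- At a point `z` off `C`, one factor `m` tending to `1` controls both the difference quotient of
  -- `Φ 1`, which is `m`, and the derivative of `Φ 1` nearby, which is `m ^ 2`. Differentiability at
  -- `z` and continuity of the derivative both follow.
  have hkey : ∀ z ∉ C, ∃ m : ℝ → ℝ, Tendsto m (𝓝 z) (𝓝 1) ∧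
      ∀ᶠ x in 𝓝 z, Φ 1 x - z = (x - z) * m x ∧
        (if x ∈ C then v (Φ 1 x) * (v x)⁻¹ else 1) = m x ^ 2 := by
    intro z hz
    obtain ⟨c, hc⟩ := hq z hz
    obtain ⟨a, b, hzab, hab⟩ := mem_nhds_iff_exists_Ioo_subset.1 hc
    have hTz : Tendsto (Φ 1) (𝓝 z) (𝓝 z) := by
      have := hTc.tendsto z
      rwa [hout 1 z hz] at this
    have hlin : Tendsto (fun x : ℝ => 1 - c * (x - z)) (𝓝 z) (𝓝 1) := by
      have : ContinuousAt (fun x : ℝ => 1 - c * (x - z)) z := by fun_prop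
      simpa [ContinuousAt] using this
    refine ⟨fun x => if x ∈ C then (1 - c * (x - z))⁻¹ else 1, ?_, ?_⟩
    · refine Tendsto.if' ?_ tendsto_const_nhds
      simpa using hlin.inv₀ one_ne_zero
    · filter_upwards [hTz (isOpen_Ioo.mem_nhds hzab), isOpen_Ioo.mem_nhds hzab,
        hlin (isOpen_Ioi.mem_nhds one_pos)] with x hTx hx hx1
      by_cases hxC : x ∈ C
      swap
      · simp [hxC, hout 1 x hxC]
      have hne : ∀ y ∈ C, y - z ≠ 0 := fun y hy h => hz (by rwa [← sub_eq_zero.1 h])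
      have hpath : ∀ s ∈ Icc (0 : ℝ) 1, v (Φ s x) = c * (Φ s x - z) ^ 2 := by
        intro s hs
        refine hab ?_ (hΦC s x hxC)
        have h1 := htm x hs.1
        have h2 := htm x hs.2
        simp only [hzero] at h1 h2
        exact ⟨hx.1.trans_le h1, h2.trans_lt hTx.2⟩
      -- The equation `u' = c * u ^ 2` makes `u⁻¹ + c * s` a constant of motion, so the time-one map
      -- near `z` is a Möbius map.
      have hd : ∀ s ∈ Icc (0 : ℝ) 1,
          HasDerivAt (fun s => (Φ s x - z)⁻¹ + c * s) 0 s := by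
        intro s hs
        have hn := hne _ (hΦC s x hxC)
        have := (((hderiv s x).sub_const z).fun_inv hn).fun_add ((hasDerivAt_id s).const_mul c)
        refine this.congr_deriv ?_
        rw [hpath s hs]
        field_simp
        ring
      have hcst := constant_of_derivWithin_zero (a := (0 : ℝ)) (b := 1)
        (f := fun s => (Φ s x - z)⁻¹ + c * s)
        (fun s hs => (hd s hs).differentiableAt.differentiableWithinAt)
        (fun s hs => (hd s (Ico_subset_Icc_self hs)).hasDerivWithinAt.derivWithin
          (uniqueDiffOn_Icc one_pos s (Ico_subset_Icc_self hs))) 1 (right_mem_Icc.2 zero_le_one)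
      simp only [hzero, mul_one, mul_zero, add_zero] at hcst
      have n1 := hne _ hxC
      have n2 := hne _ (hΦC 1 x hxC)
      have n3 : (1 - c * (x - z)) ≠ 0 := ne_of_gt hx1
      have e1 : Φ 1 x - z = (x - z) * (1 - c * (x - z))⁻¹ := by
        have e2 : (Φ 1 x - z)⁻¹ = (x - z)⁻¹ * (1 - c * (x - z)) := by
          rw [eq_sub_of_add_eq hcst]
          field_simp
        rw [← inv_inv (Φ 1 x - z), e2, mul_inv, inv_inv]
      refine ⟨by simp [hxC, e1], ?_⟩
      have hvx := hpath 0 (left_mem_Icc.2 zero_le_one)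
      have hvT := hpath 1 (right_mem_Icc.2 zero_le_one)
      rw [hzero] at hvx
      have hcne : c ≠ 0 := by
        rintro rfl
        have := hpos x hxC
        rw [hvx] at this
        simp at this
      simp only [hxC, if_true]
      rw [hvT, hvx, e1]
      field_simp
  refine ⟨Φ, fun x => if x ∈ C then v (Φ 1 x) * (v x)⁻¹ else 1,
    ⟨hv, hzero, hadd, hderiv, ?_, fun x => Or.inl (htm x), ?_, ?_, ?_⟩, hle, ?_⟩
  · intro t x hx
    exact hout t x fun hxC => (hpos x hxC).ne' hx
  · intro x
    by_cases hx : x ∈ C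
    · have hd : HasDerivAt (fun y => H (h y + 1)) (v (H (h x + 1)) * (v x)⁻¹) x :=
        (hHd (h x + 1)).comp x ((hh x hx).add_const 1)
      simp only [hx, if_true, hin 1 x hx]
      refine hd.congr_of_eventuallyEq ?_
      filter_upwards [hC.mem_nhds hx] with y hy using hin 1 y hy
    · obtain ⟨m, hm1, hm2⟩ := hkey x hx
      simp only [hx, if_false]
      rw [hasDerivAt_iff_tendsto_slope]
      refine (hm1.mono_left nhdsWithin_le_nhds).congr' ?_
      filter_upwards [nhdsWithin_le_nhds hm2, self_mem_nhdsWithin] with y hy hyx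
      have : y - x ≠ 0 := sub_ne_zero.2 hyx
      rw [slope_def_field, hout 1 x hx, hy.1]
      field_simp
  · rw [continuous_iff_continuousAt]
    intro x
    by_cases hx : x ∈ C
    · have hc : ContinuousAt (fun y => v (Φ 1 y) * (v y)⁻¹) x :=
        ((hv.continuous.comp hTc).continuousAt).mul
          (hv.continuous.continuousAt.inv₀ (hpos x hx).ne')
      refine hc.congr ?_
      filter_upwards [hC.mem_nhds hx] with y hy
      simp [hy]
    · obtain ⟨m, hm1, hm2⟩ := hkey x hx
      have : Tendsto (fun y => m y ^ 2) (𝓝 x) (𝓝 1) := by simpa using hm1.pow 2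
      unfold ContinuousAt
      simp only [hx, if_false]
      refine this.congr' ?_
      filter_upwards [hm2] with y hy using hy.2.symm
  · intro x
    by_cases hx : x ∈ C
    · simp only [hx, if_true]
      exact mul_pos (hpos _ (hΦC 1 x hx)) (inv_pos.2 (hpos x hx))
    · simp [hx]
  · intro x hx
    exact ⟨hΦC 1 x hx, by rw [hin 1 x hx, hhH]⟩

/-! ### Diffeomorphisms of the line and the equation `v (S x) = v x * S' x` -/

/-- `S` is a diffeomorphism of the line with inverse `R` and locally Lipschitz positive
derivative `S'`. -/
structure IsLipDiffeo (S R S' : ℝ → ℝ) : Prop where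
  hasDerivAt : ∀ x, HasDerivAt S (S' x) x
  lip : LocallyLipschitz S'
  pos : ∀ x, 0 < S' x
  left_inv : ∀ x, R (S x) = x
  right_inv : ∀ x, S (R x) = x

namespace IsLipDiffeo

variable {S R S' : ℝ → ℝ}

theorem strictMono (h : IsLipDiffeo S R S') : StrictMono S :=
  strictMono_of_hasDerivAt_pos h.hasDerivAt h.pos

theorem continuous (h : IsLipDiffeo S R S') : Continuous S :=
  continuous_iff_continuousAt.2 fun x => (h.hasDerivAt x).continuousAt

theorem strictMono_inv (h : IsLipDiffeo S R S') : StrictMono R := by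
  intro x y hxy
  rwa [← h.strictMono.lt_iff_lt, h.right_inv, h.right_inv]

theorem continuous_inv (h : IsLipDiffeo S R S') : Continuous R :=
  h.strictMono_inv.monotone.continuous_of_surjective fun y => ⟨S y, h.left_inv y⟩

theorem lip_inv (h : IsLipDiffeo S R S') : LocallyLipschitz R := by
  have hd : ∀ y, HasDerivAt R (S' (R y))⁻¹ y := fun y =>
    HasDerivAt.of_local_left_inverse h.continuous_inv.continuousAt (h.hasDerivAt _)
      (h.pos _).ne' (Eventually.of_forall h.right_inv)
  refine ContDiff.locallyLipschitz (𝕂 := ℝ) (contDiff_one_iff_deriv.2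
    ⟨fun y => (hd y).differentiableAt, ?_⟩)
  rw [funext fun y => (hd y).deriv]
  exact (h.lip.continuous.comp h.continuous_inv).inv₀ fun y => (h.pos _).ne'

theorem reflect (h : IsLipDiffeo S R S') :
    IsLipDiffeo (fun x => -S (-x)) (fun x => -R (-x)) (fun x => S' (-x)) where
  hasDerivAt x := by simpa using ((h.hasDerivAt (-x)).comp x (hasDerivAt_neg x)).fun_neg
  lip := h.lip.comp LocallyLipschitz.id.neg
  pos x := h.pos _
  left_inv x := by simp [h.left_inv]
  right_inv x := by simp [h.right_inv]

end IsLipDiffeo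

/-- Initial velocity for `abelSeq`: quadratic on `[z, α]`, interpolating from `1` to `m` on
`[α, β]`, constant beyond. -/
noncomputable def abelBase (z α β m : ℝ) (y : ℝ) : ℝ :=
  if y ≤ α then ((max y z - z) / (α - z)) ^ 2 else 1 + (m - 1) * min 1 ((max y α - α) / (β - α))

/-- Velocities which satisfy `v (S x) = v x * S' x` on longer and longer intervals `[α, d]`. -/
noncomputable def abelSeq (S R S' : ℝ → ℝ) (z α : ℝ) : ℕ → ℝ → ℝ
  | 0 => abelBase z α (S α) (S' α)
  | n + 1 => fun y => if y ≤ S α then abelBase z α (S α) (S' α) y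
      else abelSeq S R S' z α n (R y) * S' (R y)

section Abel

variable {S R S' : ℝ → ℝ} {z α d : ℝ}

theorem abelBase_lip {β m : ℝ} (hz : z < α) : LocallyLipschitz (abelBase z α β m) := by
  refine LocallyLipschitz.glue ?_ ?_ ?_
  · have h1 : LocallyLipschitz (fun y : ℝ => (y - z) / (α - z)) := by
      refine ContDiff.locallyLipschitz (𝕂 := ℝ) ?_
      fun_prop
    have h2 : LocallyLipschitz (fun y : ℝ => y ^ 2) := by
      refine ContDiff.locallyLipschitz (𝕂 := ℝ) ?_
      fun_prop
    exact h2.comp (h1.comp (LocallyLipschitz.id.max_const z))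
  · have h1 : LocallyLipschitz (fun y : ℝ => (y - α) / (β - α)) := by
      refine ContDiff.locallyLipschitz (𝕂 := ℝ) ?_
      fun_prop
    have h2 : LocallyLipschitz (fun y : ℝ => 1 + (m - 1) * y) := by
      refine ContDiff.locallyLipschitz (𝕂 := ℝ) ?_
      fun_prop
    exact h2.comp ((h1.comp (LocallyLipschitz.id.max_const α)).const_min 1)
  · have : α - z ≠ 0 := (sub_pos.2 hz).ne'
    simp [max_eq_left hz.le, this]

theorem abelBase_pos {β m : ℝ} (hβ : α < β) (hm : 0 < m) {y : ℝ}
    (hy : z < y) : 0 < abelBase z α β m y := by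
  unfold abelBase
  split_ifs with h
  · rw [max_eq_left hy.le]
    have : 0 < (y - z) / (α - z) := div_pos (by linarith) (by linarith)
    positivity
  · rw [max_eq_left (not_le.1 h).le]
    have h0 : 0 ≤ min 1 ((y - α) / (β - α)) :=
      le_min zero_le_one (div_nonneg (by linarith) (by linarith))
    have h1 : min 1 ((y - α) / (β - α)) ≤ 1 := min_le_left _ _
    rcases h1.lt_or_eq with h2 | h2
    · nlinarith
    · rw [h2]
      linarith

theorem abelBase_left {β m y : ℝ} (hy : z ≤ y) (hyα : y ≤ α) :
    abelBase z α β m y = ((y - z) / (α - z)) ^ 2 := by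
  rw [abelBase, if_pos hyα, max_eq_left hy]

theorem abelBase_zero {β m y : ℝ} (hz : z < α) (hy : y ≤ z) : abelBase z α β m y = 0 := by
  rw [abelBase, if_pos (hy.trans hz.le), max_eq_right hy]
  simp

theorem abelBase_self {β m : ℝ} (hz : z < α) : abelBase z α β m α = 1 := by
  rw [abelBase_left hz.le le_rfl, div_self (sub_pos.2 hz).ne', one_pow]

theorem abelBase_end {β m : ℝ} (hβ : α < β) : abelBase z α β m β = m := by
  rw [abelBase, if_neg (not_le.2 hβ), max_eq_left hβ.le, div_self (sub_pos.2 hβ).ne', min_self]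
  ring

variable (hS : IsLipDiffeo S R S') (hz : z < α) (hα : α < S α)

include hS hz hα in
theorem abelSeq_lip (n : ℕ) : LocallyLipschitz (abelSeq S R S' z α n) := by
  have hb := abelBase_lip (β := S α) (m := S' α) hz
  -- The value `1` at `α` is carried along because the two branches then agree at `S α`: both are
  -- `S' α` there.
  have key : ∀ n, abelSeq S R S' z α n α = 1 ∧ LocallyLipschitz (abelSeq S R S' z α n) := by
    intro n
    induction n with
    | zero => exact ⟨abelBase_self hz, hb⟩
    | succ n ih =>
      refine ⟨?_, ?_⟩
      · simp only [abelSeq, if_pos hα.le, abelBase_self hz]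
      · refine LocallyLipschitz.glue hb (LocallyLipschitz.real_mul (ih.2.comp hS.lip_inv)
          (hS.lip.comp hS.lip_inv)) ?_
        simp only [abelBase_end hα, hS.left_inv, ih.1, one_mul]
  exact (key n).2

include hS hz hα in
theorem abelSeq_pos (n : ℕ) {y : ℝ} (hy : z < y) : 0 < abelSeq S R S' z α n y := by
  induction n generalizing y with
  | zero => exact abelBase_pos hα (hS.pos _) hy
  | succ n ih =>
    simp only [abelSeq]
    split_ifs with h
    · exact abelBase_pos hα (hS.pos _) hy
    · refine mul_pos (ih (hz.trans ?_)) (hS.pos _)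
      rw [← hS.left_inv α]
      exact hS.strictMono_inv (not_le.1 h)

include hα in
theorem abelSeq_of_le (n : ℕ) {y : ℝ} (hy : y ≤ α) :
    abelSeq S R S' z α n y = abelBase z α (S α) (S' α) y := by
  cases n with
  | zero => rfl
  | succ n => simp only [abelSeq, if_pos (hy.trans hα.le)]

theorem abelSeq_succ_of_lt (n : ℕ) {y : ℝ} (hy : S α < y) :
    abelSeq S R S' z α (n + 1) y = abelSeq S R S' z α n (R y) * S' (R y) := by
  simp only [abelSeq, if_neg (not_le.2 hy)]

theorem abelSeq_succ_of_le (n : ℕ) {y : ℝ} (hy : y ≤ S α) :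
    abelSeq S R S' z α (n + 1) y = abelBase z α (S α) (S' α) y := by
  simp only [abelSeq, if_pos hy]

include hS in
-- Each step of the recursion pulls the argument back once by `R`, so successive approximants can
-- differ only after `n + 1` pull-backs still leave the argument beyond `α`.
theorem abelSeq_succ_eq (n : ℕ) {y : ℝ} (hy : y ≤ S^[n + 1] α) :
    abelSeq S R S' z α (n + 1) y = abelSeq S R S' z α n y := by
  induction n generalizing y with
  | zero =>
    have : y ≤ S α := hy
    simp only [abelSeq, if_pos this]
  | succ n ih =>
    by_cases h : y ≤ S α
    · simp only [abelSeq, if_pos h]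
    · have : R y ≤ S^[n + 1] α := by
        rw [← hS.strictMono.le_iff_le, hS.right_inv]
        rw [Function.iterate_succ_apply'] at hy
        exact hy
      have e := ih this
      rw [abelSeq_succ_of_lt (n + 1) (not_le.1 h), e, abelSeq_succ_of_lt n (not_le.1 h)]

include hS hα in
theorem iterate_mono : Monotone fun n => S^[n] α :=
  hS.strictMono.monotone.monotone_iterate_of_le_map hα.le

include hS hα in
theorem abelSeq_eq_of_le {n k : ℕ} (hnk : n ≤ k) {y : ℝ} (hy : y ≤ S^[n + 1] α) :
    abelSeq S R S' z α k y = abelSeq S R S' z α n y := by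
  induction k, hnk using Nat.le_induction with
  | base => rfl
  | succ k hk ih =>
    rw [abelSeq_succ_eq hS k (hy.trans (iterate_mono hS hα (by omega))), ih]

include hS hz hα in
theorem abelSeq_map (n : ℕ) {x : ℝ} (hx : α ≤ x) (hx' : x ≤ S^[n + 1] α) :
    abelSeq S R S' z α (n + 1) (S x) = abelSeq S R S' z α (n + 1) x * S' x := by
  rw [abelSeq_succ_eq hS n hx']
  rcases hx.eq_or_lt with rfl | hx
  · rw [abelSeq_of_le hα n le_rfl, abelBase_self hz, abelSeq_succ_of_le n le_rfl,
      abelBase_end hα, one_mul]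
  · rw [abelSeq_succ_of_lt n (hS.strictMono hx), hS.left_inv]

include hS in
-- Otherwise the increasing bounded iterates would converge to a fixed point of `S` in `[α, d]`.
theorem exists_le_iterate (hd : ∀ x ∈ Icc α d, x < S x) : ∃ n, d ≤ S^[n] α := by
  by_contra! hcon
  have hα : α < S α := hd α ⟨le_rfl, (hcon 0).le⟩
  have hm := iterate_mono hS hα
  have hb : BddAbove (range fun n => S^[n] α) := ⟨d, by rintro _ ⟨n, rfl⟩; exact (hcon n).le⟩
  have ht := tendsto_atTop_ciSup hm hb
  have hfix := isFixedPt_of_tendsto_iterate ht hS.continuous.continuousAt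
  have h1 : α ≤ ⨆ n, S^[n] α := le_ciSup hb 0
  have h2 : ⨆ n, S^[n] α ≤ d := ciSup_le fun n => (hcon n).le
  exact (hd _ ⟨h1, h2⟩).ne' hfix

/-- A solution `v` of `v (S x) = v x * S' x` on `[α, d]`. -/
structure IsAbelVelocity (S S' : ℝ → ℝ) (z α : ℝ) (s : Set ℝ) (v : ℝ → ℝ) : Prop where
  lip : LocallyLipschitz v
  pos : ∀ y, z < y → 0 < v y
  zero : ∀ y ≤ z, v y = 0
  quad : ∀ y, z ≤ y → y ≤ α → v y = ((y - z) / (α - z)) ^ 2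
  map : ∀ x ∈ s, v (S x) = v x * S' x

include hS hz in
theorem exists_abelVelocity_Icc (hαd : α ≤ d) (hd : ∀ x ∈ Icc α d, x < S x) :
    ∃ v, IsAbelVelocity S S' z α (Icc α d) v := by
  have hα : α < S α := hd α ⟨le_rfl, hαd⟩
  obtain ⟨n, hn⟩ := exists_le_iterate hS hd
  refine ⟨abelSeq S R S' z α (n + 1), abelSeq_lip hS hz hα _, fun y hy =>
    abelSeq_pos hS hz hα _ hy, fun y hy => ?_, fun y h1 h2 => ?_, fun x hx => ?_⟩
  · rw [abelSeq_of_le hα _ (hy.trans hz.le), abelBase_zero hz hy]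
  · rw [abelSeq_of_le hα _ h2, abelBase_left h1 h2]
  · exact abelSeq_map hS hz hα n hx.1
      (hx.2.trans (hn.trans (iterate_mono hS hα (Nat.le_succ n))))

include hS hz in
theorem exists_abelVelocity_Ici (hd : ∀ x, α ≤ x → x < S x) :
    ∃ v, IsAbelVelocity S S' z α (Ici α) v := by
  have hα : α < S α := hd α le_rfl
  -- The approximants stabilize at every point. The strict inequality makes them stabilize on a
  -- neighbourhood, so the limit inherits the local Lipschitz property.
  have hex : ∀ y, ∃ n, y < S^[n + 1] α := by
    intro y
    obtain ⟨n, hn⟩ := exists_le_iterate (d := y + 1) hS fun x hx => hd x hx.1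
    exact ⟨n, by linarith [iterate_mono hS hα (Nat.le_succ n)]⟩
  choose k hk using hex
  have hv : ∀ n y, y ≤ S^[n + 1] α → abelSeq S R S' z α (k y) y = abelSeq S R S' z α n y := by
    intro n y hy
    rcases le_total n (k y) with h | h
    · exact abelSeq_eq_of_le hS hα h hy
    · exact (abelSeq_eq_of_le hS hα h (hk y).le).symm
  refine ⟨fun y => abelSeq S R S' z α (k y) y, ?_, fun y hy => abelSeq_pos hS hz hα _ hy,
    fun y hy => ?_, fun y h1 h2 => ?_, fun x hx => ?_⟩
  · intro y
    obtain ⟨K, t, ht, hK⟩ := abelSeq_lip hS hz hα (k y) y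
    refine ⟨K, t ∩ Iio (S^[k y + 1] α), inter_mem ht (isOpen_Iio.mem_nhds (hk y)), ?_⟩
    intro a ha b hb
    simp only [hv (k y) a (le_of_lt ha.2), hv (k y) b (le_of_lt hb.2)]
    exact hK ha.1 hb.1
  · rw [abelSeq_of_le hα _ (hy.trans hz.le), abelBase_zero hz hy]
  · rw [abelSeq_of_le hα _ h2, abelBase_left h1 h2]
  · have h1 : x ≤ S^[k (S x) + 1] α := (hd x hx).le.trans (hk _).le
    have h2 : S^[k (S x) + 1] α ≤ S^[k (S x) + 1 + 1] α := iterate_mono hS hα (Nat.le_succ _)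
    rw [hv (k (S x) + 1) (S x) ((hk _).le.trans h2), hv (k (S x) + 1) x (h1.trans h2)]
    exact abelSeq_map hS hz hα _ hx h1

end Abel

/-! ### Divergence of travel times at quadratic zeros -/

section TravelTime

variable {v h : ℝ → ℝ} {C : Set ℝ}

theorem exists_travelTime (hC : IsOpen C) [hoc : OrdConnected C] (hv : ContinuousOn v C)
    (hpos : ∀ x ∈ C, 0 < v x) {a : ℝ} (ha : a ∈ C) :
    ∃ h : ℝ → ℝ, ∀ x ∈ C, HasDerivAt h (v x)⁻¹ x := by
  have hc : ContinuousOn (fun x => (v x)⁻¹) C := hv.inv₀ fun x hx => (hpos x hx).ne'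
  refine ⟨fun x => ∫ y in a..x, (v y)⁻¹, fun x hx => ?_⟩
  refine intervalIntegral.integral_hasDerivAt_right ?_ ?_ (hc.continuousAt (hC.mem_nhds hx))
  · exact (hc.mono (hoc.uIcc_subset ha hx)).intervalIntegrable
  · exact ⟨C, hC.mem_nhds hx, hc.aestronglyMeasurable hC.measurableSet⟩

theorem eq_of_hasDerivAt_zero {f : ℝ → ℝ} {a b : ℝ} (hab : a ≤ b)
    (hf : ∀ x ∈ Icc a b, HasDerivAt f 0 x) : f b = f a := by
  rcases hab.eq_or_lt with rfl | hab
  · rfl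
  refine constant_of_derivWithin_zero
    (fun x hx => (hf x hx).differentiableAt.differentiableWithinAt) (fun x hx => ?_) b
    (right_mem_Icc.2 hab.le)
  exact (hf x (Ico_subset_Icc_self hx)).hasDerivWithinAt.derivWithin
    (uniqueDiffOn_Icc hab x (Ico_subset_Icc_self hx))

/-- The travel time is explicitly a constant minus `(c * (x - z))⁻¹`, which diverges at `z`. -/
theorem exists_travelTime_lt {z α c : ℝ} (hz : z < α) (hc : 0 < c)
    (hh : ∀ x ∈ Ioc z α, HasDerivAt h (c * (x - z) ^ 2)⁻¹ x) (M : ℝ) : ∃ x ∈ Ioc z α, h x < M := by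
  have hform : ∀ x ∈ Ioc z α, h x = h α + (c * (α - z))⁻¹ - c⁻¹ * (x - z)⁻¹ := by
    intro x hx
    have := eq_of_hasDerivAt_zero (f := fun y => h y + (c * (y - z))⁻¹) hx.2 (by
      intro y hy
      have hyz : 0 < y - z := by linarith [hx.1, hy.1]
      have h1 : HasDerivAt (fun y => c * (y - z)) (c * 1) y :=
        ((hasDerivAt_id y).sub_const z).const_mul c
      refine ((hh y ⟨hx.1.trans_le hy.1, hy.2⟩).fun_add
        (h1.fun_inv (mul_pos hc hyz).ne')).congr_deriv ?_
      field_simp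
      ring)
    rw [mul_inv c (x - z)] at this
    linarith
  have ht : Tendsto (fun x : ℝ => x - z) (𝓝[>] z) (𝓝[>] 0) := by
    refine tendsto_nhdsWithin_iff.2 ⟨?_, ?_⟩
    · have : ContinuousAt (fun x : ℝ => x - z) z := by fun_prop
      have h2 := this.tendsto
      rw [sub_self] at h2
      exact h2.mono_left nhdsWithin_le_nhds
    · filter_upwards [self_mem_nhdsWithin] with x hx using sub_pos.2 (mem_Ioi.1 hx)
  have ht2 := (tendsto_inv_nhdsGT_zero.comp ht).const_mul_atTop (inv_pos.2 hc)
  obtain ⟨x, hx1, hx2⟩ := ((ht2.eventually_gt_atTop (h α + (c * (α - z))⁻¹ - M)).and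
    (Ioc_mem_nhdsGT hz)).exists
  refine ⟨x, hx2, ?_⟩
  rw [hform x hx2]
  simp only [Function.comp] at hx1
  linarith

theorem exists_lt_travelTime {z α c : ℝ} (hz : α < z) (hc : 0 < c)
    (hh : ∀ x ∈ Ico α z, HasDerivAt h (c * (x - z) ^ 2)⁻¹ x) (M : ℝ) : ∃ x ∈ Ico α z, M < h x := by
  obtain ⟨x, hx, hxM⟩ := exists_travelTime_lt (h := fun x => -h (-x)) (neg_lt_neg hz) hc (by
    intro x hx
    have := ((hh (-x) ⟨by linarith [hx.2], by linarith [hx.1]⟩).comp x (hasDerivAt_neg x)).fun_neg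
    refine this.congr_deriv ?_
    rw [mul_neg_one, neg_neg]
    congr 2
    ring) (-M)
  exact ⟨-x, ⟨by linarith [hx.2], by linarith [hx.1]⟩, by linarith⟩

theorem image_eq_univ [hoc : OrdConnected C] (hc : ContinuousOn h C)
    (hlow : ∀ M, ∃ x ∈ C, h x < M) (hup : ∀ M, ∃ x ∈ C, M < h x) : h '' C = univ := by
  refine eq_univ_of_forall fun t => ?_
  obtain ⟨a, ha, hat⟩ := hlow t
  obtain ⟨b, hb, hbt⟩ := hup t
  exact hoc.isPreconnected.intermediate_value ha hb hc ⟨hat.le, hbt.le⟩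

end TravelTime

/-! ### Fields with prescribed time-one map away from the fixed points -/

section Fields

variable {S R S' : ℝ → ℝ} {α d z : ℝ}

/-- The derivative of `h (S y) - h y` is `S' y / v (S y) - 1 / v y`, which the equation for `v`
makes zero. -/
theorem travelTime_map (hS : IsLipDiffeo S R S') {v h : ℝ → ℝ} {C s : Set ℝ}
    (hpos : ∀ x ∈ C, 0 < v x) (hh : ∀ x ∈ C, HasDerivAt h (v x)⁻¹ x) (hsC : s ⊆ C)
    (hs : ∀ x ∈ s, Icc α x ⊆ s ∧ α ≤ x) (hSC : ∀ x ∈ s, S x ∈ C)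
    (hmap : ∀ x ∈ s, v (S x) = v x * S' x) : ∀ x ∈ s, h (S x) - h x = h (S α) - h α := by
  intro x hx
  refine eq_of_hasDerivAt_zero (f := fun y => h (S y) - h y) (hs x hx).2 fun y hy => ?_
  have hys := (hs x hx).1 hy
  refine (((hh _ (hSC y hys)).comp y (hS.hasDerivAt y)).fun_sub
    (hh y (hsC hys))).congr_deriv ?_
  have := hpos _ (hsC hys)
  have := hS.pos y
  rw [hmap y hys]
  field_simp
  ring

/-- A velocity that satisfies the equation `v (S x) = v x * S' x` on `s`, multiplied by a constant,
has a flow with time-one map `S` on `s`. -/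
theorem exists_field_of_abel (hS : IsLipDiffeo S R S') {v : ℝ → ℝ} {C s : Set ℝ}
    (hv : LocallyLipschitz v) (hC : IsOpen C) [hoc : OrdConnected C]
    (hpos : ∀ x ∈ C, 0 < v x) (h0 : ∀ x ∉ C, v x = 0) (hsC : s ⊆ C)
    (hs : ∀ x ∈ s, Icc α x ⊆ s ∧ α ≤ x) (hαs : α ∈ s) (hα : α < S α) (hSC : ∀ x ∈ s, S x ∈ C)
    (hmap : ∀ x ∈ s, v (S x) = v x * S' x)
    (hlow : ∀ h : ℝ → ℝ, (∀ x ∈ C, HasDerivAt h (v x)⁻¹ x) → ∀ M, ∃ x ∈ C, h x < M)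
    (hup : ∀ h : ℝ → ℝ, (∀ x ∈ C, HasDerivAt h (v x)⁻¹ x) → ∀ M, ∃ x ∈ C, M < h x)
    (hq : ∀ z ∉ C, ∃ c, ∀ᶠ x in 𝓝 z, x ∈ C → v x = c * (x - z) ^ 2) :
    ∃ w Φ D, IsFlowField w Φ D ∧ (∀ y, w y ≠ 0 ↔ y ∈ C) ∧ (∀ x, x ≤ Φ 1 x) ∧
      ∀ x ∈ s, Φ 1 x = S x := by
  obtain ⟨h, hh⟩ := exists_travelTime hC hv.continuous.continuousOn hpos (hsC hαs)
  have hmono := (exists_inverse_of_hasDerivAt hC hh fun x hx => inv_pos.2 (hpos x hx)).1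
  -- For the field `v`, passing from `x` to `S x` takes time `l`; multiplying the field by `l`
  -- normalizes this to one.
  obtain ⟨l, hl⟩ : ∃ l, l = h (S α) - h α := ⟨_, rfl⟩
  have hlpos : 0 < l := by
    rw [hl, sub_pos]
    exact hmono (hsC hαs) (hSC α hαs) hα
  have hh1 : ∀ x ∈ C, HasDerivAt (fun y => l⁻¹ * h y) (l * v x)⁻¹ x := by
    intro x hx
    rw [mul_inv]
    exact (hh x hx).const_mul _
  have hsurj : (fun y => l⁻¹ * h y) '' C = univ := by
    refine image_eq_univ (fun x hx => (hh1 x hx).continuousAt.continuousWithinAt) ?_ ?_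
    · intro M
      obtain ⟨x, hx, hxM⟩ := hlow h hh (l * M)
      refine ⟨x, hx, ?_⟩
      rwa [inv_mul_lt_iff₀ hlpos]
    · intro M
      obtain ⟨x, hx, hxM⟩ := hup h hh (l * M)
      refine ⟨x, hx, ?_⟩
      rwa [lt_inv_mul_iff₀ hlpos]
  obtain ⟨Φ, D, hf, hle, hmem⟩ := exists_isFlowField_of_travelTime
    (v := fun x => l * v x) (LocallyLipschitz.const_mul hv l) hC
    (fun x hx => mul_pos hlpos (hpos x hx)) (fun x hx => by simp [h0 x hx]) hh1 hsurj (by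
      intro z hz
      obtain ⟨c, hc⟩ := hq z hz
      refine ⟨l * c, ?_⟩
      filter_upwards [hc] with x hx hxC
      rw [hx hxC, mul_assoc])
  refine ⟨_, Φ, D, hf, ?_, hle, ?_⟩
  · intro y
    by_cases hy : y ∈ C
    · simp [hy, hlpos.ne', (hpos y hy).ne']
    · simp [hy, h0 y hy]
  · intro x hx
    obtain ⟨h1, h2⟩ := hmem x (hsC hx)
    refine hmono.injOn h1 (hSC x hx) ?_
    have h3 := travelTime_map hS hpos hh hsC hs hSC hmap x hx
    rw [← hl] at h3
    field_simp at h2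
    linarith

/-- No cut-off is needed on the right: each application of `S` adds the same positive travel time,
so the travel time is unbounded along the iterates of `α` and the flow does not escape to infinity.
-/
theorem exists_tail_field (hS : IsLipDiffeo S R S') (hz : z < α) (hd : ∀ x, α ≤ x → x < S x) :
    ∃ w Φ D, IsFlowField w Φ D ∧ (∀ y, w y ≠ 0 → z < y) ∧ (∀ x, x ≤ Φ 1 x) ∧
      ∀ x, α ≤ x → Φ 1 x = S x := by
  obtain ⟨v, hv⟩ := exists_abelVelocity_Ici hS hz hd
  have hα := hd α le_rfl
  have hquad : ∀ x, z < x → x ≤ α → v x = ((α - z) ^ 2)⁻¹ * (x - z) ^ 2 := by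
    intro x h1 h2
    rw [hv.quad x h1.le h2, div_pow]
    ring
  have hc : 0 < ((α - z) ^ 2)⁻¹ := by
    have := sub_pos.2 hz
    positivity
  have hsC : Ici α ⊆ Ioi z := fun x hx => hz.trans_le hx
  have hs : ∀ x ∈ Ici α, Icc α x ⊆ Ici α ∧ α ≤ x := fun x hx => ⟨fun y hy => hy.1, hx⟩
  have hSC : ∀ x ∈ Ici α, S x ∈ Ioi z := fun x hx => hz.trans_le (le_trans hx (hd x hx).le)
  have hlow : ∀ h : ℝ → ℝ, (∀ x ∈ Ioi z, HasDerivAt h (v x)⁻¹ x) →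
      ∀ M, ∃ x ∈ Ioi z, h x < M := by
    intro h hh M
    obtain ⟨x, hx, hxM⟩ := exists_travelTime_lt (h := h) hz hc (fun x hx => by
      rw [← hquad x hx.1 hx.2]
      exact hh x hx.1) M
    exact ⟨x, hx.1, hxM⟩
  have hup : ∀ h : ℝ → ℝ, (∀ x ∈ Ioi z, HasDerivAt h (v x)⁻¹ x) →
      ∀ M, ∃ x ∈ Ioi z, M < h x := by
    intro h hh M
    have hmap := travelTime_map hS hv.pos hh hsC hs hSC hv.map
    have hmono := (exists_inverse_of_hasDerivAt isOpen_Ioi hh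
      fun x hx => inv_pos.2 (hv.pos x hx)).1
    have hl : 0 < h (S α) - h α := sub_pos.2 (hmono hz (hz.trans hα) hα)
    have hit : ∀ n, α ≤ S^[n] α ∧ h (S^[n] α) = h α + n * (h (S α) - h α) := by
      intro n
      induction n with
      | zero => simp
      | succ n ih =>
        rw [Function.iterate_succ_apply']
        refine ⟨ih.1.trans (hd _ ih.1).le, ?_⟩
        have := hmap _ ih.1
        push_cast
        linarith [ih.2]
    obtain ⟨n, hn⟩ := exists_nat_gt ((M - h α) / (h (S α) - h α))
    refine ⟨S^[n] α, hz.trans_le (hit n).1, ?_⟩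
    rw [(hit n).2]
    rw [div_lt_iff₀ hl] at hn
    linarith
  have hq : ∀ y ∉ Ioi z, ∃ c, ∀ᶠ x in 𝓝 y, x ∈ Ioi z → v x = c * (x - y) ^ 2 := by
    intro y hy
    rcases (le_of_not_gt hy : y ≤ z).lt_or_eq with hy | rfl
    · refine ⟨0, ?_⟩
      filter_upwards [isOpen_Iio.mem_nhds hy] with x hx hx'
      exact absurd (mem_Ioi.1 hx') (not_lt.2 (le_of_lt hx))
    · refine ⟨((α - y) ^ 2)⁻¹, ?_⟩
      filter_upwards [isOpen_Iio.mem_nhds hz] with x hx hx'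
      exact hquad x hx' (le_of_lt hx)
  obtain ⟨w, Φ, D, h1, h2, h3, h4⟩ := exists_field_of_abel (α := α) hS hv.lip
    (isOpen_Ioi (a := z)) hv.pos (fun x hx => hv.zero x (not_lt.1 hx)) hsC hs
    self_mem_Ici hα hSC hv.map hlow hup hq
  exact ⟨w, Φ, D, h1, fun y hy => (h2 y).1 hy, h3, h4⟩

/-- The equation on `[α, d]` involves `v` only up to `S d`. Beyond that point `v` can be replaced by
a multiple of `(y - z') ^ 2`, which confines the flow to `(z, z')`. The end `z'` will be the next
fixed point, or an arbitrary point beyond the last one. -/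
theorem exists_cut_field (hS : IsLipDiffeo S R S') (hz : z < α) (hαd : α ≤ d)
    (hd : ∀ x ∈ Icc α d, x < S x) {z' : ℝ} (hz' : S d < z') :
    ∃ w Φ D, IsFlowField w Φ D ∧ (∀ y, w y ≠ 0 → y ∈ Ioo z z') ∧ (∀ x, x ≤ Φ 1 x) ∧
      ∀ x ∈ Icc α d, Φ 1 x = S x := by
  obtain ⟨v, hv⟩ := exists_abelVelocity_Icc hS hz hαd hd
  have hα := hd α ⟨le_rfl, hαd⟩
  have hSm := hS.strictMono
  have hαb : α < S d := hα.trans_le (hSm.monotone hαd)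
  have hzb : z < S d := hz.trans hαb
  have hvb := hv.pos _ hzb
  obtain ⟨u, hu⟩ : ∃ u : ℝ → ℝ, ∀ y, u y = if y ≤ S d then v y else
      v (S d) * ((z' - min y z') / (z' - S d)) ^ 2 := ⟨_, fun _ => rfl⟩
  have hu1 : ∀ y ≤ S d, u y = v y := fun y hy => by rw [hu, if_pos hy]
  have hu2 : ∀ y, S d ≤ y → y ≤ z' → u y = v (S d) / (z' - S d) ^ 2 * (y - z') ^ 2 := by
    intro y h1 h2
    rcases h1.eq_or_lt with rfl | h1
    · rw [hu1 _ le_rfl]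
      have : z' - S d ≠ 0 := (sub_pos.2 hz').ne'
      have e : (S d - z') ^ 2 = (z' - S d) ^ 2 := by ring
      rw [e]
      field_simp
    · rw [hu, if_neg (not_le.2 h1), min_eq_left h2, div_pow]
      ring
  have hulip : LocallyLipschitz u := by
    have e : u = fun y => if y ≤ S d then v y else
      v (S d) * ((z' - min y z') / (z' - S d)) ^ 2 := funext hu
    rw [e]
    refine LocallyLipschitz.glue hv.lip ?_ ?_
    · have h2 : LocallyLipschitz (fun y : ℝ => v (S d) * ((z' - y) / (z' - S d)) ^ 2) := by
        refine ContDiff.locallyLipschitz (𝕂 := ℝ) ?_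
        fun_prop
      exact h2.comp (LocallyLipschitz.id.min_const z')
    · have : z' - S d ≠ 0 := (sub_pos.2 hz').ne'
      simp [min_eq_left hz'.le, this]
  have hquad : ∀ x, z < x → x ≤ α → u x = ((α - z) ^ 2)⁻¹ * (x - z) ^ 2 := by
    intro x h1 h2
    rw [hu1 x (h2.trans hαb.le), hv.quad x h1.le h2, div_pow]
    ring
  have hc : 0 < ((α - z) ^ 2)⁻¹ := by
    have := sub_pos.2 hz
    positivity
  have hc' : 0 < v (S d) / (z' - S d) ^ 2 := by
    have := sub_pos.2 hz'
    positivity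
  have hpos : ∀ x ∈ Ioo z z', 0 < u x := by
    intro x hx
    rcases le_total x (S d) with h | h
    · rw [hu1 x h]
      exact hv.pos x hx.1
    · rw [hu2 x h hx.2.le]
      have : x - z' ≠ 0 := (sub_neg.2 hx.2).ne
      positivity
  have hzero : ∀ x ∉ Ioo z z', u x = 0 := by
    intro x hx
    by_cases h : z < x
    · have h' : z' ≤ x := by
        by_contra! hc
        exact hx ⟨h, hc⟩
      rw [hu, if_neg (not_le.2 (hz'.trans_le h')), min_eq_right h']
      simp
    · rw [hu1 x ((not_lt.1 h).trans hzb.le), hv.zero x (not_lt.1 h)]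
  have hle : ∀ x ∈ Icc α d, S x ≤ S d := fun x hx => hSm.monotone hx.2
  have hlt : ∀ x ∈ Icc α d, x ≤ S d := fun x hx => (hd x hx).le.trans (hle x hx)
  have hlow : ∀ h : ℝ → ℝ, (∀ x ∈ Ioo z z', HasDerivAt h (u x)⁻¹ x) →
      ∀ M, ∃ x ∈ Ioo z z', h x < M := by
    intro h hh M
    obtain ⟨x, hx, hxM⟩ := exists_travelTime_lt (h := h) hz hc (fun x hx => by
      rw [← hquad x hx.1 hx.2]
      exact hh x ⟨hx.1, hx.2.trans_lt (hαb.trans hz')⟩) M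
    exact ⟨x, ⟨hx.1, hx.2.trans_lt (hαb.trans hz')⟩, hxM⟩
  have hup : ∀ h : ℝ → ℝ, (∀ x ∈ Ioo z z', HasDerivAt h (u x)⁻¹ x) →
      ∀ M, ∃ x ∈ Ioo z z', M < h x := by
    intro h hh M
    obtain ⟨x, hx, hxM⟩ := exists_lt_travelTime (h := h) hz' hc' (fun x hx => by
      rw [← hu2 x hx.1 hx.2.le]
      exact hh x ⟨hzb.trans_le hx.1, hx.2⟩) M
    exact ⟨x, ⟨hzb.trans_le hx.1, hx.2⟩, hxM⟩
  have hq : ∀ y ∉ Ioo z z', ∃ c, ∀ᶠ x in 𝓝 y, x ∈ Ioo z z' → u x = c * (x - y) ^ 2 := by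
    intro y hy
    by_cases h : z ≤ y
    · rcases h.eq_or_lt with rfl | h
      · refine ⟨((α - z) ^ 2)⁻¹, ?_⟩
        filter_upwards [isOpen_Iio.mem_nhds hz] with x hx hx'
        exact hquad x hx'.1 (le_of_lt hx)
      · have h' : z' ≤ y := by
          by_contra! hc
          exact hy ⟨h, hc⟩
        rcases h'.eq_or_lt with rfl | h'
        · refine ⟨v (S d) / (z' - S d) ^ 2, ?_⟩
          filter_upwards [isOpen_Ioi.mem_nhds hz'] with x hx hx'
          exact hu2 x (le_of_lt hx) hx'.2.le
        · refine ⟨0, ?_⟩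
          filter_upwards [isOpen_Ioi.mem_nhds h'] with x hx hx'
          exact absurd hx'.2 (not_lt.2 (le_of_lt hx))
    · refine ⟨0, ?_⟩
      filter_upwards [isOpen_Iio.mem_nhds (not_le.1 h)] with x hx hx'
      exact absurd hx'.1 (not_lt.2 (le_of_lt hx))
  obtain ⟨w, Φ, D, h1, h2, h3, h4⟩ := exists_field_of_abel (α := α) (s := Icc α d) hS hulip
    (isOpen_Ioo (a := z) (b := z')) hpos hzero
    (fun x hx => ⟨hz.trans_le hx.1, (hlt x hx).trans_lt hz'⟩)
    (fun x hx => ⟨Icc_subset_Icc_right hx.2, hx.1⟩) ⟨le_rfl, hαd⟩ hα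
    (fun x hx => ⟨(hz.trans_le hx.1).trans (hd x hx), (hle x hx).trans_lt hz'⟩)
    (fun x hx => by rw [hu1 _ (hle x hx), hu1 x (hlt x hx), hv.map x hx]) hlow hup hq
  exact ⟨w, Φ, D, h1, fun y hy => (h2 y).1 hy, h3, h4⟩

theorem exists_gap_field_of_lt (hS : IsLipDiffeo S R S') {e e' δ : ℝ} (hδ : 0 < δ)
    (he' : S e' = e') (hd : ∀ x ∈ Ioo e e', x < S x) :
    ∃ w Φ D, IsFlowField w Φ D ∧ (∀ y, w y ≠ 0 → y ∈ Ioo e e') ∧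
      ∀ y ∈ Icc (e + δ) (e' - δ), Φ 1 y = S y := by
  by_cases h : e + δ ≤ e' - δ
  · obtain ⟨w, Φ, D, h1, h2, _, h4⟩ := exists_cut_field (z' := e') hS
      (lt_add_of_pos_right e hδ) h (fun x hx => hd x ⟨by linarith [hx.1], by linarith [hx.2]⟩) (by
        conv_rhs => rw [← he']
        exact hS.strictMono (by linarith))
    exact ⟨w, Φ, D, h1, h2, h4⟩
  · exact ⟨_, _, _, IsFlowField.zero_field, by simp, fun y hy => absurd (hy.1.trans hy.2) h⟩

theorem exists_gap_field (hS : IsLipDiffeo S R S') {e e' δ : ℝ} (hδ : 0 < δ)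
    (he : S e = e) (he' : S e' = e') (hd : ∀ x ∈ Ioo e e', S x ≠ x) :
    ∃ w Φ D, IsFlowField w Φ D ∧ (∀ y, w y ≠ 0 → y ∈ Ioo e e') ∧
      ∀ y ∈ Icc (e + δ) (e' - δ), Φ 1 y = S y := by
  have hcont : ContinuousOn (fun x => S x - x) (Ioo e e') :=
    (hS.continuous.sub continuous_id).continuousOn
  have hsign : (∀ x ∈ Ioo e e', x < S x) ∨ ∀ x ∈ Ioo e e', S x < x := by
    by_contra! hcon
    obtain ⟨⟨x, hx, hxS⟩, y, hy, hyS⟩ := hcon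
    obtain ⟨t, ht, ht0⟩ := isPreconnected_Ioo.intermediate_value hx hy hcont
      (⟨sub_nonpos.2 hxS, sub_nonneg.2 hyS⟩ : (0 : ℝ) ∈ Icc _ _)
    exact hd t ht (sub_eq_zero.1 ht0)
  rcases hsign with h | h
  · exact exists_gap_field_of_lt hS hδ he' h
  · obtain ⟨w, Φ, D, h1, h2, h3⟩ := exists_gap_field_of_lt (e := -e') (e' := -e) hS.reflect hδ
      (by simp [he]) (fun x hx => by
        have := h (-x) ⟨by linarith [hx.2], by linarith [hx.1]⟩
        linarith)
    refine ⟨_, _, _, h1.reflect, ?_, ?_⟩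
    · intro y hy
      have := h2 (-y) (by simpa using hy)
      exact ⟨by linarith [this.2], by linarith [this.1]⟩
    · intro y hy
      have := h3 (-y) ⟨by linarith [hy.2], by linarith [hy.1]⟩
      simp only [this, neg_neg]

/-- A field supported between the extreme fixed points of `S`, with time-one map `S` away from the
fixed points. -/
theorem exists_inner_field (hS : IsLipDiffeo S R S') {E : Finset ℝ} (hE : ∀ y, S y = y ↔ y ∈ E)
    {δ : ℝ} (hδ : 0 < δ) :
    ∃ w Φ D, IsFlowField w Φ D ∧ (∀ y, w y ≠ 0 → (∃ e ∈ E, e < y) ∧ ∃ e ∈ E, y < e) ∧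
      ∀ y, (∃ e ∈ E, e < y) → (∃ e ∈ E, y < e) → (∀ e ∈ E, δ ≤ |y - e|) → Φ 1 y = S y := by
  classical
  have hgap : ∀ e : ℝ, ∃ w Φ D, IsFlowField w Φ D ∧
      (∀ y, w y ≠ 0 → e < y ∧ (∀ f ∈ E, e < f → y < f) ∧ ∃ f ∈ E, y < f) ∧
      (e ∈ E → ∀ y, e + δ ≤ y → (∀ f ∈ E, e < f → y ≤ f - δ) → (∃ f ∈ E, y < f) →
        Φ 1 y = S y) := by
    intro e
    by_cases he : e ∈ E ∧ ∃ f ∈ E, e < f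
    · obtain ⟨heE, f, hf, hef⟩ := he
      obtain ⟨g, hg, hgmin⟩ := (E.filter (e < ·)).exists_min_image id
        ⟨f, Finset.mem_filter.2 ⟨hf, hef⟩⟩
      obtain ⟨hgE, heg⟩ := Finset.mem_filter.1 hg
      have hgle : ∀ f ∈ E, e < f → g ≤ f := fun f hf hef =>
        hgmin f (Finset.mem_filter.2 ⟨hf, hef⟩)
      obtain ⟨w, Φ, D, h1, h2, h3⟩ := exists_gap_field hS hδ ((hE e).2 heE) ((hE g).2 hgE)
        (fun x hx hx' => absurd (hgle x ((hE x).1 hx') hx.1) (not_le.2 hx.2))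
      refine ⟨w, Φ, D, h1, fun y hy => ?_, fun _ y hy1 hy2 _ => h3 y ⟨hy1, hy2 g hgE heg⟩⟩
      have := h2 y hy
      exact ⟨this.1, fun f hf hef => this.2.trans_le (hgle f hf hef), g, hgE, this.2⟩
    · refine ⟨_, _, _, IsFlowField.zero_field, by simp, fun heE y hy1 _ hy3 => ?_⟩
      obtain ⟨f, hf, hyf⟩ := hy3
      exact absurd ⟨heE, f, hf, by linarith⟩ he
  choose w Φ D h1 h2 h3 using hgap
  -- Each gap is indexed by its left end point. Of two fixed points, the larger one lies to the
  -- right of the gap of the smaller, so the supports are disjoint.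
  obtain ⟨Ψ, G, hf, hΨ⟩ := IsFlowField.exists_sum E w Φ D (fun e _ => h1 e) (by
    intro e he f hf hef y
    by_contra! hcon
    rcases lt_or_gt_of_ne hef with h | h
    · exact lt_asymm ((h2 e y hcon.1).2.1 f hf h) (h2 f y hcon.2).1
    · exact lt_asymm ((h2 f y hcon.2).2.1 e he h) (h2 e y hcon.1).1)
  refine ⟨_, Ψ, G, hf, ?_, ?_⟩
  · intro y hy
    obtain ⟨e, he, hey⟩ := Finset.exists_ne_zero_of_sum_ne_zero hy
    exact ⟨⟨e, he, (h2 e y hey).1⟩, (h2 e y hey).2.2⟩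
  · rintro y ⟨e₀, he₀, hey⟩ hy2 hy3
    obtain ⟨e, he, hmax⟩ := (E.filter (· < y)).exists_max_image id
      ⟨e₀, Finset.mem_filter.2 ⟨he₀, hey⟩⟩
    obtain ⟨heE, hey⟩ := Finset.mem_filter.1 he
    have hΦ : Φ e 1 y = S y := by
      refine h3 e heE y ?_ ?_ hy2
      · have := hy3 e heE
        rw [abs_of_pos (sub_pos.2 hey)] at this
        linarith
      · intro f hf hef
        have hfy : y ≤ f := by
          by_contra! hc
          exact absurd (hmax f (Finset.mem_filter.2 ⟨hf, hc⟩)) (not_le.2 hef)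
        have := hy3 f hf
        rw [abs_of_nonpos (sub_nonpos.2 hfy)] at this
        linarith
    have hyE : y ∉ E := fun h => by
      have := hy3 y h
      simp at this
      linarith
    -- The map of this gap field moves `y`, since `S y ≠ y`; hence its field is nonzero at `y`, so
    -- that near `y` only this summand acts.
    have hne : w e y ≠ 0 := by
      intro h0
      rw [(h1 e).fixed 1 y h0] at hΦ
      exact hyE ((hE y).1 hΦ.symm)
    rw [hΨ e heE y hne, hΦ]

/-- Addition of outer fields to the field of `exists_inner_field`. -/
theorem exists_field_of_outer (hS : IsLipDiffeo S R S') {E : Finset ℝ} (hE : ∀ y, S y = y ↔ y ∈ E)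
    (hne : E.Nonempty) {δ : ℝ} (hδ : 0 < δ) {s : Set ℝ} {w₁ w₂ : ℝ → ℝ} {Φ₁ Φ₂ : ℝ → ℝ → ℝ}
    {D₁ D₂ : ℝ → ℝ} (h₁ : IsFlowField w₁ Φ₁ D₁) (h₂ : IsFlowField w₂ Φ₂ D₂)
    (hs₁ : ∀ y, w₁ y ≠ 0 → ∀ e ∈ E, e < y) (hs₂ : ∀ y, w₂ y ≠ 0 → ∀ e ∈ E, y < e)
    (hm₁ : ∀ y ∈ s, (∀ e ∈ E, e + δ ≤ y) → Φ₁ 1 y = S y)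
    (hm₂ : ∀ y ∈ s, (∀ e ∈ E, y ≤ e - δ) → Φ₂ 1 y = S y) :
    ∃ w Φ D, IsFlowField w Φ D ∧
      (∀ y, w y ≠ 0 → w₁ y ≠ 0 ∨ w₂ y ≠ 0 ∨ (∃ e ∈ E, e < y) ∧ ∃ e ∈ E, y < e) ∧
      (∀ y, (∀ e ∈ E, e < y) → Φ 1 y = Φ₁ 1 y) ∧ (∀ y, (∀ e ∈ E, y < e) → Φ 1 y = Φ₂ 1 y) ∧
      ∀ y ∈ s, (∀ e ∈ E, δ ≤ |y - e|) → Φ 1 y = S y := by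
  obtain ⟨w, Φ, D, h1, h2, h3⟩ := exists_inner_field hS hE hδ
  obtain ⟨e₀, he₀⟩ := hne
  have hd1 : ∀ x, w x = 0 ∨ w₁ x = 0 := by
    intro x
    by_contra! hc
    obtain ⟨_, e, he, hxe⟩ := h2 x hc.1
    exact lt_asymm hxe (hs₁ x hc.2 e he)
  have hf1 := h1.add_field h₁ hd1
  have hd2 : ∀ x, w x + w₁ x = 0 ∨ w₂ x = 0 := by
    intro x
    by_contra! hc
    have hx2 := hs₂ x hc.2
    have hw : w x = 0 := by
      by_contra! hc'
      obtain ⟨⟨e, he, hxe⟩, _⟩ := h2 x hc'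
      exact lt_asymm hxe (hx2 e he)
    have hw1 : w₁ x = 0 := by
      by_contra! hc'
      exact lt_asymm (hs₁ x hc' e₀ he₀) (hx2 e₀ he₀)
    exact hc.1 (by rw [hw, hw1, add_zero])
  have hf2 := hf1.add_field h₂ hd2
  have hr : ∀ y, (∀ e ∈ E, e < y) → w y = 0 ∧ w₂ y = 0 := by
    intro y hy
    constructor
    · by_contra! hc
      obtain ⟨_, e, he, hxe⟩ := h2 y hc
      exact lt_asymm hxe (hy e he)
    · by_contra! hc
      exact lt_asymm (hs₂ y hc e₀ he₀) (hy e₀ he₀)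
  have hl : ∀ y, (∀ e ∈ E, y < e) → w y = 0 ∧ w₁ y = 0 := by
    intro y hy
    constructor
    · by_contra! hc
      obtain ⟨⟨e, he, hxe⟩, _⟩ := h2 y hc
      exact lt_asymm hxe (hy e he)
    · by_contra! hc
      exact lt_asymm (hs₁ y hc e₀ he₀) (hy e₀ he₀)
  have hR : ∀ y, (∀ e ∈ E, e < y) → Φ 1 (Φ₁ 1 (Φ₂ 1 y)) = Φ₁ 1 y := by
    intro y hy
    rw [h₂.fixed 1 y (hr y hy).2]
    by_cases h0 : w₁ y = 0
    · rw [h₁.fixed 1 y h0, h1.fixed 1 y (hr y hy).1]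
    · exact IsFlowField.comp_eq_right h1 h₁ hd1 h0 1
  have hL : ∀ y, (∀ e ∈ E, y < e) → Φ 1 (Φ₁ 1 (Φ₂ 1 y)) = Φ₂ 1 y := by
    intro y hy
    by_cases h0 : w₂ y = 0
    · rw [h₂.fixed 1 y h0, h₁.fixed 1 y (hl y hy).2, h1.fixed 1 y (hl y hy).1]
    · exact IsFlowField.comp_eq_right hf1 h₂ hd2 h0 1
  refine ⟨_, _, _, hf2, ?_, hR, hL, ?_⟩
  · intro y hy
    by_cases h0 : w y = 0
    · by_cases h0' : w₁ y = 0
      · right; left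
        simpa [h0, h0'] using hy
      · exact Or.inl h0'
    · exact Or.inr (Or.inr (h2 y h0))
  · intro y hys hy
    have hyE : ∀ e ∈ E, y ≠ e := by
      rintro e he rfl
      have := hy y he
      simp at this
      linarith
    by_cases hr' : ∀ e ∈ E, e < y
    · rw [hR y hr']
      refine hm₁ y hys fun e he => ?_
      have := hy e he
      rw [abs_of_pos (sub_pos.2 (hr' e he))] at this
      linarith
    by_cases hl' : ∀ e ∈ E, y < e
    · rw [hL y hl']
      refine hm₂ y hys fun e he => ?_
      have := hy e he
      rw [abs_of_neg (sub_neg.2 (hl' e he))] at this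
      linarith
    push Not at hr' hl'
    obtain ⟨e, he, hye⟩ := hr'
    obtain ⟨f, hf, hfy⟩ := hl'
    have hye' := lt_of_le_of_ne hye (hyE e he)
    have hfy' := lt_of_le_of_ne hfy (hyE f hf).symm
    have hw1 : w₁ y = 0 := by
      by_contra! hc
      exact lt_asymm hye' (hs₁ y hc e he)
    have hw2 : w₂ y = 0 := by
      by_contra! hc
      exact lt_asymm hfy' (hs₂ y hc f hf)
    rw [h₂.fixed 1 y hw2, h₁.fixed 1 y hw1]
    exact h3 y ⟨f, hf, hfy'⟩ ⟨e, he, hye'⟩ hy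

/-- No fixed point beyond the largest one. -/
theorem lt_of_forall_fixed_lt (hS : IsLipDiffeo S R S') {E : Finset ℝ}
    (hE : ∀ y, S y = y ↔ y ∈ E) {M : ℝ} (hM : ∀ y, M ≤ y → y < S y) {e : ℝ}
    (he : ∀ f ∈ E, f ≤ e) : ∀ y, e < y → y < S y := by
  intro y hy
  by_contra! hc
  have hcont : ContinuousOn (fun x => S x - x) (Icc y (max y M)) :=
    (hS.continuous.sub continuous_id).continuousOn
  obtain ⟨t, ht, ht0⟩ := intermediate_value_Icc (le_max_left y M) hcont
    (⟨sub_nonpos.2 hc, sub_nonneg.2 (hM _ (le_max_right y M)).le⟩ : (0 : ℝ) ∈ Icc _ _)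
  exact absurd (he t ((hE t).1 (sub_eq_zero.1 ht0))) (not_le.2 (hy.trans_le ht.1))

theorem exists_fixed (hS : IsLipDiffeo S R S') {E : Finset ℝ} (hE : ∀ y, S y = y ↔ y ∈ E) {M : ℝ}
    (hM0 : 0 ≤ M) (hM : ∀ y, M ≤ y → y < S y) (hM' : ∀ y ≤ -M, S y < y) : E.Nonempty := by
  have hcont : ContinuousOn (fun x => S x - x) (Icc (-M) M) :=
    (hS.continuous.sub continuous_id).continuousOn
  obtain ⟨t, ht, ht0⟩ := intermediate_value_Icc (by linarith) hcont
    (⟨sub_nonpos.2 (hM' _ le_rfl).le, sub_nonneg.2 (hM _ le_rfl).le⟩ : (0 : ℝ) ∈ Icc _ _)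
  exact ⟨t, (hE t).1 (sub_eq_zero.1 ht0)⟩

theorem reflect_fixed {E : Finset ℝ} (hE : ∀ y, S y = y ↔ y ∈ E) :
    ∀ y, -S (-y) = y ↔ y ∈ E.image (fun x => -x) := by
  intro y
  rw [neg_eq_iff_eq_neg, hE, Finset.mem_image]
  constructor
  · intro h
    exact ⟨-y, h, neg_neg y⟩
  · rintro ⟨x, hx, rfl⟩
    rwa [neg_neg]

/-- This is the version for a Lipschitz field: `S` is matched only up to `M`, the support is bounded
above, and everywhere `y ≤ Φ 1 y`, so that the inverse flow never increases a position. -/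
theorem exists_outer_cut_field (hS : IsLipDiffeo S R S') {E : Finset ℝ}
    (hE : ∀ y, S y = y ↔ y ∈ E) (hne : E.Nonempty) {M δ : ℝ} (hδ : 0 < δ)
    (hM : ∀ y, M ≤ y → y < S y) :
    ∃ w Φ D, IsFlowField w Φ D ∧ (∀ y, w y ≠ 0 → ∀ e ∈ E, e < y) ∧
      (∃ B, ∀ y, w y ≠ 0 → y < B) ∧ (∀ y, y ≤ Φ 1 y) ∧
      ∀ y, y ≤ M → (∀ e ∈ E, e + δ ≤ y) → Φ 1 y = S y := by
  obtain ⟨e, he, hmax⟩ : ∃ e ∈ E, ∀ f ∈ E, f ≤ e := E.exists_max_image id hne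
  have hlt := lt_of_forall_fixed_lt hS hE hM hmax
  by_cases h : e + δ ≤ M
  · obtain ⟨w, Φ, D, h1, h2, h3, h4⟩ := exists_cut_field (z' := S M + 1) hS
      (lt_add_of_pos_right e hδ) h (fun x hx => hlt x (by linarith [hx.1])) (by linarith)
    exact ⟨w, Φ, D, h1, fun y hy f hf => (hmax f hf).trans_lt (h2 y hy).1,
      ⟨_, fun y hy => (h2 y hy).2⟩, h3, fun y hy hy' => h4 y ⟨hy' e he, hy⟩⟩
  · exact ⟨_, _, _, IsFlowField.zero_field, by simp, ⟨0, by simp⟩, fun y => le_rfl,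
      fun y hy hy' => absurd ((hy' e he).trans hy) h⟩

theorem exists_outer_tail_field (hS : IsLipDiffeo S R S') {E : Finset ℝ}
    (hE : ∀ y, S y = y ↔ y ∈ E) (hne : E.Nonempty) {M δ : ℝ} (hδ : 0 < δ)
    (hM : ∀ y, M ≤ y → y < S y) :
    ∃ w Φ D, IsFlowField w Φ D ∧ (∀ y, w y ≠ 0 → ∀ e ∈ E, e < y) ∧
      ∀ y, (∀ e ∈ E, e + δ ≤ y) → Φ 1 y = S y := by
  obtain ⟨e, he, hmax⟩ : ∃ e ∈ E, ∀ f ∈ E, f ≤ e := E.exists_max_image id hne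
  have hlt := lt_of_forall_fixed_lt hS hE hM hmax
  obtain ⟨w, Φ, D, h1, h2, _, h4⟩ := exists_tail_field hS (lt_add_of_pos_right e hδ)
    (fun x hx => hlt x (by linarith))
  exact ⟨w, Φ, D, h1, fun y hy f hf => (hmax f hf).trans_lt (h2 y hy),
    fun y hy' => h4 y (hy' e he)⟩

variable {M δ : ℝ} {E : Finset ℝ}

/-- A compactly supported field with time-one map `S` on `[-M, M]`, away from the fixed points. -/
theorem exists_lipschitz_field (hS : IsLipDiffeo S R S') (hE : ∀ y, S y = y ↔ y ∈ E)
    (hM0 : 0 ≤ M) (hM : ∀ y, M ≤ y → y < S y) (hM' : ∀ y ≤ -M, S y < y) (hδ : 0 < δ) :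
    ∃ w Φ D, IsFlowField w Φ D ∧ (∃ K, LipschitzWith K w) ∧
      (∀ y, M ≤ y → y ≤ Φ 1 y) ∧ (∀ y ≤ -M, Φ 1 y ≤ y) ∧
      ∀ y ∈ Icc (-M) M, (∀ e ∈ E, δ ≤ |y - e|) → Φ 1 y = S y := by
  classical
  have hne := exists_fixed hS hE hM0 hM hM'
  have hEM : ∀ e ∈ E, -M < e ∧ e < M := by
    intro e he
    have := (hE e).2 he
    constructor
    · by_contra! hc
      exact (hM' e hc).ne this
    · by_contra! hc
      exact (hM e hc).ne' this
  obtain ⟨w₁, Φ₁, D₁, a1, a2, ⟨B, a3⟩, a4, a5⟩ := exists_outer_cut_field hS hE hne hδ hM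
  obtain ⟨w₂, Φ₂, D₂, b1, b2, ⟨B', b3⟩, b4, b5⟩ := exists_outer_cut_field (M := M) hS.reflect
    (reflect_fixed hE) (hne.image _) hδ (fun y hy => by
      have := hM' (-y) (by linarith)
      linarith)
  obtain ⟨w, Φ, D, h1, h2, h3, h4, h5⟩ := exists_field_of_outer (s := Icc (-M) M) hS hE hne hδ
    a1 b1.reflect a2 (by
      intro y hy e he
      have := b2 (-y) (by simpa using hy) (-e) (Finset.mem_image_of_mem _ he)
      linarith) (fun y hy => a5 y hy.2) (by
      intro y hy hy'
      have := b5 (-y) (by linarith [hy.1]) (by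
        intro e he
        obtain ⟨f, hf, rfl⟩ := Finset.mem_image.1 he
        linarith [hy' f hf])
      simp only [this, neg_neg])
  refine ⟨w, Φ, D, h1, ?_, ?_, ?_, h5⟩
  · have hout : ∀ y, w y ≠ 0 → y < max B M ∧ min (-B') (-M) < y := by
      intro y hy
      rcases h2 y hy with h | h | h
      · obtain ⟨e, he⟩ := hne
        refine ⟨lt_max_of_lt_left (a3 y h), ?_⟩
        exact (min_le_right _ _).trans_lt ((hEM e he).1.trans (a2 y h e he))
      · obtain ⟨e, he⟩ := hne
        have e1 := b3 (-y) (by simpa using h)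
        have e2 := b2 (-y) (by simpa using h) (-e) (Finset.mem_image_of_mem _ he)
        refine ⟨lt_max_of_lt_right ?_, min_lt_of_left_lt (by linarith)⟩
        linarith [(hEM e he).2]
      · obtain ⟨⟨e, he, hey⟩, f, hf, hyf⟩ := h
        exact ⟨lt_max_of_lt_right (by linarith [(hEM f hf).2]),
          min_lt_of_right_lt (by linarith [(hEM e he).1])⟩
    refine LocallyLipschitz.exists_lipschitzWith h1.lip (a := min (-B') (-M)) (b := max B M) ?_ ?_ ?_
    · exact (min_le_right _ _).trans ((by linarith : -M ≤ M).trans (le_max_right _ _))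
    · intro x hx
      by_contra hc
      exact absurd (hout x hc).2 (not_lt.2 hx)
    · intro x hx
      by_contra hc
      exact absurd (hout x hc).1 (not_lt.2 hx)
  · intro y hy
    rw [h3 y fun e he => (hEM e he).2.trans_le hy]
    exact a4 y
  · intro y hy
    rw [h4 y fun e he => hy.trans_lt (hEM e he).1]
    have := b4 (-y)
    linarith

/-- A field with time-one map `S` away from the fixed points. -/
theorem exists_locallyLipschitz_field (hS : IsLipDiffeo S R S') (hE : ∀ y, S y = y ↔ y ∈ E)
    (hM0 : 0 ≤ M) (hM : ∀ y, M ≤ y → y < S y) (hM' : ∀ y ≤ -M, S y < y) (hδ : 0 < δ) :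
    ∃ w Φ D, IsFlowField w Φ D ∧ ∀ y, (∀ e ∈ E, δ ≤ |y - e|) → Φ 1 y = S y := by
  classical
  have hne := exists_fixed hS hE hM0 hM hM'
  obtain ⟨w₁, Φ₁, D₁, a1, a2, a5⟩ := exists_outer_tail_field hS hE hne hδ hM
  obtain ⟨w₂, Φ₂, D₂, b1, b2, b5⟩ := exists_outer_tail_field (M := M) hS.reflect
    (reflect_fixed hE) (hne.image _) hδ (fun y hy => by
      have := hM' (-y) (by linarith)
      linarith)
  obtain ⟨w, Φ, D, h1, -, -, -, h5⟩ := exists_field_of_outer (s := univ) hS hE hne hδ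
    a1 b1.reflect a2 (by
      intro y hy e he
      have := b2 (-y) (by simpa using hy) (-e) (Finset.mem_image_of_mem _ he)
      linarith) (fun y _ => a5 y) (by
      intro y hy hy'
      have := b5 (-y) (by
        intro e he
        obtain ⟨f, hf, rfl⟩ := Finset.mem_image.1 he
        linarith [hy' f hf])
      simp only [this, neg_neg])
  exact ⟨w, Φ, D, h1, fun y hy => h5 y (mem_univ y) hy⟩

end Fields

/-! ### Continuation of a polynomial to a diffeomorphism with controlled growth -/

section Extension

theorem hasDerivAt_glue {f g f' g' : ℝ → ℝ} {a : ℝ} (hf : ∀ x, HasDerivAt f (f' x) x)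
    (hg : ∀ x, HasDerivAt g (g' x) x) (h : f a = g a) (h' : f' a = g' a) (x : ℝ) :
    HasDerivAt (fun x => if x ≤ a then f x else g x) (if x ≤ a then f' x else g' x) x := by
  rcases lt_trichotomy x a with hx | rfl | hx
  · rw [if_pos hx.le]
    refine (hf x).congr_of_eventuallyEq ?_
    filter_upwards [isOpen_Iio.mem_nhds hx] with y hy
    rw [if_pos (le_of_lt hy)]
  · rw [if_pos le_rfl, ← hasDerivWithinAt_univ, ← Iic_union_Ici (a := x)]
    refine HasDerivWithinAt.union ?_ ?_
    · exact ((hf x).hasDerivWithinAt).congr (fun y hy => if_pos hy) (if_pos le_rfl)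
    · rw [h']
      refine ((hg x).hasDerivWithinAt).congr (fun y hy => ?_) (by rw [if_pos le_rfl, h])
      rcases (mem_Ici.1 hy).eq_or_lt with rfl | hy
      · rw [if_pos le_rfl, h]
      · rw [if_neg (not_le.2 hy)]
  · rw [if_neg (not_le.2 hx)]
    refine (hg x).congr_of_eventuallyEq ?_
    filter_upwards [isOpen_Ioi.mem_nhds hx] with y hy
    rw [if_neg (not_le.2 hy)]

/-- The average over the unit interval to the right. -/
noncomputable def unitAverage (f : ℝ → ℝ) (y : ℝ) : ℝ := ∫ x in y..y + 1, f x

theorem unitAverage_hasDerivAt {f : ℝ → ℝ} (hf : Continuous f) (y : ℝ) :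
    HasDerivAt (unitAverage f) (f (y + 1) - f y) y := by
  have h : ∀ x, HasDerivAt (fun x => ∫ t in (0 : ℝ)..x, f t) (f x) x := fun x =>
    intervalIntegral.integral_hasDerivAt_right (hf.intervalIntegrable _ _)
      (hf.stronglyMeasurableAtFilter _ _) hf.continuousAt
  have e : unitAverage f = fun y => (∫ t in (0 : ℝ)..(y + 1), f t) - ∫ t in (0 : ℝ)..y, f t := by
    funext y
    rw [intervalIntegral.integral_interval_sub_left (hf.intervalIntegrable _ _)
      (hf.intervalIntegrable _ _)]
    rfl
  rw [e]
  exact ((h (y + 1)).comp_add_const y 1).fun_sub (h y)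

/-- Averaging to the right regularizes a monotone function without losing monotonicity or going
below it. -/
theorem Monotone.unitAverage_spec {f : ℝ → ℝ} (hf : Monotone f) :
    Continuous (unitAverage f) ∧ Monotone (unitAverage f) ∧ ∀ y, f y ≤ unitAverage f y := by
  have hi : ∀ a b, IntervalIntegrable f volume a b := fun a b => hf.intervalIntegrable
  refine ⟨?_, ?_, ?_⟩
  · have h := intervalIntegral.continuous_primitive hi 0
    have e : unitAverage f = fun y => (∫ t in (0 : ℝ)..(y + 1), f t) - ∫ t in (0 : ℝ)..y, f t := by
      funext y
      rw [intervalIntegral.integral_interval_sub_left (hi _ _) (hi _ _)]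
      rfl
    rw [e]
    exact (h.comp (continuous_add_const 1)).sub h
  · intro x y hxy
    have e : ∀ y, unitAverage f y = ∫ t in (0 : ℝ)..1, f (t + y) := by
      intro y
      rw [intervalIntegral.integral_comp_add_right]
      simp [unitAverage, add_comm]
    rw [e, e]
    have hsh : ∀ c, IntervalIntegrable (fun t => f (t + c)) volume 0 1 := fun c =>
      Monotone.intervalIntegrable fun a b hab => hf (by linarith)
    exact intervalIntegral.integral_mono_on zero_le_one (hsh x) (hsh y)
      fun t _ => hf (by linarith)
  · intro y
    have : ∫ _ in y..y + 1, f y ≤ ∫ t in y..y + 1, f t :=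
      intervalIntegral.integral_mono_on (by linarith) (by simp) (hi _ _) fun t ht => hf ht.1
    simpa [unitAverage] using this

/-- A regular monotone majorant. -/
theorem exists_regular_majorant {σ : ℝ → ℝ} (hσ : Monotone σ) :
    ∃ Ω Ω' : ℝ → ℝ, (∀ y, HasDerivAt Ω (Ω' y) y) ∧ LocallyLipschitz Ω' ∧ (∀ y, 0 ≤ Ω' y) ∧
      (∀ y, 0 ≤ Ω y) ∧ ∀ y, σ y ≤ Ω y := by
  -- Three averages are taken: the first is continuous, the second C¹, and the third has a C¹, hence
  -- locally Lipschitz, derivative.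
  have h0 : Monotone fun y => max (σ y) 0 := hσ.max monotone_const
  obtain ⟨c1, m1, l1⟩ := Monotone.unitAverage_spec h0
  obtain ⟨c2, m2, l2⟩ := Monotone.unitAverage_spec m1
  obtain ⟨c3, m3, l3⟩ := Monotone.unitAverage_spec m2
  have hl : ∀ y, max (σ y) 0 ≤ unitAverage (unitAverage (unitAverage fun y => max (σ y) 0)) y :=
    fun y => (l1 y).trans ((l2 y).trans (l3 y))
  have hd := unitAverage_hasDerivAt c1
  have hC : ContDiff ℝ 1 (unitAverage (unitAverage fun y => max (σ y) 0)) := by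
    rw [contDiff_one_iff_deriv]
    refine ⟨fun y => (hd y).differentiableAt, ?_⟩
    rw [funext fun y => (hd y).deriv]
    exact (c1.comp (continuous_add_const 1)).sub c1
  refine ⟨_, _, unitAverage_hasDerivAt c2, ?_, fun y => sub_nonneg.2 (m2 (by linarith)),
    fun y => (le_max_right _ _).trans (hl y), fun y => (le_max_left _ _).trans (hl y)⟩
  refine ContDiff.locallyLipschitz (𝕂 := ℝ) ?_
  fun_prop

/-- Continuation of a function to the right of `c`, with prescribed value and slope at `c`, finitely
many fixed points, and fast growth. -/
theorem exists_right_extension (c a m : ℝ) (hm : 0 < m) {σ : ℝ → ℝ} (hσ : Monotone σ) :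
    ∃ F F' : ℝ → ℝ, (∀ y, HasDerivAt F (F' y) y) ∧ LocallyLipschitz F' ∧ F c = a ∧ F' c = m ∧
      (∀ y, c ≤ y → 0 < F' y) ∧ (∀ y, c + 1 ≤ y → y < F y) ∧ {y | c ≤ y ∧ F y = y}.Finite ∧
      ∀ y, c + 2 ≤ y → 0 ≤ y → σ y ≤ F y := by
  obtain ⟨Ω, Ω', hΩ, hΩl, hΩ'0, hΩ0, hσΩ⟩ := exists_regular_majorant hσ
  -- With `t = y - c ≥ 1` and `a - c ≥ -(k - 2)`, the quadratic exceeds `y` by at least `(k - 2) *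
  -- (t ^ 2 - 1) + 2 * t ^ 2 - t + m * t > 0`. All fixed points therefore lie in `[c, c + 1]`, where
  -- `F` is a polynomial; the growth term starts only at `c + 1`, with a double zero to keep the
  -- gluing C¹.
  obtain ⟨k, hk⟩ : ∃ k, k = |a - c| + 2 := ⟨_, rfl⟩
  have hk2 : 2 ≤ k := by linarith [abs_nonneg (a - c)]
  have hka : -(k - 2) ≤ a - c := by linarith [neg_abs_le (a - c)]
  have hq : ∀ y, HasDerivAt (fun y => a + m * (y - c) + k * (y - c) ^ 2) (m + 2 * k * (y - c)) y := by
    intro y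
    have h1 : HasDerivAt (fun y : ℝ => y - c) 1 y := (hasDerivAt_id y).sub_const c
    refine (((h1.const_mul m).const_add a).fun_add ((h1.fun_pow 2).const_mul k)).congr_deriv ?_
    norm_num
    ring
  have hb : ∀ y, HasDerivAt (fun y => (y - (c + 1)) ^ 2 * Ω y)
      (2 * (y - (c + 1)) * Ω y + (y - (c + 1)) ^ 2 * Ω' y) y := by
    intro y
    have h1 : HasDerivAt (fun y : ℝ => y - (c + 1)) 1 y := (hasDerivAt_id y).sub_const _
    refine ((h1.fun_pow 2).fun_mul (hΩ y)).congr_deriv ?_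
    norm_num
  have hqpos : ∀ y, c + 1 ≤ y → y < a + m * (y - c) + k * (y - c) ^ 2 := by
    intro y hy
    have ht : 1 ≤ y - c := by linarith
    have h2 : 1 ≤ (y - c) ^ 2 := one_le_pow₀ ht
    have h3 : 0 ≤ (k - 2) * ((y - c) ^ 2 - 1) := mul_nonneg (by linarith) (by linarith)
    nlinarith [mul_pos hm (by linarith : 0 < y - c), mul_nonneg (sub_nonneg.2 ht) (sub_nonneg.2 ht)]
  have hΩlip : LocallyLipschitz Ω := by
    refine ContDiff.locallyLipschitz (𝕂 := ℝ) (contDiff_one_iff_deriv.2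
      ⟨fun y => (hΩ y).differentiableAt, ?_⟩)
    rw [funext fun y => (hΩ y).deriv]
    exact hΩl.continuous
  have hge : ∀ y, c + 1 ≤ y → (if y ≤ c + 1 then a + m * (y - c) + k * (y - c) ^ 2
      else a + m * (y - c) + k * (y - c) ^ 2 + (y - (c + 1)) ^ 2 * Ω y) =
        a + m * (y - c) + k * (y - c) ^ 2 + (y - (c + 1)) ^ 2 * Ω y := by
    intro y hy
    split_ifs with h
    · rw [le_antisymm h hy]
      ring
    · rfl
  refine ⟨fun y => if y ≤ c + 1 then a + m * (y - c) + k * (y - c) ^ 2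
      else a + m * (y - c) + k * (y - c) ^ 2 + (y - (c + 1)) ^ 2 * Ω y,
    fun y => if y ≤ c + 1 then m + 2 * k * (y - c)
      else m + 2 * k * (y - c) + (2 * (y - (c + 1)) * Ω y + (y - (c + 1)) ^ 2 * Ω' y),
    ?_, ?_, ?_, ?_, ?_, ?_, ?_, ?_⟩
  · exact hasDerivAt_glue hq (fun y => (hq y).fun_add (hb y)) (by simp) (by simp)
  · have l1 : LocallyLipschitz (fun y => m + 2 * k * (y - c)) := by
      refine ContDiff.locallyLipschitz (𝕂 := ℝ) ?_
      fun_prop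
    have l2 : LocallyLipschitz (fun y => 2 * (y - (c + 1))) := by
      refine ContDiff.locallyLipschitz (𝕂 := ℝ) ?_
      fun_prop
    have l3 : LocallyLipschitz (fun y => (y - (c + 1)) ^ 2) := by
      refine ContDiff.locallyLipschitz (𝕂 := ℝ) ?_
      fun_prop
    exact LocallyLipschitz.glue l1 (l1.add ((LocallyLipschitz.real_mul l2 hΩlip).add
      (LocallyLipschitz.real_mul l3 hΩl))) (by simp)
  · simp
  · simp
  · intro y hy
    have h1 : 0 < m + 2 * k * (y - c) := by
      have : 0 ≤ 2 * k * (y - c) := mul_nonneg (by linarith) (by linarith)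
      linarith
    simp only
    split_ifs with h
    · exact h1
    · have h2 : 0 ≤ 2 * (y - (c + 1)) * Ω y :=
        mul_nonneg (by linarith [not_le.1 h]) (hΩ0 y)
      have h3 : 0 ≤ (y - (c + 1)) ^ 2 * Ω' y := mul_nonneg (sq_nonneg _) (hΩ'0 y)
      linarith
  · intro y hy
    simp only
    rw [hge y hy]
    have := mul_nonneg (sq_nonneg (y - (c + 1))) (hΩ0 y)
    linarith [hqpos y hy]
  · obtain ⟨p, hp⟩ : ∃ p : Polynomial ℝ, p = Polynomial.C a +
        Polynomial.C m * (Polynomial.X - Polynomial.C c) +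
        Polynomial.C k * (Polynomial.X - Polynomial.C c) ^ 2 - Polynomial.X := ⟨_, rfl⟩
    have hpe : ∀ y, p.eval y = a + m * (y - c) + k * (y - c) ^ 2 - y := by
      intro y
      simp [hp]
    have hp0 : p ≠ 0 := by
      rintro rfl
      have := hpe (c + 1)
      simp only [Polynomial.eval_zero] at this
      linarith [hqpos (c + 1) le_rfl]
    refine (Polynomial.finite_setOfPred_isRoot hp0).subset ?_
    rintro y ⟨hy, hFy⟩
    by_cases h : y ≤ c + 1
    · simp only [if_pos h] at hFy
      simp only [mem_ofPred_eq, Polynomial.IsRoot, hpe]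
      linarith
    · simp only [if_neg h] at hFy
      have := mul_nonneg (sq_nonneg (y - (c + 1))) (hΩ0 y)
      linarith [hqpos y (not_le.1 h).le]
  · intro y hy hy0
    simp only
    rw [hge y (by linarith)]
    have h1 : 1 ≤ (y - (c + 1)) ^ 2 := by nlinarith
    have h2 : Ω y ≤ (y - (c + 1)) ^ 2 * Ω y := le_mul_of_one_le_left (hΩ0 y) h1
    linarith [hqpos y (by linarith), hσΩ y]

/-- The inequalities at both ends bound `S` below and above by the identity there, which gives
surjectivity. -/
theorem exists_isLipDiffeo {S S' : ℝ → ℝ} (hS : ∀ x, HasDerivAt S (S' x) x)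
    (hl : LocallyLipschitz S') (hpos : ∀ x, 0 < S' x) {M : ℝ} (hM : ∀ y, M ≤ y → y < S y)
    (hM' : ∀ y ≤ -M, S y < y) : ∃ R, IsLipDiffeo S R S' := by
  have hm : StrictMono S := strictMono_of_hasDerivAt_pos hS hpos
  have hc : Continuous S := continuous_iff_continuousAt.2 fun x => (hS x).continuousAt
  have hsurj : Function.Surjective S := by
    intro t
    have h1 : t ≤ S (max t M) := (le_max_left t M).trans (hM _ (le_max_right t M)).le
    have h2 : S (min t (-M)) ≤ t := (hM' _ (min_le_right t (-M))).le.trans (min_le_left t (-M))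
    exact mem_range_of_exists_le_of_exists_ge hc ⟨_, h2⟩ ⟨_, h1⟩
  exact ⟨Function.surjInv hsurj, hS, hl, hpos,
    fun x => hm.injective (Function.surjInv_eq hsurj (S x)), Function.surjInv_eq hsurj⟩

/-- Continuation of an increasing polynomial to a diffeomorphism of the line. -/
theorem exists_diffeo_extension (P : Polynomial ℝ) (hP : P ≠ Polynomial.X) {c₁ c₂ : ℝ}
    (hc : c₁ < c₂) (hpos : ∀ y ∈ Icc c₁ c₂, 0 < P.derivative.eval y) {σ : ℝ → ℝ}
    (hσ : Monotone σ) {N : ℝ} (h₁ : -N ≤ c₁) (h₂ : c₂ ≤ N) :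
    ∃ S R S', IsLipDiffeo S R S' ∧ {y | S y = y}.Finite ∧ (∀ y, N + 1 ≤ y → y < S y) ∧
      (∀ y, y ≤ -(N + 1) → S y < y) ∧ (∀ y, N + 2 ≤ y → σ y ≤ S y) ∧
      (∀ y, y ≤ -(N + 2) → S y ≤ -σ (-y)) ∧
      ∀ y ∈ Icc c₁ c₂, S y = P.eval y ∧ S' y = P.derivative.eval y := by
  obtain ⟨F, F', f1, f2, f3, f4, f5, f6, f7, f8⟩ := exists_right_extension c₂ (P.eval c₂)
    (P.derivative.eval c₂) (hpos c₂ (right_mem_Icc.2 hc.le)) hσ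
  -- The left continuation is the point reflection of a right continuation; the slope is unchanged
  -- by it.
  obtain ⟨G, G', g1, g2, g3, g4, g5, g6, g7, g8⟩ := exists_right_extension (-c₁) (-P.eval c₁)
    (P.derivative.eval c₁) (hpos c₁ (left_mem_Icc.2 hc.le)) hσ
  have hN : 0 ≤ N := by linarith
  have hPl : LocallyLipschitz (fun y => P.derivative.eval y) := by
    refine ContDiff.locallyLipschitz (𝕂 := ℝ) ?_
    simpa using P.derivative.contDiff_aeval (𝕜 := ℝ) 1
  have hG : ∀ y, HasDerivAt (fun y => -G (-y)) (G' (-y)) y := by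
    intro y
    simpa using ((g1 (-y)).comp y (hasDerivAt_neg y)).fun_neg
  have hin := hasDerivAt_glue (a := c₂) (fun y => P.hasDerivAt y) f1 f3.symm f4.symm
  have hinl : LocallyLipschitz
      (fun y => if y ≤ c₂ then P.derivative.eval y else F' y) :=
    LocallyLipschitz.glue hPl f2 f4.symm
  have hd := hasDerivAt_glue (a := c₁) hG hin (by simp [hc.le, g3]) (by simp [hc.le, g4])
  have hl : LocallyLipschitz (fun y => if y ≤ c₁ then G' (-y) else
      if y ≤ c₂ then P.derivative.eval y else F' y) :=
    LocallyLipschitz.glue (g2.comp LocallyLipschitz.id.neg) hinl (by simp [hc.le, g4])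
  obtain ⟨S, hS⟩ : ∃ S : ℝ → ℝ, S = fun y => if y ≤ c₁ then -G (-y) else
      if y ≤ c₂ then P.eval y else F y := ⟨_, rfl⟩
  obtain ⟨S', hS'⟩ : ∃ S' : ℝ → ℝ, S' = fun y => if y ≤ c₁ then G' (-y) else
      if y ≤ c₂ then P.derivative.eval y else F' y := ⟨_, rfl⟩
  rw [← hS'] at hl
  have hd' : ∀ y, HasDerivAt S (S' y) y := by
    rw [hS, hS']
    exact hd
  have hleft : ∀ y ≤ c₁, S y = -G (-y) ∧ S' y = G' (-y) := fun y hy => by simp [hS, hS', hy]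
  have hmid : ∀ y ∈ Icc c₁ c₂, S y = P.eval y ∧ S' y = P.derivative.eval y := by
    intro y hy
    rcases hy.1.eq_or_lt with rfl | h
    · rw [(hleft _ le_rfl).1, (hleft _ le_rfl).2, g3, g4, neg_neg]
      exact ⟨rfl, rfl⟩
    · simp [hS, hS', not_le.2 h, hy.2]
  have hright : ∀ y, c₂ ≤ y → S y = F y ∧ S' y = F' y := by
    intro y hy
    rcases hy.eq_or_lt with rfl | h
    · rw [(hmid _ (right_mem_Icc.2 hc.le)).1, (hmid _ (right_mem_Icc.2 hc.le)).2, f3, f4]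
      exact ⟨rfl, rfl⟩
    · simp [hS, hS', not_le.2 h, not_le.2 (hc.trans h)]
  have hSpos : ∀ y, 0 < S' y := by
    intro y
    rcases le_total y c₁ with h | h
    · rw [(hleft y h).2]
      exact g5 _ (by linarith)
    · rcases le_total y c₂ with h' | h'
      · rw [(hmid y ⟨h, h'⟩).2]
        exact hpos y ⟨h, h'⟩
      · rw [(hright y h').2]
        exact f5 y h'
  have hM : ∀ y, N + 1 ≤ y → y < S y := by
    intro y hy
    rw [(hright y (by linarith)).1]
    exact f6 y (by linarith)
  have hM' : ∀ y ≤ -(N + 1), S y < y := by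
    intro y hy
    rw [(hleft y (by linarith)).1]
    have := g6 (-y) (by linarith)
    linarith
  obtain ⟨R, hR⟩ := exists_isLipDiffeo hd' hl hSpos hM hM'
  refine ⟨S, R, S', hR, ?_, hM, hM', ?_, ?_, hmid⟩
  · have hPX : P - Polynomial.X ≠ 0 := sub_ne_zero.2 hP
    refine (((Polynomial.finite_setOfPred_isRoot hPX).union f7).union (g7.image fun y => -y)).subset ?_
    intro y hy
    have hy' : S y = y := hy
    rcases le_total y c₁ with h | h
    · rw [(hleft y h).1] at hy'
      exact Or.inr ⟨-y, ⟨by linarith, by linarith⟩, neg_neg y⟩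
    · rcases le_total y c₂ with h' | h'
      · rw [(hmid y ⟨h, h'⟩).1] at hy'
        exact Or.inl (Or.inl (by simp [hy']))
      · rw [(hright y h').1] at hy'
        exact Or.inl (Or.inr ⟨h', hy'⟩)
  · intro y hy
    rw [(hright y (by linarith)).1]
    exact f8 y (by linarith) (by linarith)
  · intro y hy
    rw [(hleft y (by linarith)).1]
    have := g8 (-y) (by linarith) (by linarith)
    linarith

end Extension

/-! ### The monotone rearrangement and its polynomial approximation -/

section Target

variable {μ : Measure ℝ} {f : ℝ → ℝ}

theorem IsAdmissible.absolutelyContinuous (h : IsAdmissible μ f) : μ ≪ volume := by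
  rw [h.eq_withDensity]
  exact withDensity_absolutelyContinuous _ _

theorem IsAdmissible.nullSingletonClass (h : IsAdmissible μ f) : NullSingletonClass μ :=
  ⟨fun _ => h.absolutelyContinuous Real.volume_singleton⟩

theorem IsAdmissible.nonneg (h : IsAdmissible μ f) (x : ℝ) : 0 ≤ f x := by
  by_cases hx : x ∈ μ.support
  · exact (h.pos_on_support x hx).le
  · rw [h.eq_zero_off_support x hx]

theorem IsAdmissible.measure_compl_interior (h : IsAdmissible μ f) :
    μ (interior μ.support)ᶜ = 0 := by
  have h1 : μ (frontier μ.support) = 0 :=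
    h.absolutelyContinuous (h.convex_support.addHaar_frontier volume)
  refine measure_mono_null ?_ (measure_union_null h1 (Measure.measure_compl_support (μ := μ)))
  intro x hx
  by_cases hs : x ∈ μ.support
  · exact Or.inl ⟨subset_closure hs, hx⟩
  · exact Or.inr hs

theorem IsAdmissible.measure_interior (h : IsAdmissible μ f) : μ (interior μ.support) = 1 := by
  have := h.isProbabilityMeasure
  rw [← prob_compl_eq_zero_iff isOpen_interior.measurableSet]
  exact h.measure_compl_interior

theorem IsAdmissible.ordConnected_interior (h : IsAdmissible μ f) :
    OrdConnected (interior μ.support) :=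
  convex_iff_ordConnected.1 h.convex_support.interior

theorem IsAdmissible.integrable (h : IsAdmissible μ f) : Integrable f := by
  refine ⟨h.measurable.aestronglyMeasurable, ?_⟩
  rw [hasFiniteIntegral_iff_ofReal (Eventually.of_forall h.nonneg)]
  have := h.isProbabilityMeasure
  have h1 : μ univ = 1 := measure_univ
  rw [h.eq_withDensity, withDensity_apply _ MeasurableSet.univ, Measure.restrict_univ] at h1
  rw [h1]
  exact ENNReal.one_lt_top

theorem IsAdmissible.cdf_eq (h : IsAdmissible μ f) (x : ℝ) :
    ProbabilityTheory.cdf μ x = ∫ t in Iic x, f t := by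
  have := h.isProbabilityMeasure
  rw [ProbabilityTheory.cdf_eq_real, Measure.real]
  conv_lhs => rw [h.eq_withDensity]
  rw [withDensity_apply _ measurableSet_Iic,
    integral_eq_lintegral_of_nonneg_ae (Eventually.of_forall h.nonneg)
      h.measurable.aestronglyMeasurable]

theorem IsAdmissible.cdf_eq_add (h : IsAdmissible μ f) (a x : ℝ) :
    ProbabilityTheory.cdf μ x = ProbabilityTheory.cdf μ a + ∫ t in a..x, f t := by
  rw [h.cdf_eq, h.cdf_eq, ← intervalIntegral.integral_Iic_sub_Iic h.integrable.integrableOn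
    h.integrable.integrableOn]
  ring

theorem IsAdmissible.hasDerivAt_cdf (h : IsAdmissible μ f) :
    ∀ x ∈ interior μ.support, HasDerivAt (ProbabilityTheory.cdf μ) (f x) x := by
  intro x hx
  have hc : ContinuousAt f x := h.continuousOn.continuousAt (mem_interior_iff_mem_nhds.1 hx)
  have hd := (intervalIntegral.integral_hasDerivAt_right (h.integrable.intervalIntegrable (a := x)
    (b := x)) h.measurable.stronglyMeasurable.stronglyMeasurableAtFilter hc).const_add
    (ProbabilityTheory.cdf μ x)
  exact hd.congr_of_eventuallyEq (Eventually.of_forall fun y => h.cdf_eq_add x y)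

/-- Strict monotonicity on the open interval excludes the values `0` and `1`. Conversely, a value in
between is attained somewhere, and at a point off the interior all the mass would lie on one side.
-/
theorem IsAdmissible.image_cdf (h : IsAdmissible μ f) :
    ProbabilityTheory.cdf μ '' interior μ.support = Ioo 0 1 := by
  have := h.isProbabilityMeasure
  have hoc := h.ordConnected_interior
  have hmono := (exists_inverse_of_hasDerivAt isOpen_interior h.hasDerivAt_cdf
    fun x hx => h.pos_on_support x (interior_subset hx)).1
  apply Subset.antisymm
  · rintro _ ⟨x, hx, rfl⟩
    obtain ⟨a, b, hxab, hab⟩ := mem_nhds_iff_exists_Ioo_subset.1 (isOpen_interior.mem_nhds hx)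
    obtain ⟨a', ha1, ha2⟩ := exists_between hxab.1
    obtain ⟨b', hb1, hb2⟩ := exists_between hxab.2
    exact ⟨(ProbabilityTheory.cdf_nonneg μ a').trans_lt
        (hmono (hab ⟨ha1, ha2.trans hxab.2⟩) hx ha2),
      (hmono hx (hab ⟨hxab.1.trans hb1, hb2⟩) hb1).trans_le (ProbabilityTheory.cdf_le_one μ b')⟩
  · intro t ht
    have hcont : Continuous (ProbabilityTheory.cdf μ) := by
      have e : (ProbabilityTheory.cdf μ : ℝ → ℝ) = fun x =>
          ProbabilityTheory.cdf μ 0 + ∫ t in (0 : ℝ)..x, f t := funext (h.cdf_eq_add 0)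
      rw [e]
      exact (intervalIntegral.continuous_primitive
        (fun a b => h.integrable.intervalIntegrable) 0).const_add _
    obtain ⟨a, ha⟩ := ((ProbabilityTheory.tendsto_cdf_atBot μ).eventually_le_const ht.1).exists
    obtain ⟨b, hb⟩ := ((ProbabilityTheory.tendsto_cdf_atTop μ).eventually_const_le ht.2).exists
    obtain ⟨x, hx⟩ := mem_range_of_exists_le_of_exists_ge hcont ⟨a, ha⟩ ⟨b, hb⟩
    refine ⟨x, ?_, hx⟩
    by_contra hxU
    have hside : interior μ.support ⊆ Iic x ∨ interior μ.support ⊆ (Iic x)ᶜ := by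
      by_contra! hcon
      obtain ⟨h1, h2⟩ := hcon
      obtain ⟨y, hy, hyx⟩ := not_subset.1 h1
      obtain ⟨z, hz, hzx⟩ := not_subset.1 h2
      exact hxU (hoc.out hz hy ⟨not_not.1 hzx, (not_le.1 hyx).le⟩)
    rw [ProbabilityTheory.cdf_eq_real, Measure.real] at hx
    rcases hside with hs | hs
    · have h1 : μ (Iic x) = 1 :=
        le_antisymm prob_le_one (h.measure_interior ▸ measure_mono hs)
      rw [h1] at hx
      exact ht.2.ne (by simpa using hx.symm)
    · have h1 : μ (Iic x) = 0 :=
        measure_mono_null (subset_compl_comm.1 hs) h.measure_compl_interior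
      rw [h1] at hx
      exact ht.1.ne (by simpa using hx)

/-- The monotone rearrangement between the interiors of the supports. -/
theorem exists_rearrangement {μ₀ μ₁ : Measure ℝ} {f₀ f₁ : ℝ → ℝ} (h₀ : IsAdmissible μ₀ f₀)
    (h₁ : IsAdmissible μ₁ f₁) :
    ∃ S : ℝ → ℝ, ∀ y ∈ interior μ₁.support, S y ∈ interior μ₀.support ∧
      HasDerivAt S (f₁ y / f₀ (S y)) y := by
  have hoc := h₀.ordConnected_interior
  obtain ⟨-, H, -, hH⟩ := exists_inverse_of_hasDerivAt isOpen_interior h₀.hasDerivAt_cdf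
    fun x hx => h₀.pos_on_support x (interior_subset hx)
  rw [h₀.image_cdf, ← h₁.image_cdf] at hH
  refine ⟨fun y => H (ProbabilityTheory.cdf μ₁ y), fun y hy => ?_⟩
  obtain ⟨a1, -, a3⟩ := hH _ (mem_image_of_mem _ hy)
  refine ⟨a1, (a3.comp y (h₁.hasDerivAt_cdf y hy)).congr_deriv ?_⟩
  rw [div_eq_inv_mul]

theorem exists_polynomial_derivative_eq (q : Polynomial ℝ) :
    ∃ P : Polynomial ℝ, P.derivative = q := by
  induction q using Polynomial.induction_on' with
  | add p q hp hq =>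
    obtain ⟨P, rfl⟩ := hp
    obtain ⟨Q, rfl⟩ := hq
    exact ⟨P + Q, by simp⟩
  | monomial n a =>
    refine ⟨Polynomial.monomial (n + 1) (a / (n + 1)), ?_⟩
    rw [Polynomial.derivative_monomial]
    have : (n + 1 : ℝ) ≠ 0 := by positivity
    simp [this]

/-- A polynomial other than the identity which is close, with its derivative, to a given
continuously differentiable function. -/
theorem exists_polynomial_near_deriv {S s' : ℝ → ℝ} {c₁ c₂ θ : ℝ} (hc : c₁ < c₂) (hθ : 0 < θ)
    (hS : ∀ y ∈ Icc c₁ c₂, HasDerivAt S (s' y) y) (hs' : ContinuousOn s' (Icc c₁ c₂)) :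
    ∃ P : Polynomial ℝ, P ≠ Polynomial.X ∧ ∀ y ∈ Icc c₁ c₂,
      |P.derivative.eval y - s' y| ≤ θ ∧ |P.eval y - S y| ≤ θ * (c₂ - c₁ + 1) := by
  obtain ⟨q, hq⟩ := exists_polynomial_near_of_continuousOn c₁ c₂ s' hs' θ hθ
  obtain ⟨A, rfl⟩ := exists_polynomial_derivative_eq q
  have key : ∀ κ : ℝ, |κ| ≤ θ → ∀ y ∈ Icc c₁ c₂,
      |(A + Polynomial.C (S c₁ - A.eval c₁ + κ)).derivative.eval y - s' y| ≤ θ ∧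
      |(A + Polynomial.C (S c₁ - A.eval c₁ + κ)).eval y - S y| ≤ θ * (c₂ - c₁ + 1) := by
    intro κ hκ y hy
    refine ⟨by simpa using (hq y hy).le, ?_⟩
    have hmv := Convex.norm_image_sub_le_of_norm_hasDerivWithin_le (C := θ)
      (f := fun y => A.eval y - S y) (s := Icc c₁ c₂) (x := c₁) (y := y)
      (fun x hx => ((A.hasDerivAt x).fun_sub (hS x hx)).hasDerivWithinAt)
      (fun x hx => (hq x hx).le) (convex_Icc _ _) (left_mem_Icc.2 hc.le) hy
    rw [Real.norm_eq_abs, Real.norm_eq_abs, abs_of_nonneg (sub_nonneg.2 hy.1)] at hmv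
    have e : (A + Polynomial.C (S c₁ - A.eval c₁ + κ)).eval y - S y =
        (A.eval y - S y - (A.eval c₁ - S c₁)) + κ := by
      simp
      ring
    rw [e]
    have h1 : θ * (y - c₁) ≤ θ * (c₂ - c₁) := mul_le_mul_of_nonneg_left (by linarith [hy.2]) hθ.le
    linarith [abs_add_le (A.eval y - S y - (A.eval c₁ - S c₁)) κ]
  -- The identity must be avoided, since only `P ≠ X` yields finitely many fixed points. A shift by
  -- `θ` costs no more than the error already allowed, which is the extra `+ 1` in the bound.
  by_cases hX : A + Polynomial.C (S c₁ - A.eval c₁ + 0) = Polynomial.X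
  · refine ⟨A + Polynomial.C (S c₁ - A.eval c₁ + θ), fun hX' => ?_, key θ (abs_of_pos hθ).le⟩
    have h1 := congrArg (Polynomial.eval 0) (hX.trans hX'.symm)
    simp at h1
    exact hθ.ne' h1
  · exact ⟨_, hX, key 0 (by simpa using hθ.le)⟩

/-- Approximation of the density `f₁` by the pull-back of `f₀` under a polynomial. -/
theorem exists_polynomial_pullback_near {μ₀ μ₁ : Measure ℝ} {f₀ f₁ : ℝ → ℝ}
    (h₀ : IsAdmissible μ₀ f₀) (h₁ : IsAdmissible μ₁ f₁) {c₁ c₂ η : ℝ} (hc : c₁ < c₂)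
    (hsub : Icc c₁ c₂ ⊆ interior μ₁.support) (hη : 0 < η) :
    ∃ P : Polynomial ℝ, P ≠ Polynomial.X ∧ ∀ y ∈ Icc c₁ c₂, 0 < P.derivative.eval y ∧
      |f₁ y - f₀ (P.eval y) * P.derivative.eval y| ≤ η := by
  obtain ⟨S, hS⟩ := exists_rearrangement h₀ h₁
  have hSc : ContinuousOn S (Icc c₁ c₂) := fun y hy =>
    (hS y (hsub hy)).2.continuousAt.continuousWithinAt
  have hf₀S : ∀ y ∈ Icc c₁ c₂, 0 < f₀ (S y) := fun y hy =>
    h₀.pos_on_support _ (interior_subset (hS y (hsub hy)).1)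
  have hs'c : ContinuousOn (fun y => f₁ y / f₀ (S y)) (Icc c₁ c₂) := by
    refine (h₁.continuousOn.mono (hsub.trans interior_subset)).div ?_ fun y hy => (hf₀S y hy).ne'
    exact h₀.continuousOn.comp hSc fun y hy => interior_subset (hS y (hsub hy)).1
  have hs'pos : ∀ y ∈ Icc c₁ c₂, 0 < f₁ y / f₀ (S y) := fun y hy =>
    div_pos (h₁.pos_on_support y (interior_subset (hsub hy))) (hf₀S y hy)
  obtain ⟨y₀, hy₀, hmin⟩ := isCompact_Icc.exists_isMinOn (nonempty_Icc.2 hc.le) hs'c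
  obtain ⟨Q, hQ⟩ := isCompact_Icc.exists_bound_of_continuousOn hs'c
  have hK : IsCompact (S '' Icc c₁ c₂) := isCompact_Icc.image_of_continuousOn hSc
  -- Values of the polynomial must stay where `f₀` is continuous, so a compact neighbourhood of the
  -- image of `S` inside the interior of the support is fixed first.
  obtain ⟨r, hr, hrU⟩ := hK.exists_cthickening_subset_open (isOpen_interior (s := μ₀.support)) (by
    rintro _ ⟨y, hy, rfl⟩
    exact (hS y (hsub hy)).1)
  have hK' : IsCompact (Metric.cthickening r (S '' Icc c₁ c₂)) := hK.cthickening
  have hf₀c : ContinuousOn f₀ (Metric.cthickening r (S '' Icc c₁ c₂)) :=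
    h₀.continuousOn.mono (hrU.trans interior_subset)
  obtain ⟨B, hB⟩ := hK'.exists_bound_of_continuousOn hf₀c
  have hQ0 : 0 ≤ Q := (norm_nonneg _).trans (hQ y₀ hy₀)
  have hmemS : ∀ y ∈ Icc c₁ c₂, S y ∈ Metric.cthickening r (S '' Icc c₁ c₂) := fun y hy =>
    Metric.self_subset_cthickening _ (mem_image_of_mem _ hy)
  have hB0 : 0 ≤ B := (norm_nonneg _).trans (hB _ (hmemS y₀ hy₀))
  obtain ⟨ρ, hρ, huc⟩ := Metric.uniformContinuousOn_iff.1
    (hK'.uniformContinuousOn_of_continuous hf₀c) (η / (2 * (Q + 1))) (by positivity)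
  obtain ⟨L, hL⟩ : ∃ L, L = c₂ - c₁ + 1 := ⟨_, rfl⟩
  have hLpos : 0 < L := by linarith
  have hm := hs'pos y₀ hy₀
  -- The four bounds give, in order: positivity of the derivative of `P`, half of the error through
  -- the derivative, the other half through the uniform continuity of `f₀`, and values inside the
  -- thickening.
  obtain ⟨θ, hθ, hθle⟩ : ∃ θ > 0, θ ≤ f₁ y₀ / f₀ (S y₀) / 2 ∧ θ ≤ η / (2 * (B + 1)) ∧
      θ ≤ ρ / (2 * L) ∧ θ ≤ r / L := by
    refine ⟨min (min (f₁ y₀ / f₀ (S y₀) / 2) (η / (2 * (B + 1)))) (min (ρ / (2 * L)) (r / L)),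
      by positivity, ?_, ?_, ?_, ?_⟩
    · exact (min_le_left _ _).trans (min_le_left _ _)
    · exact (min_le_left _ _).trans (min_le_right _ _)
    · exact (min_le_right _ _).trans (min_le_left _ _)
    · exact (min_le_right _ _).trans (min_le_right _ _)
  obtain ⟨t1, t2, t3, t4⟩ := hθle
  obtain ⟨P, hPX, hP⟩ := exists_polynomial_near_deriv hc hθ (fun y hy => (hS y (hsub hy)).2) hs'c
  refine ⟨P, hPX, fun y hy => ?_⟩
  obtain ⟨p1, p2⟩ := hP y hy
  rw [← hL] at p2
  have hmy : f₁ y₀ / f₀ (S y₀) ≤ f₁ y / f₀ (S y) := hmin hy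
  refine ⟨by linarith [(abs_le.1 p1).1], ?_⟩
  have hd1 : dist (P.eval y) (S y) ≤ r := by
    rw [Real.dist_eq]
    exact p2.trans ((le_div_iff₀ hLpos).1 t4)
  have hd2 : dist (P.eval y) (S y) < ρ := by
    rw [Real.dist_eq]
    have := (le_div_iff₀ (by positivity)).1 t3
    nlinarith
  have hPm : P.eval y ∈ Metric.cthickening r (S '' Icc c₁ c₂) :=
    Metric.mem_cthickening_of_dist_le _ _ _ _ (mem_image_of_mem S hy) hd1
  have hu := huc _ hPm _ (hmemS y hy) hd2
  rw [Real.dist_eq] at hu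
  have hBP := hB _ hPm
  have hQy := hQ y hy
  rw [Real.norm_eq_abs] at hBP hQy
  have e : f₁ y - f₀ (P.eval y) * P.derivative.eval y =
      -((f₀ (P.eval y) - f₀ (S y)) * (f₁ y / f₀ (S y)) +
        f₀ (P.eval y) * (P.derivative.eval y - f₁ y / f₀ (S y))) := by
    have := (hf₀S y hy).ne'
    field_simp
    ring
  rw [e, abs_neg]
  have b1 : |(f₀ (P.eval y) - f₀ (S y)) * (f₁ y / f₀ (S y))| ≤ η / (2 * (Q + 1)) * Q := by
    rw [abs_mul]
    exact mul_le_mul hu.le hQy (abs_nonneg _) (by positivity)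
  have b2 : |f₀ (P.eval y) * (P.derivative.eval y - f₁ y / f₀ (S y))| ≤ B * (η / (2 * (B + 1))) := by
    rw [abs_mul]
    exact mul_le_mul hBP (p1.trans t2) (abs_nonneg _) hB0
  have b3 : η / (2 * (Q + 1)) * Q ≤ η / 2 := by
    rw [div_mul_eq_mul_div, div_le_div_iff₀ (by positivity) two_pos]
    nlinarith
  have b4 : B * (η / (2 * (B + 1))) ≤ η / 2 := by
    rw [mul_div_assoc', div_le_div_iff₀ (by positivity) two_pos]
    nlinarith
  linarith [abs_add_le ((f₀ (P.eval y) - f₀ (S y)) * (f₁ y / f₀ (S y)))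
    (f₀ (P.eval y) * (P.derivative.eval y - f₁ y / f₀ (S y)))]

end Target

/-! ### Fields whose target density is close on a large set -/

theorem IsAdmissible.exists_Icc {μ : Measure ℝ} {f : ℝ → ℝ} (h : IsAdmissible μ f) {N : ℝ}
    (hN : (interior μ.support ∩ Ioo (-N) N).Nonempty) {κ : ℝ≥0∞} (hκ : κ ≠ 0) :
    ∃ c₁ c₂, c₁ < c₂ ∧ Icc c₁ c₂ ⊆ interior μ.support ∧ -N ≤ c₁ ∧ c₂ ≤ N ∧
      μ (Icc (-N) N \ Icc c₁ c₂) < κ := by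
  have := h.isProbabilityMeasure
  have := h.nullSingletonClass
  have hoc := h.ordConnected_interior
  have hVo : IsOpen (interior μ.support ∩ Ioo (-N) N) := isOpen_interior.inter isOpen_Ioo
  have hVc : OrdConnected (interior μ.support ∩ Ioo (-N) N) := hoc.inter ordConnected_Ioo
  obtain ⟨x, hx⟩ := hN
  obtain ⟨a, b, hxab, hab⟩ := mem_nhds_iff_exists_Ioo_subset.1 (hVo.mem_nhds hx)
  obtain ⟨b', hb1, hb2⟩ := exists_between hxab.2
  have hbV := hab ⟨hxab.1.trans hb1, hb2⟩
  obtain ⟨K, hKV, hK, hKκ⟩ := hVo.measurableSet.exists_isCompact_sdiff_lt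
    (measure_ne_top μ _) hκ
  -- The compact set comes from inner regularity and may be empty or a single point; adding `x < b'`
  -- ensures `c₁ < c₂`.
  obtain ⟨K', hK'⟩ : ∃ K', K' = K ∪ {x, b'} := ⟨_, rfl⟩
  have hK'c : IsCompact K' := by
    rw [hK']
    exact hK.union (Set.toFinite _).isCompact
  have hK'V : K' ⊆ interior μ.support ∩ Ioo (-N) N := by
    rw [hK']
    refine union_subset hKV ?_
    rintro y (rfl | rfl)
    · exact hx
    · exact hbV
  have hxK : x ∈ K' := by simp [hK']
  have hbK : b' ∈ K' := by simp [hK']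
  obtain ⟨c₁, hc₁, hmin⟩ := hK'c.exists_isLeast ⟨x, hxK⟩
  obtain ⟨c₂, hc₂, hmax⟩ := hK'c.exists_isGreatest ⟨x, hxK⟩
  have hsub : Icc c₁ c₂ ⊆ interior μ.support ∩ Ioo (-N) N := hVc.out (hK'V hc₁) (hK'V hc₂)
  refine ⟨c₁, c₂, (hmin hxK).trans_lt (hb1.trans_le (hmax hbK)), fun y hy => (hsub hy).1,
    (hK'V hc₁).2.1.le, (hK'V hc₂).2.2.le, lt_of_le_of_lt ?_ hKκ⟩
  have hcov : Icc (-N) N \ Icc c₁ c₂ ⊆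
      ((interior μ.support ∩ Ioo (-N) N) \ K) ∪ ((interior μ.support)ᶜ ∪ {-N, N}) := by
    rintro y ⟨hyN, hyc⟩
    by_cases hyU : y ∈ interior μ.support
    swap
    · exact Or.inr (Or.inl hyU)
    rcases hyN.1.eq_or_lt with rfl | h1
    · exact Or.inr (Or.inr (by simp))
    rcases hyN.2.eq_or_lt with rfl | h2
    · exact Or.inr (Or.inr (by simp))
    refine Or.inl ⟨⟨hyU, h1, h2⟩, fun hyK => hyc ?_⟩
    have : y ∈ K' := by
      rw [hK']
      exact Or.inl hyK
    exact ⟨hmin this, hmax this⟩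
  have hnull : μ ((interior μ.support)ᶜ ∪ {-N, N}) = 0 :=
    measure_union_null h.measure_compl_interior ((Set.toFinite _).measure_zero μ)
  calc μ (Icc (-N) N \ Icc c₁ c₂) ≤ _ := measure_mono hcov
    _ ≤ _ := measure_union_le _ _
    _ = _ := by rw [hnull, add_zero]

/-- Two fields whose flows push `μ₀` to a measure with density close to `f₁`, up to a set that is
small for `μ₁`: one with a globally Lipschitz velocity that moves mass inwards far away, and one
whose inverse flow moves mass outwards as fast as required. -/
theorem exists_field_near {μ₀ μ₁ : Measure ℝ} {f₀ f₁ : ℝ → ℝ} (h₀ : IsAdmissible μ₀ f₀)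
    (h₁ : IsAdmissible μ₁ f₁) {N : ℝ} (hN : (interior μ₁.support ∩ Ioo (-N) N).Nonempty)
    {κ : ℝ≥0∞} (hκ : κ ≠ 0) {η : ℝ} (hη : 0 < η) {σ : ℝ → ℝ} (hσ : Monotone σ) :
    ∃ A : Set ℝ, MeasurableSet A ∧ A ⊆ Icc (-N) N ∧ μ₁ (Icc (-N) N \ A) < κ ∧
      (∃ w Φ D, IsFlowField w Φ D ∧ (∃ K, LipschitzWith K w) ∧
        (∀ y, N + 2 ≤ y → y ≤ Φ 1 y) ∧ (∀ y ≤ -(N + 2), Φ 1 y ≤ y) ∧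
        ∀ y ∈ A, |f₁ y - f₀ (Φ 1 y) * D y| ≤ η) ∧
      ∃ w Φ D, IsFlowField w Φ D ∧
        (∀ y, N + 2 ≤ y → σ y ≤ Φ 1 y) ∧ (∀ y ≤ -(N + 2), Φ 1 y ≤ -σ (-y)) ∧
        ∀ y ∈ A, |f₁ y - f₀ (Φ 1 y) * D y| ≤ η := by
  have := h₁.isProbabilityMeasure
  have := h₁.nullSingletonClass
  have hκ2 : κ / 2 ≠ 0 := by simpa using hκ
  obtain ⟨c₁, c₂, hc, hsub, hc₁, hc₂, hμc⟩ := h₁.exists_Icc hN hκ2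
  obtain ⟨P, hPX, hP⟩ := exists_polynomial_pullback_near h₀ h₁ hc hsub hη
  obtain ⟨S, R, S', hS, hfin, hM, hM', hσ1, hσ2, hSP⟩ := exists_diffeo_extension P hPX hc
    (fun y hy => (hP y hy).1) hσ hc₁ hc₂
  have hE : ∀ y, S y = y ↔ y ∈ hfin.toFinset := by simp
  have hN0 : 0 < N := by linarith
  -- The finitely many fixed points are a null set of `μ₁`, so the neighbourhood where the flow
  -- differs from `S` can be given small mass.
  obtain ⟨V, hEV, hVo, hVκ⟩ := {y | S y = y}.exists_isOpen_lt_of_lt (μ := μ₁) (κ / 2)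
    (by rw [hfin.measure_zero μ₁]; exact pos_iff_ne_zero.2 hκ2)
  obtain ⟨r, hr, hrV⟩ := hfin.isCompact.exists_thickening_subset_open hVo hEV
  obtain ⟨δ, hδ, hδr, hδ1⟩ : ∃ δ > 0, 2 * δ ≤ r ∧ δ ≤ 1 :=
    ⟨min (r / 2) 1, by positivity, by linarith [min_le_left (r / 2) 1], min_le_right _ _⟩
  have hEN : ∀ e ∈ hfin.toFinset, |e| < N + 1 := by
    intro e he
    have he' := (hE e).2 he
    rw [abs_lt]
    constructor
    · by_contra! hcon
      exact (hM' e hcon).ne he'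
    · by_contra! hcon
      exact (hM e hcon).ne' he'
  obtain ⟨A, hA⟩ : ∃ A, A = Icc c₁ c₂ \ Metric.thickening r {y | S y = y} := ⟨_, rfl⟩
  have hAdist : ∀ y ∈ A, ∀ e ∈ hfin.toFinset, 2 * δ ≤ |y - e| := by
    intro y hy e he
    rw [hA] at hy
    by_contra! hcon
    refine hy.2 (Metric.mem_thickening_iff.2 ⟨e, (hE e).2 he, ?_⟩)
    rw [Real.dist_eq]
    linarith
  have hAc : ∀ y ∈ A, y ∈ Icc c₁ c₂ := fun y hy => by
    rw [hA] at hy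
    exact hy.1
  have hclose : ∀ {w Φ D}, IsFlowField w Φ D →
      (∀ y ∈ Icc (-(N + 1)) (N + 1), (∀ e ∈ hfin.toFinset, δ ≤ |y - e|) → Φ 1 y = S y) →
      ∀ y ∈ A, |f₁ y - f₀ (Φ 1 y) * D y| ≤ η := by
    intro w Φ D hf hfS y hy
    have hyc := hAc y hy
    -- Points of `A` are at distance `2 * δ` from the fixed points, so `Φ 1 = S` on a whole ball of
    -- radius `δ` and the derivatives agree as well.
    have hev : Φ 1 =ᶠ[𝓝 y] S := by
      have h1 : Ioo (-(N + 1)) (N + 1) ∈ 𝓝 y :=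
        isOpen_Ioo.mem_nhds ⟨by linarith [hyc.1], by linarith [hyc.2]⟩
      filter_upwards [h1, Metric.ball_mem_nhds y hδ] with x hx hxy
      refine hfS x (Ioo_subset_Icc_self hx) fun e he => ?_
      have h2 := hAdist y hy e he
      rw [Metric.mem_ball, Real.dist_eq] at hxy
      have h3 := abs_sub_le y x e
      rw [abs_sub_comm y x] at h3
      linarith
    have hD : D y = S' y := (hf.hasDerivAt y).unique
      ((hS.hasDerivAt y).congr_of_eventuallyEq hev)
    rw [hev.eq_of_nhds, hD, (hSP y hyc).1, (hSP y hyc).2]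
    exact (hP y hyc).2
  have hfar : ∀ y, N + 2 ≤ |y| → ∀ e ∈ hfin.toFinset, δ ≤ |y - e| := by
    intro y hy e he
    have := abs_sub_abs_le_abs_sub y e
    linarith [hEN e he]
  refine ⟨A, ?_, ?_, ?_, ?_, ?_⟩
  · rw [hA]
    exact measurableSet_Icc.diff Metric.isOpen_thickening.measurableSet
  · exact fun y hy => ⟨hc₁.trans (hAc y hy).1, (hAc y hy).2.trans hc₂⟩
  · have hcov : Icc (-N) N \ A ⊆ (Icc (-N) N \ Icc c₁ c₂) ∪ V := by
      rintro y ⟨hyN, hyA⟩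
      by_cases hyc : y ∈ Icc c₁ c₂
      · refine Or.inr (hrV ?_)
        by_contra hyt
        exact hyA (hA ▸ ⟨hyc, hyt⟩)
      · exact Or.inl ⟨hyN, hyc⟩
    calc μ₁ (Icc (-N) N \ A) ≤ _ := measure_mono hcov
      _ ≤ _ := measure_union_le _ _
      _ < κ / 2 + κ / 2 := ENNReal.add_lt_add hμc hVκ
      _ = κ := ENNReal.add_halves κ
  · obtain ⟨w, Φ, D, a1, a2, a3, a4, a5⟩ := exists_lipschitz_field hS hE (M := N + 1)
      (by linarith) hM hM' hδ
    exact ⟨w, Φ, D, a1, a2, fun y hy => a3 y (by linarith), fun y hy => a4 y (by linarith),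
      hclose a1 a5⟩
  · obtain ⟨w, Φ, D, a1, a5⟩ := exists_locallyLipschitz_field hS hE (M := N + 1)
      (by linarith) hM hM' hδ
    refine ⟨w, Φ, D, a1, fun y hy => ?_, fun y hy => ?_, hclose a1 fun y _ => a5 y⟩
    · rw [a5 y (hfar y (hy.trans (le_abs_self y)))]
      exact hσ1 y hy
    · rw [a5 y (hfar y (le_trans (by linarith) (neg_le_abs y)))]
      exact hσ2 y hy

/-! ### Weighted `L¹` estimates -/

/-- The weight `1 + |y| ^ r`. -/
noncomputable def momentWeight (r y : ℝ) : ℝ≥0∞ := 1 + ‖y‖ₑ ^ r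

section Weight

variable {r : ℝ}

@[fun_prop]
theorem measurable_momentWeight : Measurable (momentWeight r) := by
  unfold momentWeight
  fun_prop

theorem momentWeight_mono (hr : 0 ≤ r) {x y : ℝ} (h : |x| ≤ |y|) :
    momentWeight r x ≤ momentWeight r y := by
  unfold momentWeight
  gcongr
  rw [Real.enorm_eq_ofReal_abs, Real.enorm_eq_ofReal_abs]
  exact ENNReal.ofReal_le_ofReal h

theorem momentWeight_ne_top (hr : 0 ≤ r) (y : ℝ) : momentWeight r y ≠ ∞ :=
  ENNReal.add_ne_top.2 ⟨ENNReal.one_ne_top, ENNReal.rpow_ne_top_of_nonneg hr enorm_ne_top⟩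

theorem momentWeight_add_two_le (hr : 0 ≤ r) {N y : ℝ} (hN : 2 ≤ N) (hy : N ≤ |y|) :
    momentWeight r (N + 2) ≤ (1 + 2 ^ r) * momentWeight r y := by
  have h1 : ‖N + 2‖ₑ ≤ 2 * ‖y‖ₑ := by
    rw [Real.enorm_eq_ofReal_abs, Real.enorm_eq_ofReal_abs, abs_of_nonneg (by linarith),
      ← ENNReal.ofReal_ofNat 2, ← ENNReal.ofReal_mul (by norm_num)]
    exact ENNReal.ofReal_le_ofReal (by linarith)
  have h2 : ‖N + 2‖ₑ ^ r ≤ 2 ^ r * ‖y‖ₑ ^ r := by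
    rw [← ENNReal.mul_rpow_of_nonneg _ _ hr]
    exact ENNReal.rpow_le_rpow h1 hr
  calc momentWeight r (N + 2) ≤ 1 + 2 ^ r * ‖y‖ₑ ^ r := by
        unfold momentWeight
        gcongr
    _ ≤ 1 + 2 ^ r * ‖y‖ₑ ^ r + (2 ^ r + ‖y‖ₑ ^ r) := le_self_add
    _ = (1 + 2 ^ r) * momentWeight r y := by
        unfold momentWeight
        ring

theorem lintegral_momentWeight_ne_top {μ : Measure ℝ} [IsProbabilityMeasure μ]
    (h : FiniteMoment r μ) : ∫⁻ y, momentWeight r y ∂μ ≠ ∞ := by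
  unfold momentWeight
  rw [lintegral_add_left measurable_const]
  simpa using h.ne

theorem tendsto_tail {μ : Measure ℝ} [IsProbabilityMeasure μ] (h : FiniteMoment r μ) :
    Tendsto (fun n : ℕ => ∫⁻ y in (Icc (-(n : ℝ)) n)ᶜ, momentWeight r y ∂μ) atTop (𝓝 0) := by
  refine tendsto_setLIntegral_zero (lintegral_momentWeight_ne_top h) ?_
  have h1 := tendsto_measure_iInter_atTop (μ := μ) (s := fun n : ℕ => (Icc (-(n : ℝ)) n)ᶜ)
    (fun n => measurableSet_Icc.compl.nullMeasurableSet) (fun m n hmn => by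
      have : (m : ℝ) ≤ n := by exact_mod_cast hmn
      exact compl_subset_compl.2 (Icc_subset_Icc (by linarith) this)) ⟨0, measure_ne_top μ _⟩
  have h2 : ⋂ n : ℕ, (Icc (-(n : ℝ)) n)ᶜ = ∅ := by
    refine eq_empty_of_forall_notMem fun x hx => ?_
    obtain ⟨n, hn⟩ := exists_nat_ge |x|
    exact mem_iInter.1 hx n (abs_le.1 hn)
  rwa [h2, measure_empty] at h1

end Weight

theorem IsAdmissible.setLIntegral {μ : Measure ℝ} {f : ℝ → ℝ} (h : IsAdmissible μ f)
    {ρ : ℝ → ℝ≥0∞} (hρ : Measurable ρ) {s : Set ℝ} (hs : MeasurableSet s) :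
    ∫⁻ y in s, ρ y ∂μ = ∫⁻ y in s, ρ y * ENNReal.ofReal (f y) := by
  conv_lhs => rw [h.eq_withDensity]
  rw [setLIntegral_withDensity_eq_setLIntegral_mul _ h.measurable.ennreal_ofReal hρ hs]
  simp only [Pi.mul_apply, mul_comm]

theorem IsAdmissible.measure_eq {μ : Measure ℝ} {f : ℝ → ℝ} (h : IsAdmissible μ f)
    {s : Set ℝ} (hs : MeasurableSet s) : μ s = ∫⁻ y in s, ENNReal.ofReal (f y) := by
  have := h.setLIntegral (ρ := fun _ => 1) measurable_const hs
  simpa using this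

/-- The weighted `L¹` distance of two densities which are close on a large set. -/
theorem lintegral_weight_le {μ ν : Measure ℝ} {f g : ℝ → ℝ} (hμ : IsAdmissible μ f)
    (hν : IsAdmissible ν g) {r : ℝ} (hr : 0 ≤ r) {N η : ℝ} (hN : 2 ≤ N) {A : Set ℝ}
    (hA : MeasurableSet A) (hAN : A ⊆ Icc (-N) N) (hη : ∀ y ∈ A, |f y - g y| ≤ η) :
    ∫⁻ y, momentWeight r y * ‖f y - g y‖ₑ ≤
      ((1 + (1 + 2 ^ r)) * ∫⁻ y in (Icc (-N) N)ᶜ, momentWeight r y ∂μ) +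
      μ (Icc (-N) N \ A) * (2 * momentWeight r (N + 2)) +
      (ENNReal.ofReal η * (2 * momentWeight r (N + 2) * ENNReal.ofReal (2 * N)) +
      ∫⁻ y in (Icc (-(N + 2)) (N + 2))ᶜ, momentWeight r y ∂ν) := by
  have := hμ.isProbabilityMeasure
  have := hν.isProbabilityMeasure
  obtain ⟨W, hW⟩ : ∃ W, W = momentWeight r (N + 2) := ⟨_, rfl⟩
  obtain ⟨L, hL⟩ : ∃ L, L = ENNReal.ofReal (2 * N) := ⟨_, rfl⟩
  obtain ⟨e, he⟩ : ∃ e, e = ENNReal.ofReal η := ⟨_, rfl⟩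
  have hWle : ∀ y ∈ Icc (-(N + 2)) (N + 2), momentWeight r y ≤ W := by
    intro y hy
    rw [hW]
    refine momentWeight_mono hr ?_
    rw [abs_of_nonneg (by linarith : 0 ≤ N + 2)]
    exact abs_le.2 hy
  have hBQ : Icc (-N) N ⊆ Icc (-(N + 2)) (N + 2) := Icc_subset_Icc (by linarith) (by linarith)
  have hvolA : volume A ≤ L := by
    refine (measure_mono hAN).trans ?_
    rw [Real.volume_Icc, hL]
    exact ENNReal.ofReal_le_ofReal (by linarith)
  have hclose : ∀ y ∈ A, ‖f y - g y‖ₑ ≤ e := by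
    intro y hy
    rw [Real.enorm_eq_ofReal_abs, he]
    exact ENNReal.ofReal_le_ofReal (hη y hy)
  have t1 : ∫⁻ y in A, momentWeight r y * ‖f y - g y‖ₑ ≤ W * e * L := by
    calc ∫⁻ y in A, momentWeight r y * ‖f y - g y‖ₑ ≤ ∫⁻ _ in A, W * e :=
          setLIntegral_mono' hA fun y hy => mul_le_mul' (hWle y (hBQ (hAN hy))) (hclose y hy)
      _ = W * e * volume A := setLIntegral_const _ _
      _ ≤ W * e * L := by gcongr
  have t2 : ∫⁻ y in Aᶜ, momentWeight r y * ‖f y - g y‖ₑ ≤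
      (∫⁻ y in Aᶜ, momentWeight r y ∂μ) + ∫⁻ y in Aᶜ, momentWeight r y ∂ν := by
    have hm : Measurable fun y => momentWeight r y * ENNReal.ofReal (f y) :=
      measurable_momentWeight.mul hμ.measurable.ennreal_ofReal
    rw [hμ.setLIntegral measurable_momentWeight hA.compl,
      hν.setLIntegral measurable_momentWeight hA.compl, ← lintegral_add_left hm]
    refine lintegral_mono fun y => ?_
    rw [← mul_add]
    gcongr
    refine enorm_sub_le.trans ?_
    rw [Real.enorm_of_nonneg (hμ.nonneg y), Real.enorm_of_nonneg (hν.nonneg y)]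
  have t3 : ∫⁻ y in Aᶜ, momentWeight r y ∂μ ≤
      (∫⁻ y in (Icc (-N) N)ᶜ, momentWeight r y ∂μ) + W * μ (Icc (-N) N \ A) := by
    have hsub : Aᶜ ⊆ (Icc (-N) N)ᶜ ∪ (Icc (-N) N \ A) := by
      intro y hy
      by_cases h : y ∈ Icc (-N) N
      · exact Or.inr ⟨h, hy⟩
      · exact Or.inl h
    refine (lintegral_mono_set hsub).trans ((lintegral_union_le _ _ _).trans ?_)
    gcongr
    rw [← setLIntegral_const]
    exact setLIntegral_mono' (measurableSet_Icc.diff hA) fun y hy => hWle y (hBQ hy.1)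
  have t4 : ∫⁻ y in Aᶜ, momentWeight r y ∂ν ≤
      (∫⁻ y in (Icc (-(N + 2)) (N + 2))ᶜ, momentWeight r y ∂ν) + W * ν Aᶜ := by
    have hsub : Aᶜ ⊆ (Icc (-(N + 2)) (N + 2))ᶜ ∪ (Icc (-(N + 2)) (N + 2) \ A) := by
      intro y hy
      by_cases h : y ∈ Icc (-(N + 2)) (N + 2)
      · exact Or.inr ⟨h, hy⟩
      · exact Or.inl h
    refine (lintegral_mono_set hsub).trans ((lintegral_union_le _ _ _).trans ?_)
    gcongr
    calc ∫⁻ y in Icc (-(N + 2)) (N + 2) \ A, momentWeight r y ∂ν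
        ≤ ∫⁻ _ in Icc (-(N + 2)) (N + 2) \ A, W ∂ν :=
          setLIntegral_mono' (measurableSet_Icc.diff hA) fun y hy => hWle y hy.1
      _ = W * ν (Icc (-(N + 2)) (N + 2) \ A) := setLIntegral_const _ _
      _ ≤ W * ν Aᶜ := by
        gcongr
        exact fun y hy => hy.2
  have t5 : μ A ≤ ν A + e * L := by
    rw [hμ.measure_eq hA, hν.measure_eq hA]
    calc ∫⁻ y in A, ENNReal.ofReal (f y) ≤ ∫⁻ y in A, (ENNReal.ofReal (g y) + e) := by
          refine setLIntegral_mono' hA fun y hy => ?_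
          rw [he, ← ENNReal.ofReal_add (hν.nonneg y) ((abs_nonneg _).trans (hη y hy))]
          exact ENNReal.ofReal_le_ofReal (by linarith [(abs_le.1 (hη y hy)).2])
      _ = (∫⁻ y in A, ENNReal.ofReal (g y)) + e * volume A := by
          rw [lintegral_add_right _ measurable_const, setLIntegral_const]
      _ ≤ _ := by gcongr
  -- Both measures have mass one, so `ν` has almost as little mass off `A` as `μ`.
  have t6 : ν Aᶜ ≤ μ Aᶜ + e * L := by
    have h1 : ν Aᶜ + μ A ≤ μ Aᶜ + e * L + μ A := by
      calc ν Aᶜ + μ A ≤ ν Aᶜ + (ν A + e * L) := by gcongr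
        _ = 1 + e * L := by
          rw [← add_assoc, add_comm (ν Aᶜ), measure_add_measure_compl hA, measure_univ]
        _ = μ Aᶜ + e * L + μ A := by
          rw [← measure_univ (μ := μ), ← measure_add_measure_compl hA]
          ring
    exact (ENNReal.add_le_add_iff_right (measure_ne_top μ A)).1 h1
  have t7 : μ Aᶜ ≤ μ (Icc (-N) N)ᶜ + μ (Icc (-N) N \ A) := by
    refine (measure_mono ?_).trans (measure_union_le _ _)
    intro y hy
    by_cases h : y ∈ Icc (-N) N
    · exact Or.inr ⟨h, hy⟩
    · exact Or.inl h
  -- The constant weight `W` at `N + 2` is absorbed by the tail: `N + 2 ≤ 2 * |y|` there because `N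
  -- ≥ 2`.
  have t8 : W * μ (Icc (-N) N)ᶜ ≤ (1 + 2 ^ r) * ∫⁻ y in (Icc (-N) N)ᶜ, momentWeight r y ∂μ := by
    rw [← setLIntegral_const, ← lintegral_const_mul _ measurable_momentWeight]
    refine setLIntegral_mono' measurableSet_Icc.compl fun y hy => ?_
    rw [hW]
    refine momentWeight_add_two_le hr hN ?_
    by_contra! hcon
    exact hy (abs_le.1 hcon.le)
  rw [← hW, ← hL, ← he, ← lintegral_add_compl _ hA]
  calc (∫⁻ y in A, momentWeight r y * ‖f y - g y‖ₑ) + ∫⁻ y in Aᶜ, momentWeight r y * ‖f y - g y‖ₑ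
      ≤ W * e * L + (((∫⁻ y in (Icc (-N) N)ᶜ, momentWeight r y ∂μ) + W * μ (Icc (-N) N \ A)) +
        ((∫⁻ y in (Icc (-(N + 2)) (N + 2))ᶜ, momentWeight r y ∂ν) +
          W * (μ (Icc (-N) N)ᶜ + μ (Icc (-N) N \ A) + e * L))) := by
        refine add_le_add t1 (t2.trans (add_le_add t3 (t4.trans ?_)))
        gcongr
        exact t6.trans (by gcongr)
    _ = W * μ (Icc (-N) N)ᶜ + ((∫⁻ y in (Icc (-N) N)ᶜ, momentWeight r y ∂μ) +
        μ (Icc (-N) N \ A) * (2 * W) + (e * (2 * W * L) +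
        ∫⁻ y in (Icc (-(N + 2)) (N + 2))ᶜ, momentWeight r y ∂ν)) := by ring
    _ ≤ (1 + 2 ^ r) * (∫⁻ y in (Icc (-N) N)ᶜ, momentWeight r y ∂μ) +
        ((∫⁻ y in (Icc (-N) N)ᶜ, momentWeight r y ∂μ) +
        μ (Icc (-N) N \ A) * (2 * W) + (e * (2 * W * L) +
        ∫⁻ y in (Icc (-(N + 2)) (N + 2))ᶜ, momentWeight r y ∂ν)) := by gcongr
    _ = _ := by ring

/-! ### Wasserstein distance and weighted `L¹` distance -/

section Wasserstein

/-- The Wasserstein distance is controlled by a weighted `L¹` distance of the densities. -/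
theorem wassersteinDist_le {μ ν : Measure ℝ} {f g : ℝ → ℝ} (hμ : IsAdmissible μ f)
    (hν : IsAdmissible ν g) {p : ℝ} (hp : 1 ≤ p) :
    wassersteinDist p μ ν ≤ (2 ^ (p - 1) * ∫⁻ y, ‖y‖ₑ ^ p * ‖f y - g y‖ₑ) ^ (1 / p) := by
  have := hμ.isProbabilityMeasure
  have := hν.isProbabilityMeasure
  have hp0 : 0 < p := by linarith
  have ha : Measurable fun y => ENNReal.ofReal (f y) := hμ.measurable.ennreal_ofReal
  have hb : Measurable fun y => ENNReal.ofReal (g y) := hν.measurable.ennreal_ofReal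
  obtain ⟨c, hc⟩ : ∃ c : ℝ → ℝ≥0∞,
      c = fun y => min (ENNReal.ofReal (f y)) (ENNReal.ofReal (g y)) := ⟨_, rfl⟩
  obtain ⟨α, hα⟩ : ∃ α : ℝ → ℝ≥0∞, α = fun y => ENNReal.ofReal (f y) - c y := ⟨_, rfl⟩
  obtain ⟨β, hβ⟩ : ∃ β : ℝ → ℝ≥0∞, β = fun y => ENNReal.ofReal (g y) - c y := ⟨_, rfl⟩
  have hcm : Measurable c := hc ▸ ha.min hb
  have hαm : Measurable α := hα ▸ ha.sub hcm
  have hβm : Measurable β := hβ ▸ hb.sub hcm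
  have hca : c + α = fun y => ENNReal.ofReal (f y) := by
    funext y
    simp only [Pi.add_apply, hα, hc]
    exact add_tsub_cancel_of_le (min_le_left _ _)
  have hcb : c + β = fun y => ENNReal.ofReal (g y) := by
    funext y
    simp only [Pi.add_apply, hβ, hc]
    exact add_tsub_cancel_of_le (min_le_right _ _)
  have hαβ : ∀ y, ‖f y - g y‖ₑ = α y + β y := by
    intro y
    rw [Real.enorm_eq_ofReal_abs]
    simp only [hα, hβ, hc]
    rcases le_total (f y) (g y) with h | h
    · rw [min_eq_left (ENNReal.ofReal_le_ofReal h), tsub_self, zero_add,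
        ← ENNReal.ofReal_sub _ (hμ.nonneg y), abs_sub_comm, abs_of_nonneg (sub_nonneg.2 h)]
    · rw [min_eq_right (ENNReal.ofReal_le_ofReal h), tsub_self, add_zero,
        ← ENNReal.ofReal_sub _ (hν.nonneg y), abs_of_nonneg (sub_nonneg.2 h)]
  obtain ⟨mc, hmc⟩ : ∃ m : Measure ℝ, m = volume.withDensity c := ⟨_, rfl⟩
  obtain ⟨ma, hma⟩ : ∃ m : Measure ℝ, m = volume.withDensity α := ⟨_, rfl⟩
  obtain ⟨mb, hmb⟩ : ∃ m : Measure ℝ, m = volume.withDensity β := ⟨_, rfl⟩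
  have hμe : μ = mc + ma := by
    rw [hmc, hma, ← withDensity_add_left hcm, hca]
    exact hμ.eq_withDensity
  have hνe : ν = mc + mb := by
    rw [hmc, hmb, ← withDensity_add_left hcm, hcb]
    exact hν.eq_withDensity
  have : IsFiniteMeasure mc := isFiniteMeasure_of_le μ (hμe ▸ Measure.le_add_right le_rfl)
  have : IsFiniteMeasure ma := isFiniteMeasure_of_le μ (hμe ▸ Measure.le_add_left le_rfl)
  have : IsFiniteMeasure mb := isFiniteMeasure_of_le ν (hνe ▸ Measure.le_add_left le_rfl)
  have hmass : ma univ = mb univ := by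
    have h1 : μ univ = ν univ := by rw [measure_univ, measure_univ]
    rw [hμe, hνe, Measure.add_apply, Measure.add_apply] at h1
    exact (ENNReal.add_right_inj (measure_ne_top mc univ)).1 h1
  obtain ⟨m, hm⟩ : ∃ m, m = ma univ := ⟨_, rfl⟩
  have hmtop : m ≠ ∞ := hm ▸ measure_ne_top ma univ
  -- For `m = 0` the scalar `m⁻¹` is infinite, but then `ρ` is zero.
  have hsmul : ∀ ρ : Measure ℝ, ρ univ = m → m⁻¹ • m • ρ = ρ := by
    intro ρ hρ
    by_cases h0 : m = 0
    · rw [h0, Measure.measure_univ_eq_zero] at hρ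
      rw [hρ, smul_zero, smul_zero]
    · rw [smul_smul, ENNReal.inv_mul_cancel h0 hmtop, one_smul]
  -- The common part of the two densities stays in place at no cost; the excess parts, of equal mass
  -- `m`, are coupled independently.
  obtain ⟨π, hπ⟩ : ∃ π : Measure (ℝ × ℝ),
      π = mc.map (fun y => (y, y)) + m⁻¹ • ma.prod mb := ⟨_, rfl⟩
  have hdm : Measurable fun y : ℝ => (y, y) := measurable_id.prodMk measurable_id
  have hcoup : IsCoupling μ ν π := by
    constructor
    · rw [hπ, Measure.map_add _ _ measurable_fst, Measure.map_map measurable_fst hdm,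
        Measure.map_smul, Measure.map_fst_prod, ← hmass, ← hm, hsmul ma hm.symm, hμe]
      congr 1
      exact Measure.map_id
    · rw [hπ, Measure.map_add _ _ measurable_snd, Measure.map_map measurable_snd hdm,
        Measure.map_smul, Measure.map_snd_prod, ← hm, hsmul mb (hmass.symm.trans hm.symm), hνe]
      congr 1
      exact Measure.map_id
  have hpm : Measurable fun y : ℝ => ‖y‖ₑ ^ p := by fun_prop
  have hcost : ∫⁻ z, edist z.1 z.2 ^ p ∂π ≤
      2 ^ (p - 1) * ∫⁻ y, ‖y‖ₑ ^ p * ‖f y - g y‖ₑ := by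
    have hem : Measurable fun z : ℝ × ℝ => edist z.1 z.2 ^ p := by fun_prop
    have hprod : ∫⁻ z, edist z.1 z.2 ^ p ∂(ma.prod mb) ≤
        m * (2 ^ (p - 1) * ((∫⁻ y, ‖y‖ₑ ^ p ∂ma) + ∫⁻ y, ‖y‖ₑ ^ p ∂mb)) := by
      rw [lintegral_prod _ hem.aemeasurable]
      calc ∫⁻ x, ∫⁻ y, edist x y ^ p ∂mb ∂ma
          ≤ ∫⁻ x, ∫⁻ y, 2 ^ (p - 1) * (‖x‖ₑ ^ p + ‖y‖ₑ ^ p) ∂mb ∂ma := by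
            refine lintegral_mono fun x => lintegral_mono fun y => ?_
            refine (ENNReal.rpow_le_rpow ?_ hp0.le).trans
              (ENNReal.rpow_add_le_mul_rpow_add_rpow _ _ hp)
            rw [edist_eq_enorm_sub]
            exact enorm_sub_le
        _ = ∫⁻ x, 2 ^ (p - 1) * (‖x‖ₑ ^ p * m + ∫⁻ y, ‖y‖ₑ ^ p ∂mb) ∂ma := by
            refine lintegral_congr fun x => ?_
            rw [lintegral_const_mul _ (by fun_prop),
              lintegral_add_left measurable_const, lintegral_const, ← hmass, ← hm]
        _ = _ := by
            rw [lintegral_const_mul _ (by fun_prop),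
              lintegral_add_right _ measurable_const, lintegral_mul_const _ hpm, lintegral_const,
              ← hm]
            ring
    have hsum : (∫⁻ y, ‖y‖ₑ ^ p ∂ma) + ∫⁻ y, ‖y‖ₑ ^ p ∂mb = ∫⁻ y, ‖y‖ₑ ^ p * ‖f y - g y‖ₑ := by
      rw [hma, hmb, lintegral_withDensity_eq_lintegral_mul _ hαm hpm,
        lintegral_withDensity_eq_lintegral_mul _ hβm hpm, ← lintegral_add_left (hαm.mul hpm)]
      refine lintegral_congr fun y => ?_
      simp only [Pi.mul_apply, hαβ]
      ring
    have hdiag : ∫⁻ z, edist z.1 z.2 ^ p ∂(mc.map fun y => (y, y)) = 0 := by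
      rw [lintegral_map hem hdm]
      simp [hp0]
    rw [hπ, lintegral_add_measure, hdiag, zero_add, lintegral_smul_measure, smul_eq_mul, ← hsum]
    refine (mul_le_mul_right hprod _).trans ?_
    rw [← mul_assoc]
    exact mul_le_of_le_one_left' (ENNReal.inv_mul_le_one m)
  unfold wassersteinDist
  refine ENNReal.rpow_le_rpow ?_ (by positivity)
  exact (iInf₂_le π hcoup).trans hcost

end Wasserstein

/-! ### Tails of the new target -/

theorem IsFlowField.continuous_neg_one {v : ℝ → ℝ} {Φ : ℝ → ℝ → ℝ} {D : ℝ → ℝ}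
    (h : IsFlowField v Φ D) : Continuous (Φ (-1)) := by
  have hTm : StrictMono (Φ (-1)) := by
    intro x y hxy
    rwa [← h.strictMono.lt_iff_lt, h.apply_neg_apply, h.apply_neg_apply]
  exact hTm.monotone.continuous_of_surjective fun y => ⟨Φ 1 y, h.neg_apply_apply 1 y⟩

/-- A monotone function with prescribed lower bounds at the points `a + k`. -/
theorem exists_monotone_ge (a : ℝ) (s : ℕ → ℝ) :
    ∃ σ : ℝ → ℝ, Monotone σ ∧ ∀ (k : ℕ) (y : ℝ), a + k ≤ y → s k ≤ σ y := by
  refine ⟨fun y => ∑ k ∈ Finset.range (⌊y - a⌋₊ + 1), |s k|, ?_, ?_⟩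
  · intro x y hxy
    refine Finset.sum_le_sum_of_subset_of_nonneg ?_ fun _ _ _ => abs_nonneg _
    refine Finset.range_subset_range.2 ?_
    have : ⌊x - a⌋₊ ≤ ⌊y - a⌋₊ := Nat.floor_mono (by linarith)
    omega
  · intro k y hy
    refine (le_abs_self _).trans ?_
    refine Finset.single_le_sum (f := fun k => |s k|) (fun _ _ => abs_nonneg _) ?_
    rw [Finset.mem_range, Nat.lt_succ_iff]
    exact Nat.le_floor (by linarith)

/-- If the inverse of a map moves points outwards fast enough, the image of a probability measure
under the map has small weighted tails. -/
theorem exists_growth (μ : Measure ℝ) [IsProbabilityMeasure μ] {r : ℝ} (hr : 0 ≤ r) {M : ℝ}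
    {ε : ℝ≥0∞} (hε : ε ≠ 0) :
    ∃ σ : ℝ → ℝ, Monotone σ ∧ ∀ S T : ℝ → ℝ, Measurable T → (∀ x, S (T x) = x) →
      (∀ y, M ≤ y → σ y ≤ S y) → (∀ y ≤ -M, S y ≤ -σ (-y)) →
      ∫⁻ y in (Icc (-M) M)ᶜ, momentWeight r y ∂(μ.map T) < ε := by
  obtain ⟨e, he0, hesum⟩ := ENNReal.exists_pos_sum_of_countable' hε ℕ
  -- The shell `M + k ≤ |y| ≤ M + k + 1` contributes at most `e k` as soon as `S` maps it beyond
  -- radius `s k`.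
  have htail : ∀ k : ℕ, ∃ s : ℝ, momentWeight r (M + k + 1) * μ {x | s ≤ |x|} ≤ e k := by
    intro k
    have h1 := tendsto_measure_iInter_atTop (μ := μ) (s := fun n : ℕ => {x : ℝ | (n : ℝ) ≤ |x|})
      (fun n => (measurableSet_le measurable_const measurable_id.abs).nullMeasurableSet)
      (fun m n hmn x hx => by
        have h2 : (m : ℝ) ≤ n := by exact_mod_cast hmn
        have h3 : (n : ℝ) ≤ |x| := hx
        exact h2.trans h3) ⟨0, measure_ne_top μ _⟩
    have h2 : ⋂ n : ℕ, {x : ℝ | (n : ℝ) ≤ |x|} = ∅ := by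
      refine eq_empty_of_forall_notMem fun x hx => ?_
      obtain ⟨n, hn⟩ := exists_nat_gt |x|
      have h3 : (n : ℝ) ≤ |x| := mem_iInter.1 hx n
      exact absurd h3 (not_le.2 hn)
    rw [h2, measure_empty] at h1
    have h3 := ENNReal.Tendsto.const_mul (a := momentWeight r (M + k + 1)) h1
      (Or.inr (momentWeight_ne_top hr _))
    rw [mul_zero] at h3
    obtain ⟨n, hn⟩ := (h3.eventually_le_const (he0 k)).exists
    exact ⟨n, hn⟩
  choose s hs using htail
  obtain ⟨σ, hσ, hσs⟩ := exists_monotone_ge M s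
  refine ⟨σ, hσ, fun S T hT hST h1 h2 => lt_of_le_of_lt ?_ hesum⟩
  have hcov : (Icc (-M) M)ᶜ ⊆ ⋃ k : ℕ, {y : ℝ | M + k ≤ |y| ∧ |y| ≤ M + k + 1} := by
    intro y hy
    have hMy : M < |y| := by
      by_contra! hcon
      exact hy (abs_le.1 hcon)
    refine mem_iUnion.2 ⟨⌊|y| - M⌋₊, ?_, ?_⟩
    · have := Nat.floor_le (sub_nonneg.2 hMy.le)
      linarith
    · have := Nat.lt_floor_add_one (|y| - M)
      linarith
  refine (lintegral_mono_set hcov).trans ((lintegral_iUnion_le _ _).trans ?_)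
  refine ENNReal.tsum_le_tsum fun k => le_trans ?_ (hs k)
  have hmeas : MeasurableSet {y : ℝ | M + k ≤ |y| ∧ |y| ≤ M + k + 1} :=
    (measurableSet_le measurable_const measurable_id.abs).inter
      (measurableSet_le measurable_id.abs measurable_const)
  calc ∫⁻ y in {y : ℝ | M + k ≤ |y| ∧ |y| ≤ M + k + 1}, momentWeight r y ∂(μ.map T)
      ≤ ∫⁻ _ in {y : ℝ | M + k ≤ |y| ∧ |y| ≤ M + k + 1}, momentWeight r (M + k + 1)
          ∂(μ.map T) := by
        refine setLIntegral_mono' hmeas fun y hy => momentWeight_mono hr ?_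
        exact hy.2.trans (le_abs_self _)
    _ = momentWeight r (M + k + 1) * μ.map T {y : ℝ | M + k ≤ |y| ∧ |y| ≤ M + k + 1} :=
        setLIntegral_const _ _
    _ ≤ momentWeight r (M + k + 1) * μ {x | s k ≤ |x|} := by
        rw [Measure.map_apply hT hmeas]
        gcongr
        intro x hx
        have hx1 : M + k ≤ |T x| := hx.1
        have hk : (0 : ℝ) ≤ k := Nat.cast_nonneg k
        rcases le_total 0 (T x) with h | h
        · rw [abs_of_nonneg h] at hx1
          have h3 := h1 (T x) (by linarith)
          rw [hST] at h3
          exact (hσs k _ hx1).trans (h3.trans (le_abs_self x))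
        · rw [abs_of_nonpos h] at hx1
          have h3 := h2 (T x) (by linarith)
          rw [hST] at h3
          exact (hσs k _ hx1).trans (le_trans (by linarith) (neg_le_abs x))

/-- A point that `T` sends into the tail has not been moved outwards, so it was in the tail already
and with a weight at least as large. -/
theorem lintegral_tail_map_le {μ : Measure ℝ} {r : ℝ} (hr : 0 ≤ r) {N M : ℝ} (hNM : N ≤ M)
    {S T : ℝ → ℝ} (hT : Measurable T) (hST : ∀ x, S (T x) = x) (h1 : ∀ y, M ≤ y → y ≤ S y)
    (h2 : ∀ y ≤ -M, S y ≤ y) :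
    ∫⁻ y in (Icc (-M) M)ᶜ, momentWeight r y ∂(μ.map T) ≤
      ∫⁻ y in (Icc (-N) N)ᶜ, momentWeight r y ∂μ := by
  rw [setLIntegral_map measurableSet_Icc.compl measurable_momentWeight hT]
  have key : ∀ x, T x ∈ (Icc (-M) M)ᶜ → |T x| ≤ |x| ∧ M < |T x| := by
    intro x hx
    have hMT : M < |T x| := by
      by_contra! hcon
      exact hx (abs_le.1 hcon)
    refine ⟨?_, hMT⟩
    rcases le_total 0 (T x) with h | h
    · rw [abs_of_nonneg h] at hMT ⊢
      have := h1 (T x) hMT.le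
      rw [hST] at this
      exact this.trans (le_abs_self x)
    · rw [abs_of_nonpos h] at hMT ⊢
      have := h2 (T x) (by linarith)
      rw [hST] at this
      exact le_trans (by linarith) (neg_le_abs x)
  refine (setLIntegral_mono' (hT measurableSet_Icc.compl)
    fun x hx => momentWeight_mono hr (key x hx).1).trans (lintegral_mono_set fun x hx => ?_)
  intro hxN
  have h3 := abs_le.2 hxN
  have h4 := key x hx
  linarith

/-- Density, in a weighted `L¹` sense, of the measures reached from `μ₀` by autonomous flows. -/
theorem exists_flowField_lintegral_lt {μ₀ μ₁ : Measure ℝ} {f₀ f₁ : ℝ → ℝ}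
    (h₀ : IsAdmissible μ₀ f₀) (h₁ : IsAdmissible μ₁ f₁) {r : ℝ} (hr : 0 ≤ r)
    (hm : FiniteMoment r μ₁) {ε : ℝ≥0∞} (hε : ε ≠ 0) :
    ∃ w Φ D, IsFlowField w Φ D ∧
      ∫⁻ y, momentWeight r y * ‖f₁ y - f₀ (Φ 1 y) * D y‖ₑ < ε ∧
      (FiniteMoment r μ₀ → ∃ K, LipschitzWith K w) := by
  have := h₀.isProbabilityMeasure
  have := h₁.isProbabilityMeasure
  have hε2 : ε / 2 ≠ 0 := by simpa using hε
  have hε4 : ε / 2 / 2 ≠ 0 := by simpa using hε2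
  have hCtop : (1 + (1 + 2 ^ r) : ℝ≥0∞) ≠ ∞ := by
    have : (2 : ℝ≥0∞) ^ r ≠ ∞ := ENNReal.rpow_ne_top_of_nonneg hr (by norm_num)
    simp [this]
  obtain ⟨x₀, hx₀⟩ : (interior μ₁.support).Nonempty := by
    rw [nonempty_iff_ne_empty]
    intro h
    have := h₁.measure_interior
    rw [h, measure_empty] at this
    exact zero_ne_one this
  have hev1 : ∀ᶠ n : ℕ in atTop,
      (1 + (1 + 2 ^ r)) * ∫⁻ y in (Icc (-(n : ℝ)) n)ᶜ, momentWeight r y ∂μ₁ < ε / 2 / 2 := by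
    have := ENNReal.Tendsto.const_mul (tendsto_tail hm) (Or.inr hCtop)
    rw [mul_zero] at this
    exact this.eventually_lt_const (pos_iff_ne_zero.2 hε4)
  have hev2 : ∀ᶠ n : ℕ in atTop, |x₀| < n :=
    tendsto_natCast_atTop_atTop.eventually_gt_atTop _
  have hev3 : ∀ᶠ n : ℕ in atTop, FiniteMoment r μ₀ →
      ∫⁻ y in (Icc (-(n : ℝ)) n)ᶜ, momentWeight r y ∂μ₀ < ε / 2 / 2 := by
    by_cases h : FiniteMoment r μ₀
    · filter_upwards [(tendsto_tail h).eventually_lt_const (pos_iff_ne_zero.2 hε4)] with n hn _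
        using hn
    · exact Eventually.of_forall fun n h' => absurd h' h
  obtain ⟨n, ⟨⟨hn1, hn2⟩, hn3⟩, hn4⟩ :=
    (((hev1.and hev2).and hev3).and (eventually_ge_atTop 2)).exists
  obtain ⟨N, hN⟩ : ∃ N : ℝ, N = n := ⟨_, rfl⟩
  rw [← hN] at hn1 hn2 hn3
  have hN2 : 2 ≤ N := by
    rw [hN]
    exact_mod_cast hn4
  have hWtop : 2 * momentWeight r (N + 2) ≠ ∞ :=
    ENNReal.mul_ne_top (by norm_num) (momentWeight_ne_top hr _)
  -- `N` is fixed before `κ` and `η`, because the weight `W` at `N + 2` multiplies both errors. The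
  -- four terms of `lintegral_weight_le` get a quarter of `ε` each.
  obtain ⟨κ, hκ0, hκ⟩ := ENNReal.exists_pos_mul_lt hWtop hε4
  obtain ⟨η, hη0, hη⟩ := ENNReal.exists_nnreal_pos_mul_lt
    (ENNReal.mul_ne_top hWtop (ENNReal.ofReal_ne_top (r := 2 * N))) hε4
  obtain ⟨σ, hσ, hgrow⟩ := exists_growth μ₀ hr (M := N + 2) hε4
  obtain ⟨A, hA, hAN, hAκ, hfA, hfB⟩ := exists_field_near h₀ h₁ (N := N)
    ⟨x₀, hx₀, abs_lt.1 hn2⟩ hκ0.ne' (η := η) (by exact_mod_cast hη0) hσ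
  have hfin : ∀ {w Φ D}, IsFlowField w Φ D → (∀ y ∈ A, |f₁ y - f₀ (Φ 1 y) * D y| ≤ η) →
      ∫⁻ y in (Icc (-(N + 2)) (N + 2))ᶜ, momentWeight r y ∂(μ₀.map (Φ (-1))) < ε / 2 / 2 →
      ∫⁻ y, momentWeight r y * ‖f₁ y - f₀ (Φ 1 y) * D y‖ₑ < ε := by
    intro w Φ D hf hclose htail
    have hadm := h₀.map (hf.apply_neg_apply 1) (hf.neg_apply_apply 1) hf.continuous_neg_one
      hf.hasDerivAt hf.contD hf.posD
    refine (lintegral_weight_le h₁ hadm hr hN2 hA hAN hclose).trans_lt ?_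
    have hκ' : μ₁ (Icc (-N) N \ A) * (2 * momentWeight r (N + 2)) < ε / 2 / 2 :=
      lt_of_le_of_lt (by gcongr) hκ
    rw [ENNReal.ofReal_coe_nnreal]
    calc _ < ε / 2 / 2 + ε / 2 / 2 + (ε / 2 / 2 + ε / 2 / 2) :=
          ENNReal.add_lt_add (ENNReal.add_lt_add hn1 hκ') (ENNReal.add_lt_add hη htail)
      _ = ε := by rw [ENNReal.add_halves, ENNReal.add_halves]
  -- With a finite moment, the compactly supported field is used and the tails of `μ₀` dominate.
  -- Without it, those tails are of no help, and the field with fast growing `S` is used.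
  by_cases h : FiniteMoment r μ₀
  · obtain ⟨w, Φ, D, hf, hK, a1, a2, a3⟩ := hfA
    refine ⟨w, Φ, D, hf, hfin hf a3 ?_, fun _ => hK⟩
    exact (lintegral_tail_map_le hr (by linarith) hf.continuous_neg_one.measurable
      (hf.apply_neg_apply 1) a1 a2).trans_lt (hn3 h)
  · obtain ⟨w, Φ, D, hf, a1, a2, a3⟩ := hfB
    refine ⟨w, Φ, D, hf, hfin hf a3 ?_, fun h' => absurd h' h⟩
    exact hgrow _ _ hf.continuous_neg_one.measurable (hf.apply_neg_apply 1) a1 a2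

end AutonomousTransport

/-! ### The two density statements -/

theorem mainTheorem2 (μ₀ μ₁ : Measure ℝ) (f₀ f₁ : ℝ → ℝ)
    (h₀ : AutonomousTransport.IsAdmissible μ₀ f₀)
    (h₁ : AutonomousTransport.IsAdmissible μ₁ f₁) (ε : ℝ) (hε : 0 < ε) :
    (∃ (ν : Measure ℝ) (g v : ℝ → ℝ),
      AutonomousTransport.IsAdmissible ν g ∧
      AutonomousTransport.l1Dist f₁ g < ENNReal.ofReal ε ∧
      AutonomousTransport.Realizes μ₀ ν v ∧
      (AutonomousTransport.IsLipschitzOn f₀ μ₀.support →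
        AutonomousTransport.IsLipschitzOn v (AutonomousTransport.hull μ₀ ν))) ∧
    (∀ p : ℝ, 1 ≤ p → AutonomousTransport.FiniteMoment p μ₁ →
      ∃ (ν : Measure ℝ) (g v : ℝ → ℝ),
        AutonomousTransport.IsAdmissible ν g ∧
        AutonomousTransport.wassersteinDist p μ₁ ν < ENNReal.ofReal ε ∧
        AutonomousTransport.Realizes μ₀ ν v ∧
        (AutonomousTransport.IsLipschitzOn f₀ μ₀.support →
          LocallyLipschitzOn (AutonomousTransport.hull μ₀ ν) v ∧
          (AutonomousTransport.FiniteMoment p μ₀ →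
            AutonomousTransport.IsLipschitzOn v (AutonomousTransport.hull μ₀ ν)))) := by
  have hε' : ENNReal.ofReal ε ≠ 0 := (ENNReal.ofReal_pos.2 hε).ne'
  have hP₀ := h₀.isProbabilityMeasure
  have hP₁ := h₁.isProbabilityMeasure
  have hadm : ∀ {w Φ D}, AutonomousTransport.IsFlowField w Φ D →
      AutonomousTransport.IsAdmissible (μ₀.map (Φ (-1))) (fun y => f₀ (Φ 1 y) * D y) :=
    fun hf => h₀.map (hf.apply_neg_apply 1) (hf.neg_apply_apply 1) hf.continuous_neg_one
      hf.hasDerivAt hf.contD hf.posD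
  refine ⟨?_, fun p hp hm => ?_⟩
  · have hm0 : ∀ (μ : Measure ℝ) [IsProbabilityMeasure μ],
        AutonomousTransport.FiniteMoment 0 μ := fun μ _ => by
      simp [AutonomousTransport.FiniteMoment]
    obtain ⟨w, Φ, D, hf, hlt, hK⟩ := AutonomousTransport.exists_flowField_lintegral_lt h₀ h₁
      le_rfl (hm0 μ₁) hε'
    refine ⟨_, _, _, hadm hf, lt_of_le_of_lt (lintegral_mono fun y => ?_) hlt,
      hf.realizes h₀.convex_support hf.continuous_neg_one, fun _ => ?_⟩
    · exact le_mul_of_one_le_left' le_self_add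
    · obtain ⟨K, hK⟩ := hK (hm0 μ₀)
      exact ⟨K, hK.neg.lipschitzOnWith⟩
  · have hp0 : 0 < p := by linarith
    have hCtop : (2 : ℝ≥0∞) ^ (p - 1) ≠ ∞ :=
      ENNReal.rpow_ne_top_of_nonneg (by linarith) (by norm_num)
    have hεp : ENNReal.ofReal ε ^ p ≠ 0 :=
      (ENNReal.rpow_pos (ENNReal.ofReal_pos.2 hε) ENNReal.ofReal_ne_top).ne'
    -- This `δ` is the size of the weighted `L¹` distance for which `(2 ^ (p - 1) * δ) ^ (1 / p)`
    -- stays below `ε`.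
    obtain ⟨δ, hδ0, hδ⟩ := ENNReal.exists_pos_mul_lt hCtop hεp
    obtain ⟨w, Φ, D, hf, hlt, hK⟩ := AutonomousTransport.exists_flowField_lintegral_lt h₀ h₁
      hp0.le hm hδ0.ne'
    refine ⟨_, _, _, hadm hf, ?_, hf.realizes h₀.convex_support hf.continuous_neg_one,
      fun _ => ⟨?_, fun hm0 => ?_⟩⟩
    · refine (AutonomousTransport.wassersteinDist_le h₁ (hadm hf) hp).trans_lt ?_
      rw [one_div, ENNReal.rpow_inv_lt_iff hp0]
      refine lt_of_le_of_lt ?_ hδ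
      rw [mul_comm]
      gcongr
      refine le_trans (lintegral_mono fun y => ?_) hlt.le
      exact mul_le_mul_left le_add_self _
    · exact LocallyLipschitz.locallyLipschitzOn hf.lip.neg
    · obtain ⟨K, hK⟩ := hK hm0
      exact ⟨K, hK.neg.lipschitzOnWith⟩
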